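/- Let $n\ge 2$, let $\Omega\subset\mathbb R\times\mathbb R^{n+1}$ be open with coordinates $(x,y_0,\dots,y_n)$, and let $f\colon\Omega\to\mathbb R$ be smooth. Consider the ordinary differential equation $\mathcal E$: $y^{(n+1)}=f(x,y,y',\dots,y^{(n)})$. A solution is a function $y$ of class $C^{n+1}$ on a nonempty open interval $I_y$ that satisfies the equation, and its lift is $x\mapsto (x,y(x),\dots,y^{(n)}(x))\in\Omega$. The lifts of the solutions form a one-dimensional foliation of $\Omega$. Let $\mathcal S$ be its space of leaves with the quotient topology, $\pi\colon\Omega\to\mathcal S$ the projection, and $[y]\in\mathcal S$ the leaf that contains the lift of $y$. The linearization of $\mathcal E$ along $y$ is $h^{(n+1)}=\sum_{i=0}^n\frac{\partial f}{\partial y_i}h^{(i)}$ on $I_y$, with coefficients evaluated on the lift of $y$; let $V_y$ be its solution space. Wilczynski invariants. Locally, every linear equation $h^{(n+1)}+p_n(x)h^{(n)}+\dots+p_0(x)h=0$ can be brought by a smooth transformation $(x,h)\mapsto(\lambda(x),\mu(x)h)$ with $\lambda'\ne0$, $\mu\neq 0$ to a form $g^{(n+1)}+q_{n-2}(t)g^{(n-2)}+\dots+q_0(t)g=0$.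 Its Wilczynski invariants are the functions $(\lambda')^k\cdot(\theta_k\circ\lambda)$, $3\le k\le n+1$, where $$\theta_k=\sum_{j=1}^{k-2}(-1)^{j+1}\frac{(2k-j-1)!\,(n-k+j)!}{(k-j)!\,(j-1)!}\,q_{n-k+j}^{(j-1)};$$ they do not depend on the choice of $\lambda,\mu$. The generalized Wilczynski invariants $W_3,\dots,W_{n+1}$ of $\mathcal E$ are the functions on $\Omega$ which, evaluated along any solution $y$, give the Wilczynski invariants of the linearization of $\mathcal E$ along $y$. $GL(2,\mathbb R)$-structures. Let $V_n=S^n(\mathbb R^2)$ be the space of homogeneous polynomials of degree $n$ in two variables, with the irreducible representation $\rho_n\colon GL(2,\mathbb R)\to GL(V_n)$ induced by the standard one. An irreducible $GL(2,\mathbb R)$-structure (paraconformal structure) on an $(n+1)$-dimensional smooth manifold $S$ is a smooth reduction $P$ of its frame bundle, whose fibre at $s$ consists of all linear isomorphisms $V_n\to T_sS$, to the group $\rho_n(GL(2,\mathbb R))$. Theorem. Suppose that $W_3,\dots,W_{n+1}$ vanish identically and that $\mathcal S$ is Hausdorff. Then: 1. $\mathcal S$ is second countable and carries the structure of a smooth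 $(n+1)$-dimensional manifold such that $\pi$ is a smooth submersion. 2. For every solution $y$, the linearization of $\mathcal E$ along $y$ is trivializable: near each point of $I_y$ a transformation $(x,h)\mapsto(\lambda(x),\mu(x)h)$ brings it to $h^{(n+1)}=0$. 3. For every solution $y$ there is a linear isomorphism $\Theta_y\colon V_y\to T_{[y]}\mathcal S$ such that, for every $x\in I_y$ and $h\in V_y$, $\Theta_y(h)$ is the image under $d\pi$ of the vector $\bigl(0,h(x),h'(x),\dots,h^{(n)}(x)\bigr)$ tangent to $\Omega$ at the point $(x,y(x),\dots,y^{(n)}(x))$. 4. There is an irreducible $GL(2,\mathbb R)$-structure $P$ on $\mathcal S$ whose frames are given as follows: for every solution $y$, a linear isomorphism $\varphi\colon V_n\to T_{[y]}\mathcal S$ belongs to $P$ if and only if, for every $x\in I_y$ and every $h\in V_y$ with $h(x)=\dots=h^{(n-1)}(x)=0$ and $h^{(n)}(x)>0$, the vector $\Theta_y(h)$ equals $\varphi(\ell^n)$ for some $\ell\in\mathbb R^2$. In particular, the lines in $T_{[y]}\mathcal S$ formed by the solutions of the linearization that vanish to order $n$ at a point of $I_y$ all lie on the cone $\{c\,\varphi(\ell^n)\mid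 c\in\mathbb R,\ \ell\in\mathbb R^2\}$, $\varphi\in P$, over a rational normal curve. -/

import Mathlib

open scoped ContDiff Manifold Nat

noncomputable section

/-! ### Jets of functions and linear equations -/

/-- The fibre part `(y, y', …, y⁽ⁿ⁾)` of the `n`-jet of a function `y` at `x`. -/
def jet (n : ℕ) (y : ℝ → ℝ) (x : ℝ) : Fin (n + 1) → ℝ :=
  fun i => iteratedDeriv i y x

/-- `h` solves `h⁽ⁿ⁺¹⁾ + pₙ h⁽ⁿ⁾ + ⋯ + p₀ h = 0` on the set `J` (used for open `J` only). -/
def IsLinearSolution (n : ℕ) (p : Fin (n + 1) → ℝ → ℝ) (J : Set ℝ) (h : ℝ → ℝ) : Prop :=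
  ContDiffOn ℝ (n + 1 : ℕ) h J ∧
    ∀ x ∈ J, iteratedDeriv (n + 1) h x + ∑ i : Fin (n + 1), p i x * iteratedDeriv i h x = 0

/-- On the open interval `J`, the transformation `(x, y) ↦ (lam x, mu x * y)` is invertible and
carries the linear equation with coefficients `p` to the one with coefficients `q` on `lam '' J`:
the graph of `g` is the image of the graph of `x ↦ g (lam x) / mu x`. -/
structure IsLinearEquivalence (n : ℕ) (p : Fin (n + 1) → ℝ → ℝ) (J : Set ℝ)
    (lam mu : ℝ → ℝ) (q : Fin (n + 1) → ℝ → ℝ) : Prop where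
  isOpen : IsOpen J
  isPreconnected : IsPreconnected J
  contDiffOn_lam : ContDiffOn ℝ ∞ lam J
  contDiffOn_mu : ContDiffOn ℝ ∞ mu J
  deriv_lam_ne_zero : ∀ x ∈ J, deriv lam x ≠ 0
  mu_ne_zero : ∀ x ∈ J, mu x ≠ 0
  solution_iff : ∀ g : ℝ → ℝ, IsLinearSolution n q (lam '' J) g ↔
    IsLinearSolution n p J (fun x => g (lam x) / mu x)

/-- A linear equation on an open set `I` is trivializable if near each point of `I` it can be
brought to `y⁽ⁿ⁺¹⁾ = 0` by a transformation `(x, y) ↦ (lam x, mu x * y)`. -/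
def IsTrivializable (n : ℕ) (p : Fin (n + 1) → ℝ → ℝ) (I : Set ℝ) : Prop :=
  ∀ x ∈ I, ∃ J ⊆ I, x ∈ J ∧ ∃ lam mu : ℝ → ℝ, IsLinearEquivalence n p J lam mu 0

/-- Laguerre–Forsyth form on `J'`: the coefficients of `y⁽ⁿ⁾` and `y⁽ⁿ⁻¹⁾` vanish. -/
def IsLaguerreForsyth (n : ℕ) (q : Fin (n + 1) → ℝ → ℝ) (J' : Set ℝ) : Prop :=
  ∀ t ∈ J', ∀ i : Fin (n + 1), n - 1 ≤ (i : ℕ) → q i t = 0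

/-- The expression for the Wilczynski invariant `θₖ` (`3 ≤ k ≤ n + 1`) of an equation
`y⁽ⁿ⁺¹⁾ + qₙ₋₂ y⁽ⁿ⁻²⁾ + ⋯ + q₀ y = 0` in Laguerre–Forsyth form. In this range of `k` all
subtractions are exact and the index `n - k + j` is at most `n - 2`. -/
def laguerreForsythTheta (n k : ℕ) (q : Fin (n + 1) → ℝ → ℝ) (t : ℝ) : ℝ :=
  ∑ j ∈ Finset.Icc 1 (k - 2),
    (-1 : ℝ) ^ (j + 1) *
      (((2 * k - j - 1)! * (n + j - k)! : ℕ) : ℝ) / (((k - j)! * (j - 1)! : ℕ) : ℝ) *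
      iteratedDeriv (j - 1) (q (Fin.ofNat (n + 1) (n + j - k))) t

/-- `w` is the Wilczynski invariant of weight `k` of the linear equation with coefficients `p` on
`I`: whenever the equation is brought, on an interval `J ⊆ I`, to a Laguerre–Forsyth form, `w` is
`(lam')ᵏ` times the pull-back of `θₖ` of that form. (Such forms exist near each point, so that `w`
is determined on `I`.) -/
def IsWilczynskiInvariant (n k : ℕ) (p : Fin (n + 1) → ℝ → ℝ) (I : Set ℝ) (w : ℝ → ℝ) : Prop :=
  ∀ J ⊆ I, ∀ (lam mu : ℝ → ℝ) (q : Fin (n + 1) → ℝ → ℝ),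
    IsLinearEquivalence n p J lam mu q → IsLaguerreForsyth n q (lam '' J) →
      ∀ x ∈ J, w x = deriv lam x ^ k * laguerreForsythTheta n k q (lam x)

/-! ### Nonlinear equations, their solutions, and the solution space -/

/-- A smooth ordinary differential equation `y⁽ⁿ⁺¹⁾ = f (x, y, y', …, y⁽ⁿ⁾)`, with `f` defined on
an open set of the space of `n`-jets. This open set, with coordinates `(x, y₀, …, yₙ)`, is also the
equation manifold. -/
structure ODE (n : ℕ) where
  domain : TopologicalSpace.Opens (ℝ × (Fin (n + 1) → ℝ))
  rhs : ℝ × (Fin (n + 1) → ℝ) → ℝ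
  contDiffOn_rhs : ContDiffOn ℝ ∞ rhs domain

namespace ODE

variable {n : ℕ} (E : ODE n)

/-- A solution of the equation on some nonempty open interval. -/
structure Solution where
  interval : Set ℝ
  toFun : ℝ → ℝ
  isOpen : IsOpen interval
  nonempty : interval.Nonempty
  isPreconnected : IsPreconnected interval
  contDiffOn : ContDiffOn ℝ (n + 1 : ℕ) toFun interval
  jet_mem : ∀ x ∈ interval, (x, jet n toFun x) ∈ E.domain
  eq_rhs : ∀ x ∈ interval, iteratedDeriv (n + 1) toFun x = E.rhs (x, jet n toFun x)

variable {E}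

/-- The lift of a solution to the equation manifold. -/
def Solution.lift (y : E.Solution) (x : y.interval) : E.domain :=
  ⟨((x : ℝ), jet n y.toFun x), y.jet_mem x x.2⟩

variable (E)

/-- Two points of the equation manifold are related if the lift of a solution passes through both,
that is, if they lie on the same leaf of the foliation formed by all solutions. -/
def SameSolution (a b : E.domain) : Prop :=
  ∃ (y : E.Solution) (x x' : y.interval), y.lift x = a ∧ y.lift x' = b

/-- The solution space: the quotient of the equation manifold by the foliation formed by all
solutions, with the quotient topology. -/
def SolutionSpace : Type := Quot E.SameSolution

instance : TopologicalSpace E.SolutionSpace :=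
  inferInstanceAs (TopologicalSpace (Quot E.SameSolution))

/-- The projection of the equation manifold to the solution space. -/
def proj (a : E.domain) : E.SolutionSpace := Quot.mk E.SameSolution a

variable {E}

/-- The point of the solution space that a solution defines. -/
def Solution.point (y : E.Solution) : E.SolutionSpace :=
  E.proj (y.lift ⟨y.nonempty.choose, y.nonempty.choose_spec⟩)

theorem Solution.proj_lift (y : E.Solution) (x : y.interval) : E.proj (y.lift x) = y.point :=
  Quot.sound ⟨y, x, _, rfl, rfl⟩

/-- The coefficients of the linearization
`h⁽ⁿ⁺¹⁾ - ∑ᵢ (∂f/∂yᵢ) (x, y, …, y⁽ⁿ⁾) h⁽ⁱ⁾ = 0` along a solution `y`. -/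
def Solution.linearization (y : E.Solution) (i : Fin (n + 1)) (x : ℝ) : ℝ :=
  -(fderiv ℝ E.rhs (x, jet n y.toFun x) (0, Pi.single i 1))

/-- The solution space of the linearization along `y`, on the interval of `y`. Its elements are
extended by zero, so that they are determined by their values on the interval. -/
def Solution.linearSolutions (y : E.Solution) : Submodule ℝ (ℝ → ℝ) where
  carrier := {h | IsLinearSolution n y.linearization y.interval h ∧ ∀ x ∉ y.interval, h x = 0}
  zero_mem' := by
    refine ⟨⟨contDiffOn_const, fun x _ => ?_⟩, fun _ _ => rfl⟩
    have h0 : ∀ k : ℕ, iteratedDeriv k (0 : ℝ → ℝ) x = 0 := fun k => by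
      simp
    simp [h0]
  add_mem' := by
    rintro a b ⟨⟨ha, ha'⟩, ha0⟩ ⟨⟨hb, hb'⟩, hb0⟩
    refine ⟨⟨ha.add hb, fun x hx => ?_⟩, fun x hx => by simp [ha0 x hx, hb0 x hx]⟩
    have hax := ha.contDiffAt (y.isOpen.mem_nhds hx)
    have hbx := hb.contDiffAt (y.isOpen.mem_nhds hx)
    have key : ∀ k : ℕ, k ≤ n + 1 →
        iteratedDeriv k (a + b) x = iteratedDeriv k a x + iteratedDeriv k b x := fun k hk =>
      iteratedDeriv_add (hax.of_le (by exact_mod_cast hk)) (hbx.of_le (by exact_mod_cast hk))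
    rw [key _ le_rfl, Finset.sum_congr rfl fun i _ => by rw [key i i.2.le, mul_add],
      Finset.sum_add_distrib]
    linarith [ha' x hx, hb' x hx]
  smul_mem' := by
    rintro c a ⟨⟨ha, ha'⟩, ha0⟩
    refine ⟨⟨contDiffOn_const.smul ha, fun x hx => ?_⟩, fun x hx => by simp [ha0 x hx]⟩
    have hax := ha.contDiffAt (y.isOpen.mem_nhds hx)
    have key : ∀ k : ℕ, k ≤ n + 1 → iteratedDeriv k (c • a) x = c * iteratedDeriv k a x :=
      fun k hk => by
        simp
    rw [key _ le_rfl, Finset.sum_congr rfl fun i _ => by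
      rw [key i i.2.le, mul_left_comm], ← Finset.mul_sum, ← mul_add, ha' x hx, mul_zero]

variable (E)

/-- `W`, a function on the equation manifold, is the generalized Wilczynski invariant of weight `k`:
evaluated along any solution it gives the Wilczynski invariant of weight `k` of the linearization
along that solution. -/
def IsGeneralizedWilczynskiInvariant (k : ℕ) (W : ℝ × (Fin (n + 1) → ℝ) → ℝ) : Prop :=
  ∀ y : E.Solution, IsWilczynskiInvariant n k y.linearization y.interval
    (fun x => W (x, jet n y.toFun x))

end ODE

/-! ### Irreducible `GL(2, ℝ)`-structures -/

/-- `Vₙ = Sⁿ(ℝ²)`: homogeneous polynomials of degree `n` in two variables `v₁, v₂`. -/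
abbrev BinaryForm (n : ℕ) : Type := MvPolynomial.homogeneousSubmodule (Fin 2) ℝ n

/-- The vector `a v₁ + b v₂` of `ℝ²`, as a linear form in the variables. -/
def linearForm (l : Fin 2 → ℝ) : MvPolynomial (Fin 2) ℝ :=
  ∑ i, MvPolynomial.C (l i) * MvPolynomial.X i

theorem linearForm_isHomogeneous (l : Fin 2 → ℝ) : (linearForm l).IsHomogeneous 1 :=
  MvPolynomial.IsHomogeneous.sum _ _ _ fun i _ => MvPolynomial.isHomogeneous_C_mul_X (l i) i

/-- The `n`-th power of a vector of `ℝ²`. The lines spanned by the `n`-th powers of nonzero vectors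
form the rational normal curve in the projective space of `Vₙ`. -/
def linearPower (n : ℕ) (l : Fin 2 → ℝ) : BinaryForm n :=
  ⟨linearForm l ^ n, by simpa using (linearForm_isHomogeneous l).pow n⟩

/-- The irreducible representation `ρₙ` of `GL(2, ℝ)` on `Vₙ`: the action on the vectors
`v₁, v₂` of `ℝ²`, `vⱼ ↦ ∑ᵢ gᵢⱼ vᵢ`, extended to `Sⁿ(ℝ²)`. -/
def binaryFormRep (n : ℕ) (g : GL (Fin 2) ℝ) : BinaryForm n →ₗ[ℝ] BinaryForm n :=
  (MvPolynomial.aeval fun j => linearForm fun i => g.1 i j).toLinearMap.restrict fun P hP => by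
    have h := MvPolynomial.IsHomogeneous.aeval (n := 1) hP (fun j => linearForm fun i => g.1 i j)
      (fun j => linearForm_isHomogeneous _)
    simpa using h

/-- An irreducible `GL(2, ℝ)`-structure on an `(n + 1)`-dimensional manifold: a reduction of the
frame bundle, whose points are the linear isomorphisms `Vₙ → TₛS`, to the group `ρₙ(GL(2, ℝ))`. -/
structure GL2Structure (n : ℕ) (S : Type) [TopologicalSpace S]
    [ChartedSpace (EuclideanSpace ℝ (Fin (n + 1))) S]
    [IsManifold 𝓘(ℝ, EuclideanSpace ℝ (Fin (n + 1))) ∞ S] where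
  /-- the frames of the structure at each point -/
  frames : (s : S) → Set (BinaryForm n ≃ₗ[ℝ] TangentSpace 𝓘(ℝ, EuclideanSpace ℝ (Fin (n + 1))) s)
  /-- the frames at a point form one orbit of `ρₙ(GL(2, ℝ))` -/
  orbit : ∀ s, ∀ u ∈ frames s, ∀ u',
    u' ∈ frames s ↔ ∃ g : GL (Fin 2) ℝ, ∀ v, u' v = u (binaryFormRep n g v)
  /-- smooth local sections exist near each point -/
  exists_section : ∀ s₀ : S, ∃ U : Set S, IsOpen U ∧ s₀ ∈ U ∧
    ∃ σ : (s : S) → (BinaryForm n ≃ₗ[ℝ] TangentSpace 𝓘(ℝ, EuclideanSpace ℝ (Fin (n + 1))) s),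
      (∀ s ∈ U, σ s ∈ frames s) ∧
      ∀ v : BinaryForm n, ContMDiffOn 𝓘(ℝ, EuclideanSpace ℝ (Fin (n + 1)))
        (𝓘(ℝ, EuclideanSpace ℝ (Fin (n + 1)))).tangent ∞
        (fun s => (⟨s, σ s v⟩ : TangentBundle 𝓘(ℝ, EuclideanSpace ℝ (Fin (n + 1))) S)) U

end

/-! The space of leaves. The lifts are the integral curves of the smooth field `(1, field)`, so they
are graphs over intervals of the `x`-axis, and each meets a slice `x = const` at most once. The
maximal flow `E.flow` is smooth on an open domain (`contDiffAt_flow`, `isOpen_flowDomain`). Moving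
points along leaves into a slice therefore gives charts of `SolutionSpace`, with flow maps between
slices as transition maps. It also shows that the projection is open, which gives second
countability, and that it is a submersion.

Tangent spaces. By the symmetry of second derivatives, the vertical derivative `flowDeriv` of the
flow solves the variational equation (`hasDerivAt_flowDeriv`), so it transports the jets of
solutions of the linearization. Since the projection is constant along the flow, the image under it
of the jet of `h` at `x` does not depend on `x`. This is `Solution.tangentEquiv`, the map `Θ`.

Trivialization. A linear equation of order `n + 1` determines a second order equation `v'' + a v' +
b v = 0` whose `n`-th symmetric power has the same coefficients of `h⁽ⁿ⁾` and `h⁽ⁿ⁻¹⁾`. For a basis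
`v, w` of its solutions with `v > 0`, the substitution `h = vⁿ g(w / v)` leads to a Laguerre–Forsyth
form (`exists_laguerreForsyth`). The invariants `θₖ` are triangular in the remaining coefficients,
so if all of them vanish the form is `g⁽ⁿ⁺¹⁾ = 0` (`IsLaguerreForsyth.eq_zero`). Locally, then, the
solutions of the linearization are the binary forms of degree `n` in `w, v`.

The structure. This identification with `Vₙ` is a frame in which the solutions vanishing to order
`n` at `x` are the multiples of `(v(x) w - w(x) v)ⁿ`, a point of the rational normal curve. The
remaining problem is independence of the choices. It is solved by rigidity
(`BinaryForm.exists_eq_binaryFormRep`): a linear automorphism taking infinitely many points of the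
cone over the curve into the cone lies in `ρₙ(GL(2, ℝ))`. Rigidity shows that adapted frames over a
leaf form one orbit, and that a frame adapted on some interval is adapted along the whole leaf. For
smoothness, the pair is normalized at each point of a slice. The jets of the resulting solutions are
iterated derivatives of a polynomial along a smooth vector field (`frameJet`), hence smooth
functions of the point. -/

noncomputable section

/-! ### Composition operators and smooth local flows -/

section CompositionOperator

open scoped Topology

variable {K : Type} [TopologicalSpace K] [CompactSpace K]
  {E : Type} [NormedAddCommGroup E] [NormedSpace ℝ E]
  {F : Type} [NormedAddCommGroup F] [NormedSpace ℝ F]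

/-- Pointwise application of a family of continuous linear maps, as a continuous bilinear map. -/
def ContinuousMap.applyCLM : C(K, E →L[ℝ] F) →L[ℝ] C(K, E) →L[ℝ] C(K, F) :=
  LinearMap.mkContinuous₂
    (LinearMap.mk₂ ℝ (fun (A : C(K, E →L[ℝ] F)) (v : C(K, E)) =>
        (⟨fun t => A t (v t), by fun_prop⟩ : C(K, F)))
      (fun _ _ _ => by ext; simp) (fun _ _ _ => by ext; simp)
      (fun _ _ _ => by ext; simp) (fun _ _ _ => by ext; simp)) 1 (by
    intro A v
    rw [ContinuousMap.norm_le _ (by positivity)]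
    intro t
    calc ‖A t (v t)‖ ≤ ‖A t‖ * ‖v t‖ := (A t).le_opNorm _
      _ ≤ 1 * ‖A‖ * ‖v‖ := by
        rw [one_mul]
        exact mul_le_mul (A.norm_coe_le_norm t) (v.norm_coe_le_norm t) (norm_nonneg (v t))
          (norm_nonneg A))

/-- The mean value inequality at each parameter `t` bounds the remainder, and compactness of the
range of `u` makes the bound uniform in `t`. -/
theorem hasFDerivAt_comp_continuousMap {X : E → F} (hX : ContDiff ℝ 1 X) (u : C(K, E)) :
    HasFDerivAt (fun u : C(K, E) => (⟨X, hX.continuous⟩ : C(E, F)).comp u)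
      (ContinuousMap.applyCLM
        ((⟨fderiv ℝ X, hX.continuous_fderiv one_ne_zero⟩ : C(E, E →L[ℝ] F)).comp u)) u := by
  rw [hasFDerivAt_iff_isLittleO_nhds_zero, Asymptotics.isLittleO_iff]
  intro ε hε
  have hK : IsCompact (Set.range u) := isCompact_range u.continuous
  -- The derivative of `X` is uniformly continuous at the compact range of `u`, even against points
  -- off the range, so one `δ` serves all `t`.
  have hunif := hK.uniformContinuousAt_of_continuousAt (fderiv ℝ X)
    (fun a _ => (hX.continuous_fderiv one_ne_zero).continuousAt) (Metric.dist_mem_uniformity hε)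
  obtain ⟨δ, hδ, hδ'⟩ := Metric.mem_uniformity_dist.1 hunif
  filter_upwards [Metric.ball_mem_nhds (0 : C(K, E)) hδ] with h hh
  rw [ContinuousMap.norm_le _ (by positivity)]
  intro t
  have ht : ‖h t‖ < δ := (h.norm_coe_le_norm t).trans_lt (by simpa using hh)
  have key : ‖X (u t + h t) - X (u t) - fderiv ℝ X (u t) (u t + h t - u t)‖ ≤
      ε * ‖u t + h t - u t‖ := (convex_ball (u t) δ).norm_image_sub_le_of_norm_fderiv_le'
    (𝕜 := ℝ) (fun x _ => hX.differentiable one_ne_zero x) (fun x hx => by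
      have := hδ' (a := u t) (b := x) (by rw [dist_comm]; exact hx) ⟨t, rfl⟩
      rw [← dist_eq_norm, dist_comm]
      exact le_of_lt this) (Metric.mem_ball_self hδ) (by simpa using ht)
  simp only [add_sub_cancel_left] at key
  calc _ = ‖X (u t + h t) - X (u t) - fderiv ℝ X (u t) (h t)‖ := rfl
    _ ≤ ε * ‖h t‖ := key
    _ ≤ ε * ‖h‖ := by gcongr; exact h.norm_coe_le_norm t

/-- The derivative of the composition operator of `X` is the composition operator of `fderiv ℝ X`
followed by a continuous linear map, so the order of smoothness goes up by induction, with the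
target space varying. -/
theorem contDiff_comp_continuousMap {X : E → F} (hX : ContDiff ℝ ∞ X) :
    ContDiff ℝ ∞ (fun u : C(K, E) => (⟨X, hX.continuous⟩ : C(E, F)).comp u) := by
  rw [contDiff_infty]
  intro m
  induction m generalizing F with
  | zero =>
    exact contDiff_zero.2 (ContinuousMap.continuous_postcomp _)
  | succ m ih =>
    have hd := fun u : C(K, E) => hasFDerivAt_comp_continuousMap (hX.of_le (by simp)) u
    have hX' : ContDiff ℝ ∞ (fderiv ℝ X) := (contDiff_infty_iff_fderiv.1 hX).2
    rw [Nat.cast_succ, contDiff_succ_iff_fderiv]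
    refine ⟨fun u => (hd u).differentiableAt, by simp, ?_⟩
    have : fderiv ℝ (fun u : C(K, E) => (⟨X, hX.continuous⟩ : C(E, F)).comp u) =
        fun u => ContinuousMap.applyCLM
          ((⟨fderiv ℝ X, hX'.continuous⟩ : C(E, E →L[ℝ] F)).comp u) :=
      funext fun u => (hd u).fderiv
    rw [this]
    exact ContinuousMap.applyCLM.contDiff.comp (ih hX')

end CompositionOperator

/-! ### Smooth dependence on initial values via the implicit function theorem -/

section LocalFlow

open scoped Topology unitInterval

variable {E : Type} [NormedAddCommGroup E]

/-- The restriction of a curve to `[0, τ]`, rescaled to the unit interval. -/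
def rescaleCurve (τ : I) (u : C(I, E)) : C(I, E) := ⟨fun r => u (τ * r), by fun_prop⟩

theorem dist_rescaleCurve_const_le (τ : I) (u : C(I, E)) (a : E) :
    dist (rescaleCurve τ u) (ContinuousMap.const I a) ≤ dist u (ContinuousMap.const I a) := by
  rw [ContinuousMap.dist_le dist_nonneg]
  intro r
  exact ContinuousMap.dist_apply_le_dist (f := u) (g := ContinuousMap.const I a) (τ * r)

variable [NormedSpace ℝ E]

/-- The operator `u ↦ (t ↦ ∫₀ᵗ u)` on the continuous functions on the unit interval. -/
def unitIntervalPrimitive : C(I, E) →L[ℝ] C(I, E) :=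
  LinearMap.mkContinuous
    { toFun := fun u => ⟨fun t => (t : ℝ) • ∫ r : I, u (t * r), by
        have : Continuous fun t : I => ∫ r : I, u (t * r) := by
          have := continuous_parametric_integral_of_continuous (X := I) (Y := I)
            (μ := MeasureTheory.volume) (f := fun t r => u (t * r))
            (by unfold Function.uncurry; fun_prop) isCompact_univ
          simpa using this
        fun_prop⟩
      map_add' := fun u v => by
        ext t
        have hi : ∀ w : C(I, E), MeasureTheory.Integrable (fun r : I => w (t * r)) := fun w =>
          (by fun_prop : Continuous fun r : I => w (t * r)).integrable_of_hasCompactSupport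
            (HasCompactSupport.of_compactSpace _)
        simp [MeasureTheory.integral_add (hi u) (hi v)]
      map_smul' := fun c u => by
        ext t
        simp [MeasureTheory.integral_smul, smul_comm c] } 1 (by
    intro u
    rw [ContinuousMap.norm_le _ (by positivity)]
    intro t
    simp only [LinearMap.coe_mk, AddHom.coe_mk, ContinuousMap.coe_mk, norm_smul]
    refine mul_le_mul ?_ ?_ (norm_nonneg _) zero_le_one
    · rw [Real.norm_eq_abs, abs_of_nonneg t.2.1]
      exact t.2.2
    · refine (MeasureTheory.norm_integral_le_of_norm_le_const (C := ‖u‖)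
        (Filter.Eventually.of_forall fun r => u.norm_coe_le_norm _)).trans ?_
      simp)

theorem unitIntervalPrimitive_apply (u : C(I, E)) (t : I) :
    unitIntervalPrimitive u t = (t : ℝ) • ∫ r : I, u (t * r) := rfl

theorem unitIntervalPrimitive_rescaleCurve (τ t : I) (u : C(I, E)) :
    (τ : ℝ) • unitIntervalPrimitive (rescaleCurve τ u) t = unitIntervalPrimitive u (τ * t) := by
  simp [unitIntervalPrimitive_apply, rescaleCurve, mul_assoc, mul_smul]


/-- The rescaled integral equation `u(t) = a + s ∫₀ᵗ X(u)` for curves on the unit interval is solved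
for `u` by the implicit function theorem in `C(I, E)`, with parameters `(s, a)`. The flow is the
value of `u` at `t = 1`. -/
theorem exists_local_flow_of_contDiff [CompleteSpace E] {X : E → E} (hX : ContDiff ℝ ∞ X)
    (a₀ : E) :
    ∃ Φ : ℝ × E → E, ContDiffAt ℝ ∞ Φ (0, a₀) ∧ ∃ δ > 0, ∀ a ∈ Metric.ball a₀ δ,
      Φ (0, a) = a ∧ ∀ s ∈ Set.Ioo (-δ) δ, HasDerivAt (fun s => Φ (s, a)) (X (Φ (s, a))) s := by
  set N : C(I, E) → C(I, E) := fun u => (⟨X, hX.continuous⟩ : C(E, E)).comp u with hNdef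
  have hN : ContDiff ℝ ∞ N := contDiff_comp_continuousMap hX
  set cst : E →L[ℝ] C(I, E) := ContinuousLinearMap.const ℝ I with hcst
  have hcst' : ∀ a, cst a = ContinuousMap.const I a := fun _ => rfl
  set f : (ℝ × E) × C(I, E) → C(I, E) := fun v =>
    v.2 - cst v.1.2 - v.1.1 • unitIntervalPrimitive (N v.2) with hfdef
  set p : (ℝ × E) × C(I, E) := ((0, a₀), cst a₀) with hp
  have hf : ContDiff ℝ ∞ f := by
    have h1 : ContDiff ℝ ∞ fun v : (ℝ × E) × C(I, E) => unitIntervalPrimitive (N v.2) :=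
      unitIntervalPrimitive.contDiff.comp (hN.comp contDiff_snd)
    have h2 : ContDiff ℝ ∞ fun v : (ℝ × E) × C(I, E) => cst v.1.2 :=
      cst.contDiff.comp (contDiff_snd.comp contDiff_fst)
    exact (contDiff_snd.sub h2).sub ((contDiff_fst.comp contDiff_fst).smul h1)
  -- At `s = 0` the integral term disappears, so the partial derivative in `u` is the identity.
  have hinv : (fderiv ℝ f p ∘L .inr ℝ (ℝ × E) C(I, E)).IsInvertible := by
    have h1 : HasFDerivAt (fun u => f (p.1, u)) (fderiv ℝ f p ∘L .inr ℝ (ℝ × E) C(I, E)) p.2 :=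
      HasFDerivAt.comp (g := f) p.2 (hf.differentiable (by simp) p).hasFDerivAt
        (hasFDerivAt_prodMk_right p.1 p.2)
    have h2 : HasFDerivAt (fun u => f (p.1, u)) (ContinuousLinearMap.id ℝ C(I, E)) p.2 := by
      have : (fun u => f (p.1, u)) = fun u => u - cst a₀ := by
        ext u; simp [hfdef, hp]
      rw [this]
      exact (hasFDerivAt_id _).sub_const _
    rw [h1.unique h2]
    exact ⟨ContinuousLinearEquiv.refl ℝ _, rfl⟩
  have hne : (∞ : WithTop ℕ∞) ≠ 0 := by simp
  set g := hf.contDiffAt.implicitFunction hne hinv with hg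
  have hgs : ContDiffAt ℝ ∞ g (0, a₀) := hf.contDiffAt.contDiffAt_implicitFunction hne hinv
  have hg0 : g (0, a₀) = cst a₀ := hf.contDiffAt.implicitFunction_apply_self hne hinv
  have hfp : f p = 0 := by simp [hfdef, hp]
  have hex : ∀ᶠ x in 𝓝 ((0 : ℝ), a₀), f (x, g x) = 0 := by
    have := hf.contDiffAt.eventually_apply_implicitFunction hne hinv
    rwa [hfp] at this
  have huniq : ∀ᶠ v in 𝓝 p, f v = 0 → g v.1 = v.2 := by
    have := hf.contDiffAt.eventually_apply_eq_iff_implicitFunction hne hinv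
    rw [hfp] at this
    exact this.mono fun v hv => hv.1
  obtain ⟨η, hη, huniq⟩ := Metric.eventually_nhds_iff_ball.1 huniq
  have hnear : ∀ᶠ x in 𝓝 ((0 : ℝ), a₀), dist (g x) (cst a₀) < η / 2 := by
    have := hgs.continuousAt.tendsto
    rw [hg0] at this
    exact this (Metric.ball_mem_nhds _ (half_pos hη))
  have hcont : ∀ᶠ x in 𝓝 ((0 : ℝ), a₀), ContinuousAt g x :=
    ((hgs.of_le (by simp : (1 : WithTop ℕ∞) ≤ ∞)).eventually (by simp)).mono
      fun _ h => h.continuousAt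
  obtain ⟨r, hr, hball⟩ := Metric.eventually_nhds_iff_ball.1 (hex.and (hnear.and hcont))
  set δ := min r (η / 2) with hδdef
  have hδ : 0 < δ := lt_min hr (half_pos hη)
  have hmem : ∀ a ∈ Metric.ball a₀ δ, ∀ s ∈ Set.Ioo (-δ) δ, (s, a) ∈ Metric.ball ((0 : ℝ), a₀) δ := by
    intro a ha s hs
    rw [← ball_prod_same]
    refine ⟨?_, ha⟩
    simpa [abs_lt] using hs
  have hball' : ∀ x ∈ Metric.ball ((0 : ℝ), a₀) δ,
      f (x, g x) = 0 ∧ dist (g x) (cst a₀) < η / 2 ∧ ContinuousAt g x := fun x hx =>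
    hball x (Metric.ball_subset_ball (min_le_left _ _) hx)
  have hval : ∀ x ∈ Metric.ball ((0 : ℝ), a₀) δ, ∀ t : I,
      g x t = x.2 + x.1 • unitIntervalPrimitive (N (g x)) t := by
    intro x hx t
    have h := DFunLike.congr_fun (hball' x hx).1 t
    simp only [hfdef, hcst', ContinuousMap.sub_apply, ContinuousMap.smul_apply,
      ContinuousMap.const_apply, ContinuousMap.zero_apply] at h
    rw [sub_sub, sub_eq_zero] at h
    exact h
  -- The curve for `(s, a)` restricted to `[0, τ]` and rescaled solves the equation for `(s τ, a)`.
  -- It stays close to the constant curve, so local uniqueness in the implicit function theorem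
  -- identifies it.
  have hscale : ∀ a ∈ Metric.ball a₀ δ, ∀ s ∈ Set.Ioo (-δ) δ, ∀ τ : I,
      g (s * τ, a) = rescaleCurve τ (g (s, a)) := by
    intro a ha s hs τ
    have hx := hmem a ha s hs
    have hsτ : s * τ ∈ Set.Ioo (-δ) δ := by
      rw [Set.mem_Ioo, ← abs_lt] at hs ⊢
      rw [abs_mul, abs_of_nonneg τ.2.1]
      exact (mul_le_of_le_one_right (abs_nonneg _) τ.2.2).trans_lt hs
    refine huniq ((s * τ, a), rescaleCurve τ (g (s, a))) ?_ ?_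
    · rw [← ball_prod_same]
      refine ⟨Metric.ball_subset_ball ((min_le_right _ _).trans (half_le_self hη.le))
        (hmem a ha _ hsτ), ?_⟩
      refine (dist_rescaleCurve_const_le τ (g (s, a)) a₀).trans_lt ?_
      exact (hball' _ hx).2.1.trans (half_lt_self hη)
    · ext t
      have h1 := hval (s, a) hx (τ * t)
      have h2 := unitIntervalPrimitive_rescaleCurve τ t (N (g (s, a)))
      have h3 : N (rescaleCurve τ (g (s, a))) = rescaleCurve τ (N (g (s, a))) := rfl
      simp only [hfdef, hcst', ContinuousMap.sub_apply, ContinuousMap.smul_apply,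
        ContinuousMap.const_apply, ContinuousMap.zero_apply, h3, mul_smul, h2]
      change g (s, a) (τ * t) - a - _ = 0
      rw [h1]
      simp
  refine ⟨fun x => g x 1, ?_, δ, hδ, fun a ha => ⟨?_, fun s hs => ?_⟩⟩
  · exact (ContinuousMap.evalCLM ℝ (1 : I)).contDiff.contDiffAt.comp _ hgs
  · have := hval (0, a) (hmem a ha 0 ⟨by linarith, hδ⟩) 1
    simpa using this
  · set γ : ℝ → E := fun s => g (s, a) 1 with hγ
    have hγc : ContinuousOn γ (Set.Ioo (-δ) δ) := by
      intro s hs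
      have h1 : ContinuousAt (fun s : ℝ => g (s, a)) s :=
        ContinuousAt.comp (g := g) (f := fun s : ℝ => (s, a)) (hball' _ (hmem a ha s hs)).2.2
          (by fun_prop)
      exact ((ContinuousMap.evalCLM ℝ (1 : I)).continuous.continuousAt.comp h1).continuousWithinAt
    have hXγ : ContinuousOn (fun s => X (γ s)) (Set.Ioo (-δ) δ) :=
      hX.continuous.comp_continuousOn hγc
    -- By `hscale` the curve `g (s, a)` traces the values of `γ` between `0` and `s`; the equation
    -- in `C(I, E)` becomes the usual integral equation for `γ`.
    have hint : ∀ s ∈ Set.Ioo (-δ) δ, γ s = a + ∫ q in (0 : ℝ)..s, X (γ q) := by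
      intro s hs
      have h1 := hval (s, a) (hmem a ha s hs) 1
      have h2 : ∀ r : I, g (s, a) r = γ (s * r) := by
        intro r
        have := DFunLike.congr_fun (hscale a ha s hs r) 1
        simpa [rescaleCurve] using this.symm
      have h3 : ∫ r : I, X (γ (s * r)) = ∫ r in (0 : ℝ)..1, X (γ (s * r)) := by
        rw [intervalIntegral.integral_of_le zero_le_one, ← MeasureTheory.integral_Icc_eq_integral_Ioc]
        exact MeasureTheory.integral_subtype (α := ℝ) measurableSet_Icc (fun r => X (γ (s * r)))
      change γ s = _ at h1
      rw [h1]
      congr 1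
      simp only [unitIntervalPrimitive_apply, hNdef, one_mul, ContinuousMap.comp_apply,
        ContinuousMap.coe_mk, h2, h3, Set.Icc.coe_one, one_smul]
      rw [intervalIntegral.smul_integral_comp_mul_left (fun q => X (γ q)) s]
      simp
    have hder : HasDerivAt (fun s => a + ∫ q in (0 : ℝ)..s, X (γ q)) (X (γ s)) s := by
      have hsub : Set.uIcc 0 s ⊆ Set.Ioo (-δ) δ :=
        Set.OrdConnected.uIcc_subset Set.ordConnected_Ioo ⟨by linarith, hδ⟩ hs
      exact (intervalIntegral.integral_hasDerivAt_right
        ((hXγ.mono hsub).intervalIntegrable)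
        (hXγ.stronglyMeasurableAtFilter isOpen_Ioo s hs)
        (hXγ.continuousAt (isOpen_Ioo.mem_nhds hs))).const_add a
    exact hder.congr_of_eventuallyEq
      (Filter.eventually_of_mem (isOpen_Ioo.mem_nhds hs) hint)

/-- A smooth vector field on an open set has a smooth local flow near each point. -/
theorem exists_local_flow [FiniteDimensional ℝ E] {X : E → E} {U : Set E} (hU : IsOpen U)
    (hX : ContDiffOn ℝ ∞ X U) {a₀ : E} (ha₀ : a₀ ∈ U) :
    ∃ Φ : ℝ × E → E, ContDiffAt ℝ ∞ Φ (0, a₀) ∧ ∃ δ > 0, ∀ a ∈ Metric.ball a₀ δ,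
      Φ (0, a) = a ∧ ∀ s ∈ Set.Ioo (-δ) δ, Φ (s, a) ∈ U ∧
        HasDerivAt (fun s => Φ (s, a)) (X (Φ (s, a))) s := by
  have : CompleteSpace E := FiniteDimensional.complete ℝ E
  obtain ⟨ε, hε, hεU⟩ := Metric.isOpen_iff.1 hU a₀ ha₀
  -- Cutting off makes the field global; where the bump equals `1`, on the ball of radius `ε / 3`,
  -- its integral curves are those of `X`.
  let χ : ContDiffBump a₀ := ⟨ε / 3, ε / 2, by positivity, by linarith⟩
  have hsm : ContDiff ℝ ∞ fun a => χ a • X a := by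
    rw [contDiff_iff_contDiffAt]
    intro a
    by_cases ha : a ∈ U
    · exact χ.contDiff.contDiffAt.smul (hX.contDiffAt (hU.mem_nhds ha))
    · have : (fun a => χ a • X a) =ᶠ[𝓝 a] fun _ => 0 := by
        have h : a ∉ Metric.closedBall a₀ (ε / 2) := fun h =>
          ha (hεU (Metric.closedBall_subset_ball (by linarith) h))
        filter_upwards [Metric.isClosed_closedBall.isOpen_compl.mem_nhds h] with b hb
        rw [χ.zero_of_le_dist, zero_smul]
        simpa using (not_le.1 (fun h => hb (Metric.mem_closedBall.2 h))).le
      exact contDiffAt_const.congr_of_eventuallyEq this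
  obtain ⟨Φ, hΦ, δ, hδ, h⟩ := exists_local_flow_of_contDiff hsm a₀
  have h0 : Φ (0, a₀) = a₀ := (h a₀ (Metric.mem_ball_self hδ)).1
  have hnear : ∀ᶠ x in 𝓝 ((0 : ℝ), a₀), Φ x ∈ Metric.ball a₀ (ε / 3) := by
    have := hΦ.continuousAt.tendsto
    rw [h0] at this
    exact this (Metric.ball_mem_nhds _ (by positivity))
  obtain ⟨r, hr, hball⟩ := Metric.eventually_nhds_iff_ball.1 hnear
  refine ⟨Φ, hΦ, min δ r, lt_min hδ hr, fun a ha => ?_⟩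
  have ha' := h a (Metric.ball_subset_ball (min_le_left _ _) ha)
  refine ⟨ha'.1, fun s hs => ?_⟩
  have hs' := ha'.2 s ⟨by linarith [hs.1, min_le_left δ r], hs.2.trans_le (min_le_left _ _)⟩
  have hb : Φ (s, a) ∈ Metric.ball a₀ (ε / 3) := by
    refine hball _ ?_
    rw [← ball_prod_same]
    refine ⟨?_, Metric.ball_subset_ball (min_le_right _ _) ha⟩
    rw [Metric.mem_ball, Real.dist_eq, sub_zero, abs_lt]
    exact ⟨by linarith [hs.1, min_le_right δ r], hs.2.trans_le (min_le_right _ _)⟩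
  refine ⟨hεU (Metric.ball_subset_ball (by linarith) hb), ?_⟩
  rwa [χ.one_of_mem_closedBall (Metric.ball_subset_closedBall hb), one_smul] at hs'

end LocalFlow

/-! ### Iterated derivatives on open sets -/

section IteratedDeriv

open scoped Topology

theorem ContDiffOn.iteratedDeriv_of_isOpen {J : Set ℝ} (hJ : IsOpen J) {h : ℝ → ℝ} (k : ℕ)
    {m : ℕ} (hh : ContDiffOn ℝ (m + k : ℕ) h J) : ContDiffOn ℝ m (iteratedDeriv k h) J := by
  induction k generalizing m with
  | zero => simpa using hh
  | succ k ih =>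
    rw [iteratedDeriv_succ]
    have h1 : ContDiffOn ℝ (m + 1 : ℕ) (iteratedDeriv k h) J :=
      ih (by rwa [add_assoc, add_comm 1 k])
    exact ((contDiffOn_succ_iff_deriv_of_isOpen hJ).1 (by exact_mod_cast h1)).2.2

theorem ContDiffOn.hasDerivAt_iteratedDeriv {J : Set ℝ} (hJ : IsOpen J) {h : ℝ → ℝ} {k m : ℕ}
    (hkm : k < m) (hh : ContDiffOn ℝ m h J) {x : ℝ} (hx : x ∈ J) :
    HasDerivAt (iteratedDeriv k h) (iteratedDeriv (k + 1) h x) x := by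
  obtain ⟨l, rfl⟩ := Nat.exists_eq_add_of_lt hkm
  have h1 : ContDiffOn ℝ (l + 1 : ℕ) (iteratedDeriv k h) J :=
    ContDiffOn.iteratedDeriv_of_isOpen hJ k (hh.of_le (by exact_mod_cast (by omega)))
  rw [iteratedDeriv_succ]
  exact ((h1.contDiffAt (hJ.mem_nhds hx)).differentiableAt
    (by exact_mod_cast Nat.succ_ne_zero l)).hasDerivAt

end IteratedDeriv

/-! ### Ordinary differential equations as first order systems -/

namespace ODE

open scoped Topology

variable {n : ℕ} (E : ODE n)

/-- The right-hand side of the first order system equivalent to the equation. -/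
def field (z : ℝ × (Fin (n + 1) → ℝ)) : Fin (n + 1) → ℝ :=
  Fin.snoc (α := fun _ => ℝ) (fun i : Fin n => z.2 i.succ) (E.rhs z)

@[simp]
theorem field_castSucc (z : ℝ × (Fin (n + 1) → ℝ)) (i : Fin n) :
    E.field z i.castSucc = z.2 i.succ := by
  simp [field]

@[simp]
theorem field_last (z : ℝ × (Fin (n + 1) → ℝ)) : E.field z (Fin.last n) = E.rhs z := by
  simp [field]

theorem contDiffOn_field : ContDiffOn ℝ ∞ E.field E.domain := by
  rw [contDiffOn_pi]
  intro i
  refine Fin.lastCases ?_ (fun i => ?_) i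
  · simpa using E.contDiffOn_rhs
  · simp only [field_castSucc]
    fun_prop

/-- `u` solves the first order system on `J`. -/
def IsCurve (J : Set ℝ) (u : ℝ → Fin (n + 1) → ℝ) : Prop :=
  ∀ x ∈ J, (x, u x) ∈ E.domain ∧ HasDerivAt u (E.field (x, u x)) x

variable {E}

theorem IsCurve.mono {J J' : Set ℝ} {u : ℝ → Fin (n + 1) → ℝ} (h : E.IsCurve J u) (hJ : J' ⊆ J) :
    E.IsCurve J' u := fun x hx => h x (hJ hx)

theorem IsCurve.continuousAt {J : Set ℝ} {u : ℝ → Fin (n + 1) → ℝ} (h : E.IsCurve J u) {x : ℝ}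
    (hx : x ∈ J) : ContinuousAt u x := (h x hx).2.continuousAt

theorem IsCurve.congr {J : Set ℝ} (hJ : IsOpen J) {u v : ℝ → Fin (n + 1) → ℝ} (h : E.IsCurve J u)
    (huv : Set.EqOn v u J) : E.IsCurve J v := fun x hx => by
  rw [huv hx]
  exact ⟨(h x hx).1, (h x hx).2.congr_of_eventuallyEq
    (Filter.eventually_of_mem (hJ.mem_nhds hx) huv)⟩

theorem IsCurve.eventuallyEq {J : Set ℝ} (hJ : IsOpen J) {u v : ℝ → Fin (n + 1) → ℝ}
    (hu : E.IsCurve J u) (hv : E.IsCurve J v) {x : ℝ} (hx : x ∈ J) (huv : u x = v x) :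
    u =ᶠ[𝓝 x] v := by
  have hX : ContDiffAt ℝ 1 E.field (x, u x) :=
    (E.contDiffOn_field.contDiffAt (E.domain.isOpen.mem_nhds (hu x hx).1)).of_le (by simp)
  obtain ⟨K, s, hs, hL⟩ := hX.exists_lipschitzOnWith
  have hmem : ∀ w : ℝ → Fin (n + 1) → ℝ, E.IsCurve J w → w x = u x →
      ∀ᶠ t in 𝓝 x, HasDerivAt w (E.field (t, w t)) t ∧ w t ∈ {b | (t, b) ∈ s} := by
    intro w hw hwx
    have hc : ContinuousAt (fun t => (t, w t)) x :=
      continuousAt_id.prodMk (hw.continuousAt hx)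
    have h2 : ∀ᶠ t in 𝓝 x, (t, w t) ∈ s := hc (by simpa [hwx] using hs)
    filter_upwards [hJ.mem_nhds hx, h2] with t ht ht'
    exact ⟨(hw t ht).2, ht'⟩
  refine ODE_solution_unique_of_eventually (v := fun t b => E.field (t, b))
    (s := fun t => {b | (t, b) ∈ s}) (K := K) (Filter.Eventually.of_forall fun t => ?_)
    (hmem u hu rfl) (hmem v hv huv.symm) huv
  intro a ha b hb
  simpa [Prod.edist_eq] using hL ha hb

theorem IsCurve.eqOn {J : Set ℝ} (hJ : IsOpen J) (hJ' : IsPreconnected J)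
    {u v : ℝ → Fin (n + 1) → ℝ} (hu : E.IsCurve J u) (hv : E.IsCurve J v) {x : ℝ} (hx : x ∈ J)
    (huv : u x = v x) : Set.EqOn u v J := by
  intro y hy
  refine hJ'.induction₂' (fun a b => u a = v a → u b = v b) (fun a ha => ?_)
    (fun a b c _ _ _ h1 h2 h => h2 (h1 h)) hx hy huv
  by_cases h : u a = v a
  · filter_upwards [mem_nhdsWithin_of_mem_nhds (hu.eventuallyEq hJ hv ha h)] with b hb
    exact ⟨fun _ => hb, fun _ => h⟩
  · have := ((hu.continuousAt ha).prodMk (hv.continuousAt ha)).eventually_mem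
      (isClosed_diagonal.isOpen_compl.mem_nhds h)
    filter_upwards [mem_nhdsWithin_of_mem_nhds this] with b hb
    exact ⟨fun h' => absurd h' h, fun h' => absurd h' hb⟩

/-- Bootstrapping: if `u` is of class `Cᵐ`, so is its derivative `E.field (x, u x)`. -/
theorem IsCurve.contDiffOn {J : Set ℝ} (hJ : IsOpen J) {u : ℝ → Fin (n + 1) → ℝ}
    (hu : E.IsCurve J u) : ContDiffOn ℝ ∞ u J := by
  rw [contDiffOn_infty]
  intro m
  induction m with
  | zero => exact contDiffOn_zero.2 fun x hx => (hu.continuousAt hx).continuousWithinAt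
  | succ m ih =>
    rw [Nat.cast_succ, contDiffOn_succ_iff_deriv_of_isOpen hJ]
    refine ⟨fun x hx => (hu x hx).2.differentiableAt.differentiableWithinAt, by simp, ?_⟩
    have h1 : ContDiffOn ℝ m (fun x => E.field (x, u x)) J :=
      (E.contDiffOn_field.of_le (by exact_mod_cast le_top)).comp (contDiffOn_id.prodMk ih)
        fun x hx => (hu x hx).1
    exact h1.congr fun x hx => (hu x hx).2.deriv

theorem IsCurve.iteratedDeriv_eq {J : Set ℝ} (hJ : IsOpen J) {u : ℝ → Fin (n + 1) → ℝ}
    (hu : E.IsCurve J u) (i : Fin (n + 1)) :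
    ∀ x ∈ J, iteratedDeriv i (fun x => u x 0) x = u x i := by
  refine Fin.induction (fun x _ => by simp) (fun i ih x hx => ?_) i
  have h1 : iteratedDeriv (i.castSucc : ℕ) (fun x => u x 0) =ᶠ[𝓝 x] fun x => u x i.castSucc :=
    Filter.eventually_of_mem (hJ.mem_nhds hx) ih
  rw [Fin.val_succ, iteratedDeriv_succ]
  rw [Fin.val_castSucc] at h1
  rw [h1.deriv_eq]
  have h2 := hasDerivAt_pi.1 (hu x hx).2 i.castSucc
  rw [h2.deriv, field_castSucc]

theorem IsCurve.jet_eq {J : Set ℝ} (hJ : IsOpen J) {u : ℝ → Fin (n + 1) → ℝ}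
    (hu : E.IsCurve J u) {x : ℝ} (hx : x ∈ J) : jet n (fun x => u x 0) x = u x :=
  funext fun i => hu.iteratedDeriv_eq hJ i x hx

theorem IsCurve.iteratedDeriv_succ_eq {J : Set ℝ} (hJ : IsOpen J) {u : ℝ → Fin (n + 1) → ℝ}
    (hu : E.IsCurve J u) {x : ℝ} (hx : x ∈ J) :
    iteratedDeriv (n + 1) (fun x => u x 0) x = E.rhs (x, u x) := by
  have h1 : iteratedDeriv n (fun x => u x 0) =ᶠ[𝓝 x] fun x => u x (Fin.last n) :=
    Filter.eventually_of_mem (hJ.mem_nhds hx) (hu.iteratedDeriv_eq hJ (Fin.last n))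
  rw [iteratedDeriv_succ, h1.deriv_eq]
  rw [(hasDerivAt_pi.1 (hu x hx).2 (Fin.last n)).deriv, field_last]

/-- The solution of the equation given by a solution of the first order system. -/
def IsCurve.toSolution {J : Set ℝ} (hJ : IsOpen J) (hJ' : IsPreconnected J) (hJ₀ : J.Nonempty)
    {u : ℝ → Fin (n + 1) → ℝ} (hu : E.IsCurve J u) : E.Solution where
  interval := J
  toFun := fun x => u x 0
  isOpen := hJ
  nonempty := hJ₀
  isPreconnected := hJ'
  contDiffOn := by
    have h1 := contDiffOn_pi.1 (hu.contDiffOn hJ) 0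
    exact h1.of_le (by exact_mod_cast le_top)
  jet_mem := fun x hx => by
    rw [hu.jet_eq hJ hx]
    exact (hu x hx).1
  eq_rhs := fun x hx => by
    rw [hu.jet_eq hJ hx, hu.iteratedDeriv_succ_eq hJ hx]

theorem isCurve_jet {J : Set ℝ} (hJ : IsOpen J) {y : ℝ → ℝ} (hy : ContDiffOn ℝ (n + 1 : ℕ) y J)
    (hmem : ∀ x ∈ J, (x, jet n y x) ∈ E.domain)
    (heq : ∀ x ∈ J, iteratedDeriv (n + 1) y x = E.rhs (x, jet n y x)) :
    E.IsCurve J (jet n y) := by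
  intro x hx
  refine ⟨hmem x hx, hasDerivAt_pi.2 fun i => ?_⟩
  have h1 := ContDiffOn.hasDerivAt_iteratedDeriv hJ i.2 hy hx
  refine Fin.lastCases ?_ (fun i => ?_) i
  · have h1 := ContDiffOn.hasDerivAt_iteratedDeriv hJ (Fin.last n).2 hy hx
    rw [field_last, ← heq x hx]
    simpa [jet] using h1
  · have h1 := ContDiffOn.hasDerivAt_iteratedDeriv hJ i.castSucc.2 hy hx
    rw [field_castSucc]
    simpa [jet] using h1

theorem Solution.isCurve (y : E.Solution) : E.IsCurve y.interval (jet n y.toFun) :=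
  isCurve_jet y.isOpen y.contDiffOn y.jet_mem y.eq_rhs

theorem Solution.contDiffOn_jet (y : E.Solution) : ContDiffOn ℝ ∞ (jet n y.toFun) y.interval :=
  y.isCurve.contDiffOn y.isOpen

theorem Solution.contDiffOn_lift (y : E.Solution) :
    ContDiffOn ℝ ∞ (fun x => (x, jet n y.toFun x)) y.interval :=
  contDiffOn_id.prodMk y.contDiffOn_jet

/-! ### The maximal flow of the equation -/

variable (E) in
/-- The solution through the point `z` takes the value `w` (as a jet) at `x`. -/
def Reaches (z : ℝ × (Fin (n + 1) → ℝ)) (x : ℝ) (w : Fin (n + 1) → ℝ) : Prop :=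
  ∃ (J : Set ℝ) (u : ℝ → Fin (n + 1) → ℝ), IsOpen J ∧ IsPreconnected J ∧ E.IsCurve J u ∧
    z.1 ∈ J ∧ x ∈ J ∧ u z.1 = z.2 ∧ u x = w

theorem IsCurve.reaches {J : Set ℝ} (hJ : IsOpen J) (hJ' : IsPreconnected J)
    {u : ℝ → Fin (n + 1) → ℝ} (hu : E.IsCurve J u) {x x' : ℝ} (hx : x ∈ J) (hx' : x' ∈ J) :
    E.Reaches (x, u x) x' (u x') := ⟨J, u, hJ, hJ', hu, hx, hx', rfl, rfl⟩

theorem Reaches.symm {z : ℝ × (Fin (n + 1) → ℝ)} {x : ℝ} {w : Fin (n + 1) → ℝ}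
    (h : E.Reaches z x w) : E.Reaches (x, w) z.1 z.2 := by
  obtain ⟨J, u, hJ, hJ', hu, hz, hx, h1, h2⟩ := h
  exact ⟨J, u, hJ, hJ', hu, hx, hz, h2, h1⟩

theorem Reaches.left_mem {z : ℝ × (Fin (n + 1) → ℝ)} {x : ℝ} {w : Fin (n + 1) → ℝ}
    (h : E.Reaches z x w) : z ∈ E.domain := by
  obtain ⟨J, u, hJ, hJ', hu, hz, hx, h1, h2⟩ := h
  have := (hu _ hz).1
  rwa [h1] at this

theorem Reaches.right_mem {z : ℝ × (Fin (n + 1) → ℝ)} {x : ℝ} {w : Fin (n + 1) → ℝ}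
    (h : E.Reaches z x w) : (x, w) ∈ E.domain := h.symm.left_mem

theorem Reaches.unique {z : ℝ × (Fin (n + 1) → ℝ)} {x : ℝ} {w w' : Fin (n + 1) → ℝ}
    (h : E.Reaches z x w) (h' : E.Reaches z x w') : w = w' := by
  obtain ⟨J, u, hJ, hJc, hu, hz, hx, h1, h2⟩ := h
  obtain ⟨J', u', hJ', hJc', hu', hz', hx', h1', h2'⟩ := h'
  have hc : IsPreconnected (J ∩ J') :=
    (hJc.ordConnected.inter hJc'.ordConnected).isPreconnected
  have := (hu.mono Set.inter_subset_left).eqOn (hJ.inter hJ') hc (hu'.mono Set.inter_subset_right)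
    ⟨hz, hz'⟩ (h1.trans h1'.symm) ⟨hx, hx'⟩
  rw [← h2, this, h2']

-- The intersection of two intervals is an interval, so the two curves agree on it by uniqueness and
-- glue to a curve on the union. This makes lying on a common solution a transitive relation.
open Classical in
theorem Reaches.trans {z : ℝ × (Fin (n + 1) → ℝ)} {x x' : ℝ} {w w' : Fin (n + 1) → ℝ}
    (h : E.Reaches z x w) (h' : E.Reaches (x, w) x' w') : E.Reaches z x' w' := by
  obtain ⟨J, u, hJ, hJc, hu, hz, hx, h1, h2⟩ := h
  obtain ⟨J', u', hJ', hJc', hu', hz', hx', h1', h2'⟩ := h'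
  have hc : IsPreconnected (J ∩ J') :=
    (hJc.ordConnected.inter hJc'.ordConnected).isPreconnected
  have heq := (hu.mono Set.inter_subset_left).eqOn (hJ.inter hJ') hc
    (hu'.mono Set.inter_subset_right) ⟨hx, hz'⟩ (h2.trans h1'.symm)
  set v : ℝ → Fin (n + 1) → ℝ := fun t => if t ∈ J then u t else u' t with hv
  have hvu : Set.EqOn v u J := fun t ht => by simp [hv, ht]
  have hvu' : Set.EqOn v u' J' := fun t ht => by
    by_cases h : t ∈ J
    · simp only [hv, h, if_true]
      exact heq ⟨h, ht⟩
    · simp [hv, h]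
  refine ⟨J ∪ J', v, hJ.union hJ', IsPreconnected.union x hx hz' hJc hJc', ?_, Or.inl hz,
    Or.inr hx', (hvu hz).trans h1, (hvu' hx').trans h2'⟩
  rintro t (ht | ht)
  · exact hu.congr hJ hvu t ht
  · exact hu'.congr hJ' hvu' t ht

theorem sameSolution_iff (a b : E.domain) :
    E.SameSolution a b ↔ E.Reaches a b.1.1 b.1.2 := by
  constructor
  · rintro ⟨y, x, x', rfl, rfl⟩
    exact y.isCurve.reaches y.isOpen y.isPreconnected x.2 x'.2
  · rintro ⟨J, u, hJ, hJc, hu, hz, hx, h1, h2⟩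
    refine ⟨hu.toSolution hJ hJc ⟨_, hz⟩, ⟨_, hz⟩, ⟨_, hx⟩, ?_, ?_⟩
    · refine Subtype.ext (Prod.ext rfl ?_)
      exact (hu.jet_eq hJ hz).trans h1
    · refine Subtype.ext (Prod.ext rfl ?_)
      exact (hu.jet_eq hJ hx).trans h2

variable (E) in
open Classical in
/-- The flow of the equation: `E.flow (z, x)` is the value (as a jet) at `x` of the solution through
`z`. -/
def flow (p : (ℝ × (Fin (n + 1) → ℝ)) × ℝ) : Fin (n + 1) → ℝ :=
  if h : ∃ w, E.Reaches p.1 p.2 w then h.choose else 0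

variable (E) in
/-- The domain of the flow. -/
def flowDomain : Set ((ℝ × (Fin (n + 1) → ℝ)) × ℝ) := {p | ∃ w, E.Reaches p.1 p.2 w}

theorem reaches_flow {z : ℝ × (Fin (n + 1) → ℝ)} {x : ℝ} (h : (z, x) ∈ E.flowDomain) :
    E.Reaches z x (E.flow (z, x)) := by
  have h' : ∃ w, E.Reaches z x w := h
  rw [flow, dif_pos h']
  exact h'.choose_spec

theorem Reaches.mem_flowDomain {z : ℝ × (Fin (n + 1) → ℝ)} {x : ℝ} {w : Fin (n + 1) → ℝ}
    (h : E.Reaches z x w) : (z, x) ∈ E.flowDomain := ⟨w, h⟩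

theorem Reaches.flow_eq {z : ℝ × (Fin (n + 1) → ℝ)} {x : ℝ} {w : Fin (n + 1) → ℝ}
    (h : E.Reaches z x w) : E.flow (z, x) = w := (reaches_flow h.mem_flowDomain).unique h

/-- A time-dependent system becomes autonomous on the jet space by adding the component `x' = 1`;
elapsed time is then the difference of the values of `x`. -/
theorem exists_local_curves {z₀ : ℝ × (Fin (n + 1) → ℝ)} (hz₀ : z₀ ∈ E.domain) :
    ∃ F : (ℝ × (Fin (n + 1) → ℝ)) × ℝ → Fin (n + 1) → ℝ, ContDiffAt ℝ ∞ F (z₀, z₀.1) ∧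
      ∀ᶠ p in 𝓝 (z₀, z₀.1), E.Reaches p.1 p.2 (F p) := by
  have hX : ContDiffOn ℝ ∞ (fun z => ((1 : ℝ), E.field z)) E.domain :=
    contDiffOn_const.prodMk E.contDiffOn_field
  obtain ⟨Φ, hΦ, δ, hδ, h⟩ := exists_local_flow E.domain.isOpen hX hz₀
  have h1 : ∀ a ∈ Metric.ball z₀ δ, ∀ s ∈ Set.Ioo (-δ) δ, (Φ (s, a)).1 = a.1 + s := by
    intro a ha s hs
    have hd : ∀ s ∈ Set.Ioo (-δ) δ, HasDerivAt (fun s => (Φ (s, a)).1 - s) 0 s := fun s hs => by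
      have h2 : HasDerivAt (fun s => (Φ (s, a)).1) 1 s := by
        simpa using (((h a ha).2 s hs).2.hasFDerivAt.fst).hasDerivAt
      have h3 := h2.fun_sub (hasDerivAt_id' s)
      rwa [sub_self] at h3
    have := isOpen_Ioo.is_const_of_deriv_eq_zero isPreconnected_Ioo
      (fun s hs => (hd s hs).differentiableAt.differentiableWithinAt)
      (fun s hs => (hd s hs).deriv) (x := s) (y := 0) hs ⟨by linarith, hδ⟩
    simp only [(h a ha).1, sub_zero] at this
    linarith
  refine ⟨fun p => (Φ (p.2 - p.1.1, p.1)).2, ?_, ?_⟩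
  · have h2 : ContDiffAt ℝ ∞ (fun p : (ℝ × (Fin (n + 1) → ℝ)) × ℝ => (p.2 - p.1.1, p.1))
        (z₀, z₀.1) := by fun_prop
    have h3 : ContDiffAt ℝ ∞ (fun p : (ℝ × (Fin (n + 1) → ℝ)) × ℝ => Φ (p.2 - p.1.1, p.1))
        (z₀, z₀.1) := ContDiffAt.comp (g := Φ) (z₀, z₀.1) (by simpa using hΦ) h2
    exact h3.snd
  · have hc : ContinuousAt (fun p : (ℝ × (Fin (n + 1) → ℝ)) × ℝ => (p.2 - p.1.1, p.1))
        (z₀, z₀.1) := by fun_prop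
    have h2 : ∀ᶠ q in 𝓝 ((0 : ℝ), z₀), q ∈ Set.Ioo (-δ) δ ×ˢ Metric.ball z₀ δ :=
      (isOpen_Ioo.prod Metric.isOpen_ball).mem_nhds
        ⟨⟨by simpa using hδ, hδ⟩, Metric.mem_ball_self hδ⟩
    rw [show ((0 : ℝ), z₀) = (fun p : (ℝ × (Fin (n + 1) → ℝ)) × ℝ => (p.2 - p.1.1, p.1))
      (z₀, z₀.1) by simp] at h2
    have h3 := hc.eventually h2
    filter_upwards [h3] with p hp
    obtain ⟨hp1, hp2⟩ := hp
    refine ⟨Set.Ioo (p.1.1 - δ) (p.1.1 + δ), fun x => (Φ (x - p.1.1, p.1)).2, isOpen_Ioo,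
      isPreconnected_Ioo, fun x hx => ?_, by simpa using hδ, ?_, ?_, rfl⟩
    · have hx' : x - p.1.1 ∈ Set.Ioo (-δ) δ := ⟨by linarith [hx.1], by linarith [hx.2]⟩
      obtain ⟨h4, h5⟩ := (h p.1 hp2).2 _ hx'
      have h6 : (x, (Φ (x - p.1.1, p.1)).2) = Φ (x - p.1.1, p.1) :=
        Prod.ext (by rw [h1 _ hp2 _ hx']; ring) rfl
      rw [h6]
      refine ⟨h4, ?_⟩
      exact (HasDerivAt.comp_sub_const x p.1.1 h5).snd
    · exact ⟨by linarith [hp1.1], by linarith [hp1.2]⟩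
    · simp [(h p.1 hp2).1]

theorem eventually_mem_flowDomain_diag {z₀ : ℝ × (Fin (n + 1) → ℝ)} (hz₀ : z₀ ∈ E.domain) :
    ∀ᶠ p in 𝓝 (z₀, z₀.1), p ∈ E.flowDomain := by
  obtain ⟨F, -, hF⟩ := exists_local_curves hz₀
  exact hF.mono fun p hp => hp.mem_flowDomain

theorem contDiffAt_flow_diag {z₀ : ℝ × (Fin (n + 1) → ℝ)} (hz₀ : z₀ ∈ E.domain) :
    ContDiffAt ℝ ∞ E.flow (z₀, z₀.1) := by
  obtain ⟨F, hF', hF⟩ := exists_local_curves hz₀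
  exact hF'.congr_of_eventuallyEq (hF.mono fun p hp => hp.flow_eq)

theorem reaches_self {z : ℝ × (Fin (n + 1) → ℝ)} (hz : z ∈ E.domain) : E.Reaches z z.1 z.2 := by
  have h := reaches_flow (eventually_mem_flowDomain_diag hz).self_of_nhds
  exact h.trans h.symm

theorem flow_self {z : ℝ × (Fin (n + 1) → ℝ)} (hz : z ∈ E.domain) : E.flow (z, z.1) = z.2 :=
  (reaches_self hz).flow_eq

theorem IsCurve.flow_eq {J : Set ℝ} (hJ : IsOpen J) (hJ' : IsPreconnected J)
    {u : ℝ → Fin (n + 1) → ℝ} (hu : E.IsCurve J u) {x x' : ℝ} (hx : x ∈ J) (hx' : x' ∈ J) :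
    E.flow ((x, u x), x') = u x' := (hu.reaches hJ hJ' hx hx').flow_eq

theorem flow_flow {z : ℝ × (Fin (n + 1) → ℝ)} {x x' : ℝ} (h : (z, x) ∈ E.flowDomain)
    (h' : ((x, E.flow (z, x)), x') ∈ E.flowDomain) :
    E.flow ((x, E.flow (z, x)), x') = E.flow (z, x') :=
  ((reaches_flow h).trans (reaches_flow h')).flow_eq.symm

/-- The property holds for pairs near the diagonal by the local flow and is transitive by composing
flow maps, so it spreads over the interval. A finite order `m` is fixed because being `Cᵐ` at a
point implies the same at nearby points. -/
theorem flow_transition {J : Set ℝ} (hJ : IsOpen J) (hJ' : IsPreconnected J)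
    {u : ℝ → Fin (n + 1) → ℝ} (hu : E.IsCurve J u) (m : ℕ) {x x' : ℝ} (hx : x ∈ J)
    (hx' : x' ∈ J) :
    (∀ᶠ z in 𝓝 (x, u x), (z, x') ∈ E.flowDomain) ∧
      ContDiffAt ℝ m (fun z => E.flow (z, x')) (x, u x) := by
  refine hJ'.induction₂' (fun x x' => (∀ᶠ z in 𝓝 (x, u x), (z, x') ∈ E.flowDomain) ∧
      ContDiffAt ℝ m (fun z => E.flow (z, x')) (x, u x)) (fun x hx => ?_)
      (fun x x' x'' hx hx' hx'' h1 h2 => ?_) hx hx'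
  · have h1 := (eventually_mem_flowDomain_diag (hu x hx).1).eventually_nhds
    have h2 := ((contDiffAt_flow_diag (hu x hx).1).of_le
      (by exact_mod_cast le_top : (m : WithTop ℕ∞) ≤ ∞)).eventually (by simp)
    have h3 := h1.and h2
    have hc1 : ContinuousAt (fun y => ((x, u x), y)) x := by fun_prop
    have hc2 : ContinuousAt (fun y => ((y, u y), x)) x :=
      (continuousAt_id.prodMk (hu.continuousAt hx)).prodMk continuousAt_const
    have hp : ∀ (z : ℝ × (Fin (n + 1) → ℝ)) (y : ℝ),
        ((∀ᶠ p in 𝓝 (z, y), p ∈ E.flowDomain) ∧ ContDiffAt ℝ m E.flow (z, y)) →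
        (∀ᶠ z' in 𝓝 z, (z', y) ∈ E.flowDomain) ∧ ContDiffAt ℝ m (fun z' => E.flow (z', y)) z := by
      intro z y h
      have hc : ContinuousAt (fun z' : ℝ × (Fin (n + 1) → ℝ) => (z', y)) z := by fun_prop
      exact ⟨hc.eventually h.1, ContDiffAt.comp (g := E.flow) z h.2 (by fun_prop)⟩
    filter_upwards [mem_nhdsWithin_of_mem_nhds (hc1.eventually h3),
      mem_nhdsWithin_of_mem_nhds (hc2.eventually h3)] with y hy1 hy2
    exact ⟨hp _ _ hy1, hp _ _ hy2⟩
  · have hval : E.flow ((x, u x), x') = u x' := hu.flow_eq hJ hJ' hx hx'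
    have hc : ContinuousAt (fun z => (x', E.flow (z, x'))) (x, u x) :=
      continuousAt_const.prodMk h1.2.continuousAt
    have h3 : ∀ᶠ z in 𝓝 (x, u x), ((x', E.flow (z, x')), x'') ∈ E.flowDomain :=
      hc.eventually (by simpa [hval] using h2.1)
    refine ⟨?_, ?_⟩
    · filter_upwards [h1.1, h3] with z hz hz'
      exact ((reaches_flow hz).trans (reaches_flow hz')).mem_flowDomain
    · have h4 : ContDiffAt ℝ m (fun z => E.flow ((x', E.flow (z, x')), x'')) (x, u x) :=
        ContDiffAt.comp (g := fun z => E.flow (z, x'')) (x, u x) (by simpa [hval] using h2.2)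
          (contDiffAt_const.prodMk h1.2)
      refine h4.congr_of_eventuallyEq ?_
      filter_upwards [h1.1, h3] with z hz hz'
      exact (flow_flow hz hz').symm

/-- The flow to a time near `x'` is the flow to exactly `x'`, handled by `flow_transition`, followed
by a short flow near the diagonal. -/
theorem flow_smooth_aux {p : (ℝ × (Fin (n + 1) → ℝ)) × ℝ} (hp : p ∈ E.flowDomain) (m : ℕ) :
    (∀ᶠ q in 𝓝 p, q ∈ E.flowDomain) ∧ ContDiffAt ℝ m E.flow p := by
  obtain ⟨z, x'⟩ := p
  obtain ⟨w, J, u, hJ, hJ', hu, hz, hx', h1, rfl⟩ := hp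
  dsimp only at hz hx' h1
  obtain ⟨x, b⟩ := z
  dsimp only at hz h1
  subst h1
  have ht := flow_transition hJ hJ' hu m hz hx'
  have hval : E.flow ((x, u x), x') = u x' := hu.flow_eq hJ hJ' hz hx'
  have h1 := contDiffAt_flow_diag (hu x' hx').1
  have h2 := eventually_mem_flowDomain_diag (hu x' hx').1
  have hs : ContDiffAt ℝ m (fun q : (ℝ × (Fin (n + 1) → ℝ)) × ℝ => ((x', E.flow (q.1, x')), q.2))
      ((x, u x), x') := by
    refine ContDiffAt.prodMk (contDiffAt_const.prodMk ?_) contDiffAt_snd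
    exact ContDiffAt.comp (g := fun z => E.flow (z, x')) ((x, u x), x') ht.2 contDiffAt_fst
  have h3 : ∀ᶠ q : (ℝ × (Fin (n + 1) → ℝ)) × ℝ in 𝓝 ((x, u x), x'), (q.1, x') ∈ E.flowDomain :=
    (continuousAt_fst (p := (((x, u x), x') : (ℝ × (Fin (n + 1) → ℝ)) × ℝ))).eventually ht.1
  have h4 : ∀ᶠ q : (ℝ × (Fin (n + 1) → ℝ)) × ℝ in 𝓝 ((x, u x), x'),
      ((x', E.flow (q.1, x')), q.2) ∈ E.flowDomain :=
    hs.continuousAt.eventually (by simpa [hval] using h2)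
  refine ⟨?_, ?_⟩
  · filter_upwards [h3, h4] with q hq hq'
    exact ((reaches_flow hq).trans (reaches_flow hq')).mem_flowDomain
  · have h5 : ContDiffAt ℝ m (fun q : (ℝ × (Fin (n + 1) → ℝ)) × ℝ =>
        E.flow ((x', E.flow (q.1, x')), q.2)) ((x, u x), x') :=
      ContDiffAt.comp (g := E.flow) ((x, u x), x')
        (by simpa [hval] using h1.of_le (by exact_mod_cast le_top)) hs
    refine h5.congr_of_eventuallyEq ?_
    filter_upwards [h3, h4] with q hq hq'
    exact (flow_flow hq hq').symm

theorem isOpen_flowDomain : IsOpen E.flowDomain :=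
  isOpen_iff_mem_nhds.2 fun _ hp => (flow_smooth_aux hp 0).1

theorem contDiffAt_flow {p : (ℝ × (Fin (n + 1) → ℝ)) × ℝ} (hp : p ∈ E.flowDomain) :
    ContDiffAt ℝ ∞ E.flow p :=
  contDiffAt_infty.2 fun m => (flow_smooth_aux hp m).2

theorem contDiffOn_flow : ContDiffOn ℝ ∞ E.flow E.flowDomain :=
  fun _ hp => (contDiffAt_flow hp).contDiffWithinAt

theorem hasDerivAt_flow {z : ℝ × (Fin (n + 1) → ℝ)} {x : ℝ} (h : (z, x) ∈ E.flowDomain) :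
    HasDerivAt (fun x => E.flow (z, x)) (E.field (x, E.flow (z, x))) x := by
  obtain ⟨w, J, u, hJ, hJ', hu, hz, hx', h1, rfl⟩ := h
  have hval : ∀ t ∈ J, E.flow (z, t) = u t := fun t ht => by
    have := hu.flow_eq hJ hJ' hz ht
    rwa [h1] at this
  rw [hval x hx']
  exact (hu x hx').2.congr_of_eventuallyEq (Filter.eventually_of_mem (hJ.mem_nhds hx') hval)

theorem exists_isCurve {z : ℝ × (Fin (n + 1) → ℝ)} (hz : z ∈ E.domain) :
    ∃ (δ : ℝ) (u : ℝ → Fin (n + 1) → ℝ), 0 < δ ∧ E.IsCurve (Set.Ioo (z.1 - δ) (z.1 + δ)) u ∧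
      u z.1 = z.2 := by
  obtain ⟨J, u, hJ, hJ', hu, h1, -, h2, -⟩ := reaches_self hz
  obtain ⟨δ, hδ, hδ'⟩ := Metric.isOpen_iff.1 hJ _ h1
  rw [Real.ball_eq_Ioo] at hδ'
  exact ⟨δ, u, hδ, hu.mono hδ', h2⟩

end ODE

/-! ### Linear equations -/

section LinearEquations

open scoped Topology

theorem two_le_infty : (2 : WithTop ℕ∞) ≤ ∞ :=
  (WithTop.coe_le_coe.2 le_top : ((2 : ℕ∞) : WithTop ℕ∞) ≤ ((⊤ : ℕ∞) : WithTop ℕ∞))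

theorem jet_congr {n : ℕ} {h k : ℝ → ℝ} {x : ℝ} (hk : h =ᶠ[𝓝 x] k) : jet n h x = jet n k x :=
  funext fun i => hk.iteratedDeriv_eq i

/-- A linear equation, as a nonlinear one. -/
def linearODE {n : ℕ} {p : Fin (n + 1) → ℝ → ℝ} {J : Set ℝ} (hJ : IsOpen J)
    (hp : ∀ i, ContDiffOn ℝ ∞ (p i) J) : ODE n where
  domain := ⟨J ×ˢ Set.univ, hJ.prod isOpen_univ⟩
  rhs := fun z => -∑ i, p i z.1 * z.2 i
  contDiffOn_rhs := by
    refine ContDiffOn.neg (ContDiffOn.sum fun i _ => ?_)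
    have h1 : ContDiffOn ℝ ∞ (fun z : ℝ × (Fin (n + 1) → ℝ) => p i z.1) (J ×ˢ Set.univ) :=
      (hp i).comp contDiffOn_fst fun z hz => hz.1
    exact h1.mul (by fun_prop)

variable {n : ℕ} {p : Fin (n + 1) → ℝ → ℝ} {J : Set ℝ}

theorem IsLinearSolution.isCurve (hJ : IsOpen J) (hp : ∀ i, ContDiffOn ℝ ∞ (p i) J) {h : ℝ → ℝ}
    (hh : IsLinearSolution n p J h) : (linearODE hJ hp).IsCurve J (jet n h) :=
  ODE.isCurve_jet hJ hh.1 (fun _ hx => ⟨hx, trivial⟩) fun x hx => by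
    have := hh.2 x hx
    change _ = -∑ i, p i x * iteratedDeriv i h x
    linarith

theorem ODE.IsCurve.isLinearSolution (hJ : IsOpen J) (hp : ∀ i, ContDiffOn ℝ ∞ (p i) J)
    {u : ℝ → Fin (n + 1) → ℝ} (hu : (linearODE hJ hp).IsCurve J u) :
    IsLinearSolution n p J fun x => u x 0 := by
  refine ⟨(contDiffOn_pi.1 (hu.contDiffOn hJ) 0).of_le (by exact_mod_cast le_top),
    fun x hx => ?_⟩
  rw [hu.iteratedDeriv_succ_eq hJ hx]
  have : ∀ i : Fin (n + 1), iteratedDeriv i (fun x => u x 0) x = u x i :=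
    fun i => hu.iteratedDeriv_eq hJ i x hx
  simp only [this]
  change -∑ i, p i x * u x i + _ = 0
  simp

theorem IsLinearSolution.jet_eqOn (hJ : IsOpen J) (hJ' : IsPreconnected J)
    (hp : ∀ i, ContDiffOn ℝ ∞ (p i) J) {h k : ℝ → ℝ} (hh : IsLinearSolution n p J h)
    (hk : IsLinearSolution n p J k) {x : ℝ} (hx : x ∈ J) (hhk : jet n h x = jet n k x) :
    Set.EqOn (jet n h) (jet n k) J :=
  (hh.isCurve hJ hp).eqOn hJ hJ' (hk.isCurve hJ hp) hx hhk

theorem IsLinearSolution.eqOn (hJ : IsOpen J) (hJ' : IsPreconnected J)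
    (hp : ∀ i, ContDiffOn ℝ ∞ (p i) J) {h k : ℝ → ℝ} (hh : IsLinearSolution n p J h)
    (hk : IsLinearSolution n p J k) {x : ℝ} (hx : x ∈ J) (hhk : jet n h x = jet n k x) :
    Set.EqOn h k J := fun t ht => by
  simpa [jet] using congrFun (hh.jet_eqOn hJ hJ' hp hk hx hhk ht) 0

theorem IsLinearSolution.congr (hJ : IsOpen J) {h k : ℝ → ℝ} (hh : IsLinearSolution n p J h)
    (hk : Set.EqOn k h J) : IsLinearSolution n p J k := by
  refine ⟨hh.1.congr hk, fun x hx => ?_⟩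
  have he : k =ᶠ[𝓝 x] h := Filter.eventually_of_mem (hJ.mem_nhds hx) hk
  simp only [he.iteratedDeriv_eq]
  exact hh.2 x hx

theorem jet_add {h k : ℝ → ℝ} (hJ : IsOpen J) (hh : ContDiffOn ℝ (n + 1 : ℕ) h J)
    (hk : ContDiffOn ℝ (n + 1 : ℕ) k J) {x : ℝ} (hx : x ∈ J) :
    jet n (h + k) x = jet n h x + jet n k x := by
  funext i
  exact iteratedDeriv_add
    ((hh.contDiffAt (hJ.mem_nhds hx)).of_le (by exact_mod_cast i.2.le))
    ((hk.contDiffAt (hJ.mem_nhds hx)).of_le (by exact_mod_cast i.2.le))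

theorem jet_smul (c : ℝ) (h : ℝ → ℝ) (x : ℝ) : jet n (c • h) x = c • jet n h x := by
  funext i
  simp [jet]

end LinearEquations

/-! ### The linearization and the derivative of the flow -/

namespace ODE

open scoped Topology

variable {n : ℕ} (E : ODE n)

/-- The coefficients of the linearization, as functions on the jet space. -/
def linCoeff (i : Fin (n + 1)) (z : ℝ × (Fin (n + 1) → ℝ)) : ℝ :=
  -(fderiv ℝ E.rhs z (0, Pi.single i 1))

theorem contDiffOn_linCoeff (i : Fin (n + 1)) : ContDiffOn ℝ ∞ (E.linCoeff i) E.domain :=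
  ((((contDiffOn_infty_iff_fderiv_of_isOpen E.domain.isOpen).1 E.contDiffOn_rhs).2).clm_apply
    contDiffOn_const).neg

variable {E}

theorem Solution.contDiffOn_linearization (y : E.Solution) (i : Fin (n + 1)) :
    ContDiffOn ℝ ∞ (y.linearization i) y.interval :=
  (E.contDiffOn_linCoeff i).comp y.contDiffOn_lift y.jet_mem

variable (E) in
/-- The derivative of the flow in the vertical directions. -/
def flowDeriv (z : ℝ × (Fin (n + 1) → ℝ)) (x : ℝ) :
    (Fin (n + 1) → ℝ) →L[ℝ] (Fin (n + 1) → ℝ) :=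
  (fderiv ℝ E.flow (z, x)).comp
    ((ContinuousLinearMap.inl ℝ (ℝ × (Fin (n + 1) → ℝ)) ℝ).comp
      (ContinuousLinearMap.inr ℝ ℝ (Fin (n + 1) → ℝ)))

theorem flowDeriv_apply (z : ℝ × (Fin (n + 1) → ℝ)) (x : ℝ) (v : Fin (n + 1) → ℝ) :
    E.flowDeriv z x v = fderiv ℝ E.flow (z, x) ((0, v), 0) := rfl

theorem hasFDerivAt_flow_vertical {x x' : ℝ} {b : Fin (n + 1) → ℝ}
    (h : ((x, b), x') ∈ E.flowDomain) :
    HasFDerivAt (fun b => E.flow ((x, b), x')) (E.flowDeriv (x, b) x') b := by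
  have h1 : HasFDerivAt E.flow (fderiv ℝ E.flow ((x, b), x')) ((x, b), x') :=
    ((contDiffAt_flow h).differentiableAt (by simp)).hasFDerivAt
  have h2 : HasFDerivAt (fun b : Fin (n + 1) → ℝ => ((x, b), x'))
      ((ContinuousLinearMap.inl ℝ (ℝ × (Fin (n + 1) → ℝ)) ℝ).comp
        (ContinuousLinearMap.inr ℝ ℝ (Fin (n + 1) → ℝ))) b :=
    HasFDerivAt.comp (g := fun z : ℝ × (Fin (n + 1) → ℝ) => (z, x')) b
      (hasFDerivAt_prodMk_left (x, b) x') (hasFDerivAt_prodMk_right x b)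
  exact HasFDerivAt.comp (g := E.flow) b h1 h2

theorem eventually_flowDomain_vertical {x x' : ℝ} {b : Fin (n + 1) → ℝ}
    (h : ((x, b), x') ∈ E.flowDomain) : ∀ᶠ b' in 𝓝 b, ((x, b'), x') ∈ E.flowDomain := by
  have hc : ContinuousAt (fun b' : Fin (n + 1) → ℝ => ((x, b'), x')) b := by fun_prop
  exact hc.eventually (isOpen_flowDomain.mem_nhds h)

theorem flowDeriv_self {x : ℝ} {b : Fin (n + 1) → ℝ} (h : (x, b) ∈ E.domain) :
    E.flowDeriv (x, b) x = ContinuousLinearMap.id ℝ _ := by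
  have hm : ((x, b), x) ∈ E.flowDomain := (reaches_self h).mem_flowDomain
  refine (hasFDerivAt_flow_vertical hm).unique
    ((hasFDerivAt_id b).congr_of_eventuallyEq ?_)
  filter_upwards [eventually_flowDomain_vertical hm] with b' hb'
  exact flow_self (z := (x, b')) (reaches_flow hb').left_mem

/-- The chain rule for `flow_flow`. With a return to the starting time it makes each `flowDeriv`
invertible. -/
theorem flowDeriv_comp {x x' x'' : ℝ} {b : Fin (n + 1) → ℝ} (h : ((x, b), x') ∈ E.flowDomain)
    (h' : ((x', E.flow ((x, b), x')), x'') ∈ E.flowDomain) :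
    (E.flowDeriv (x', E.flow ((x, b), x')) x'').comp (E.flowDeriv (x, b) x') =
      E.flowDeriv (x, b) x'' := by
  have hm : ((x, b), x'') ∈ E.flowDomain := ((reaches_flow h).trans (reaches_flow h')).mem_flowDomain
  have h1 := HasFDerivAt.comp (g := fun b => E.flow ((x', b), x'')) b
    (hasFDerivAt_flow_vertical h') (hasFDerivAt_flow_vertical h)
  refine (h1.congr_of_eventuallyEq ?_).unique (hasFDerivAt_flow_vertical hm)
  have hc := (hasFDerivAt_flow_vertical h).continuousAt.eventually
    (eventually_flowDomain_vertical h')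
  filter_upwards [eventually_flowDomain_vertical h, hc] with b' hb' hb''
  exact (flow_flow hb' hb'').symm

theorem flowDeriv_injective {x x' : ℝ} {b : Fin (n + 1) → ℝ} (h : ((x, b), x') ∈ E.flowDomain) :
    Function.Injective (E.flowDeriv (x, b) x') := by
  have hr := reaches_flow h
  have h' : ((x', E.flow ((x, b), x')), x) ∈ E.flowDomain := hr.symm.mem_flowDomain
  have h1 := flowDeriv_comp h h'
  rw [flowDeriv_self hr.left_mem] at h1
  intro v w hvw
  have h2 := DFunLike.congr_fun h1
  simp only [ContinuousLinearMap.comp_apply, ContinuousLinearMap.id_apply] at h2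
  rw [← h2 v, hvw, h2 w]

theorem flowDeriv_surjective {x x' : ℝ} {b : Fin (n + 1) → ℝ} (h : ((x, b), x') ∈ E.flowDomain) :
    Function.Surjective (E.flowDeriv (x, b) x') :=
  LinearMap.surjective_of_injective
    (f := (E.flowDeriv (x, b) x' : (Fin (n + 1) → ℝ) →ₗ[ℝ] (Fin (n + 1) → ℝ)))
    (flowDeriv_injective h)

/-- The vertical derivative of the first order system is the first order system of the linearized
equation, which ties the variational equation to `Solution.linearization`. -/
theorem fderiv_field_vertical {z : ℝ × (Fin (n + 1) → ℝ)} (hz : z ∈ E.domain)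
    (v : Fin (n + 1) → ℝ) :
    fderiv ℝ E.field z (0, v) =
      Fin.snoc (α := fun _ => ℝ) (fun i : Fin n => v i.succ) (-∑ i, E.linCoeff i z * v i) := by
  have hd : DifferentiableAt ℝ E.field z :=
    (E.contDiffOn_field.contDiffAt (E.domain.isOpen.mem_nhds hz)).differentiableAt (by simp)
  funext i
  have h1 : fderiv ℝ E.field z (0, v) i = fderiv ℝ (fun z => E.field z i) z (0, v) := by
    rw [fderiv_apply hd]; rfl
  rw [h1]
  refine Fin.lastCases ?_ (fun i => ?_) i
  · simp only [field_last, Fin.snoc_last]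
    have h2 : ((0 : ℝ), v) = ∑ i, v i • ((0 : ℝ), (Pi.single i 1 : Fin (n + 1) → ℝ)) := by
      refine Prod.ext (by simp [Prod.fst_sum]) ?_
      rw [Prod.snd_sum]
      simpa using (pi_eq_sum_univ' v)
    rw [h2, map_sum]
    simp only [map_smul, smul_eq_mul, linCoeff, neg_mul, Finset.sum_neg_distrib, neg_neg]
    exact Finset.sum_congr rfl fun i _ => mul_comm _ _
  · simp only [field_castSucc, Fin.snoc_castSucc]
    have h2 : HasFDerivAt (fun z : ℝ × (Fin (n + 1) → ℝ) => z.2 i.succ)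
        ((ContinuousLinearMap.proj i.succ).comp (ContinuousLinearMap.snd ℝ ℝ (Fin (n + 1) → ℝ)))
        z :=
      (((ContinuousLinearMap.proj i.succ : (Fin (n + 1) → ℝ) →L[ℝ] ℝ)).comp
        (ContinuousLinearMap.snd ℝ ℝ (Fin (n + 1) → ℝ))).hasFDerivAt
    rw [h2.fderiv]
    rfl

/-- The variational equation: differentiate `∂ₓ flow = field (x, flow)` in a vertical direction and
interchange the two derivatives. -/
theorem hasDerivAt_flowDeriv {z : ℝ × (Fin (n + 1) → ℝ)} {x : ℝ} (h : (z, x) ∈ E.flowDomain)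
    (v : Fin (n + 1) → ℝ) :
    HasDerivAt (fun x => E.flowDeriv z x v)
      (fderiv ℝ E.field (x, E.flow (z, x)) (0, E.flowDeriv z x v)) x := by
  have hs := contDiffAt_flow h
  have hd : DifferentiableAt ℝ (fderiv ℝ E.flow) (z, x) :=
    (hs.fderiv_right (m := 1) (by rw [one_add_one_eq_two]; exact two_le_infty)).differentiableAt (by simp)
  have hline : HasDerivAt (fun t : ℝ => (z, t)) ((0 : ℝ × (Fin (n + 1) → ℝ)), (1 : ℝ)) x :=
    (hasDerivAt_const x z).prodMk (hasDerivAt_id x)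
  have h1 : HasDerivAt (fun t => fderiv ℝ E.flow (z, t))
      (fderiv ℝ (fderiv ℝ E.flow) (z, x) (0, 1)) x :=
    HasFDerivAt.comp_hasDerivAt (l := fderiv ℝ E.flow) x hd.hasFDerivAt hline
  have h2 : HasDerivAt (fun t => E.flowDeriv z t v)
      (fderiv ℝ (fderiv ℝ E.flow) (z, x) (0, 1) ((0, v), 0)) x :=
    h1.clm_apply (hasDerivAt_const x _) |>.congr_deriv (by simp)
  have hsymm : IsSymmSndFDerivAt ℝ E.flow (z, x) := hs.isSymmSndFDerivAt
    (by simpa using two_le_infty)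
  rw [hsymm.eq] at h2
  have h3 : (fun q => fderiv ℝ E.flow q (0, 1)) =ᶠ[𝓝 (z, x)]
      fun q => E.field (q.2, E.flow q) := by
    filter_upwards [isOpen_flowDomain.mem_nhds h] with q hq
    have hq1 : HasDerivAt (fun t => E.flow (q.1, t)) (fderiv ℝ E.flow q (0, 1)) q.2 :=
      HasFDerivAt.comp_hasDerivAt (l := E.flow) q.2
        ((contDiffAt_flow hq).differentiableAt (by simp)).hasFDerivAt
        ((hasDerivAt_const q.2 q.1).prodMk (hasDerivAt_id q.2))
    exact hq1.unique (hasDerivAt_flow hq)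
  have h4 : HasFDerivAt (fun q => fderiv ℝ E.flow q (0, 1))
      ((fderiv ℝ (fderiv ℝ E.flow) (z, x)).flip (0, 1)) (z, x) := by
    have := hd.hasFDerivAt.clm_apply (hasFDerivAt_const ((0 : ℝ × (Fin (n + 1) → ℝ)), (1 : ℝ)) (z, x))
    refine this.congr_fderiv ?_
    ext <;> simp
  have hf : HasFDerivAt E.field (fderiv ℝ E.field (x, E.flow (z, x))) (x, E.flow (z, x)) :=
    ((E.contDiffOn_field.contDiffAt
      (E.domain.isOpen.mem_nhds (reaches_flow h).right_mem)).differentiableAt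
        (by simp)).hasFDerivAt
  have h5 : HasFDerivAt (fun q : (ℝ × (Fin (n + 1) → ℝ)) × ℝ => E.field (q.2, E.flow q))
      ((fderiv ℝ E.field (x, E.flow (z, x))).comp
        ((ContinuousLinearMap.snd ℝ (ℝ × (Fin (n + 1) → ℝ)) ℝ).prod (fderiv ℝ E.flow (z, x))))
      (z, x) :=
    HasFDerivAt.comp (g := E.field) (z, x) hf
      (hasFDerivAt_snd.prodMk (hs.differentiableAt (by simp)).hasFDerivAt)
  have h6 := DFunLike.congr_fun ((h4.congr_of_eventuallyEq h3.symm).unique h5) ((0, v), 0)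
  refine h2.congr_deriv ?_
  simpa [flowDeriv_apply] using h6

theorem Solution.flow_eq (y : E.Solution) {x x' : ℝ} (hx : x ∈ y.interval)
    (hx' : x' ∈ y.interval) : E.flow ((x, jet n y.toFun x), x') = jet n y.toFun x' :=
  y.isCurve.flow_eq y.isOpen y.isPreconnected hx hx'

theorem Solution.mem_flowDomain (y : E.Solution) {x x' : ℝ} (hx : x ∈ y.interval)
    (hx' : x' ∈ y.interval) : ((x, jet n y.toFun x), x') ∈ E.flowDomain :=
  (y.isCurve.reaches y.isOpen y.isPreconnected hx hx').mem_flowDomain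

/-- The linearization along a solution, as a nonlinear equation. -/
abbrev Solution.linearODE (y : E.Solution) : ODE n :=
  _root_.linearODE y.isOpen y.contDiffOn_linearization

theorem Solution.isCurve_flowDeriv (y : E.Solution) {x : ℝ} (hx : x ∈ y.interval)
    (v : Fin (n + 1) → ℝ) :
    y.linearODE.IsCurve y.interval fun t => E.flowDeriv (x, jet n y.toFun x) t v := by
  intro t ht
  refine ⟨⟨ht, trivial⟩, ?_⟩
  refine (hasDerivAt_flowDeriv (y.mem_flowDomain hx ht) v).congr_deriv ?_
  rw [y.flow_eq hx ht, fderiv_field_vertical (y.jet_mem t ht)]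
  rfl

theorem Solution.jet_linearSolution (y : E.Solution) {h : ℝ → ℝ}
    (hh : IsLinearSolution n y.linearization y.interval h) {x x' : ℝ}
    (hx : x ∈ y.interval) (hx' : x' ∈ y.interval) :
    jet n h x' = E.flowDeriv (x, jet n y.toFun x) x' (jet n h x) := by
  refine (hh.isCurve y.isOpen y.contDiffOn_linearization).eqOn y.isOpen y.isPreconnected
    (y.isCurve_flowDeriv hx (jet n h x)) hx ?_ hx'
  rw [flowDeriv_self (y.jet_mem x hx)]
  rfl

open Classical in
/-- A solution of the linearization is determined by its jet at a point, which is arbitrary. -/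
def Solution.jetEquiv (y : E.Solution) (x : y.interval) :
    y.linearSolutions ≃ₗ[ℝ] (Fin (n + 1) → ℝ) :=
  LinearEquiv.ofBijective
    ({ toFun := fun h => jet n (h : ℝ → ℝ) x
       map_add' := fun h k => jet_add y.isOpen h.2.1.1 k.2.1.1 x.2
       map_smul' := fun c h => jet_smul c _ _ } :
      y.linearSolutions →ₗ[ℝ] (Fin (n + 1) → ℝ)) <| by
    constructor
    · intro h k hhk
      refine Subtype.ext (funext fun t => ?_)
      by_cases ht : t ∈ y.interval
      · exact h.2.1.eqOn y.isOpen y.isPreconnected y.contDiffOn_linearization k.2.1 x.2 hhk ht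
      · rw [h.2.2 t ht, k.2.2 t ht]
    · intro v
      have hc := y.isCurve_flowDeriv x.2 v
      have hl := hc.isLinearSolution y.isOpen y.contDiffOn_linearization
      set k : ℝ → ℝ := fun t => E.flowDeriv (x, jet n y.toFun x) t v 0 with hk
      -- Elements of `linearSolutions` vanish off the interval, so the solution given by the flow is
      -- cut off there; its jets on the open interval do not change.
      have he : Set.EqOn (y.interval.indicator k) k y.interval :=
        fun t ht => Set.indicator_of_mem ht k
      refine ⟨⟨y.interval.indicator k, hl.congr y.isOpen he,
        fun t ht => Set.indicator_of_notMem ht k⟩, ?_⟩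
      change jet n (y.interval.indicator k) x = v
      rw [jet_congr (Filter.eventually_of_mem (y.isOpen.mem_nhds x.2) he),
        hc.jet_eq y.isOpen x.2, flowDeriv_self (y.jet_mem x x.2)]
      rfl

@[simp]
theorem Solution.jetEquiv_apply (y : E.Solution) (x : y.interval) (h : y.linearSolutions) :
    y.jetEquiv x h = jet n (h : ℝ → ℝ) x := rfl

end ODE

/-! ### The manifold structure of the solution space -/

namespace ODE

open scoped Topology

variable {n : ℕ} {E : ODE n}

/-- By uniqueness and gluing, `SameSolution` is already an equivalence relation, so the quotient
identifies no further points. -/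
theorem proj_eq_proj_iff {a b : E.domain} :
    E.proj a = E.proj b ↔ E.Reaches a b.1.1 b.1.2 := by
  rw [← sameSolution_iff]
  refine Equivalence.quot_mk_eq_iff (r := E.SameSolution) ⟨fun a => ?_, fun {a b} h => ?_,
    fun {a b c} h h' => ?_⟩ a b
  · exact (sameSolution_iff a a).2 (reaches_self a.2)
  · exact (sameSolution_iff b a).2 ((sameSolution_iff a b).1 h).symm
  · exact (sameSolution_iff a c).2 (((sameSolution_iff a b).1 h).trans ((sameSolution_iff b c).1 h'))

theorem proj_surjective : Function.Surjective E.proj := Quot.exists_rep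

theorem isQuotientMap_proj : Topology.IsQuotientMap E.proj := isQuotientMap_quot_mk

theorem continuous_proj : Continuous E.proj := isQuotientMap_proj.continuous

/-- Saturations of open sets are open: if the leaf of `a` meets the open set at `b`, the flow to the
slice through `b` is continuous near `a`, so nearby leaves meet it too. -/
theorem isOpenMap_proj : IsOpenMap E.proj := by
  intro V hV
  rw [← isQuotientMap_proj.isOpen_preimage, isOpen_iff_mem_nhds]
  rintro a ⟨b, hb, hba⟩
  have hr : E.Reaches a b.1.1 b.1.2 := proj_eq_proj_iff.1 hba.symm
  obtain ⟨V', hV', rfl⟩ := isOpen_induced_iff.1 hV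
  have hc : ContinuousAt (fun a' : E.domain => (b.1.1, E.flow (a'.1, b.1.1))) a := by
    refine continuousAt_const.prodMk ?_
    refine ContinuousAt.comp (g := E.flow) (f := fun a' : E.domain => (a'.1, b.1.1))
      (contDiffAt_flow hr.mem_flowDomain).continuousAt ?_
    fun_prop
  have h1 : ∀ᶠ a' in 𝓝 a, (b.1.1, E.flow (a'.1, b.1.1)) ∈ V' :=
    hc (hV'.mem_nhds (by
      change (b.1.1, E.flow (a.1, b.1.1)) ∈ V'
      rw [hr.flow_eq]
      exact hb))
  have hc2 : ContinuousAt (fun a' : E.domain => (a'.1, b.1.1)) a := by fun_prop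
  have h2 : ∀ᶠ a' in 𝓝 a, (a'.1, b.1.1) ∈ E.flowDomain :=
    hc2 (isOpen_flowDomain.mem_nhds hr.mem_flowDomain)
  filter_upwards [h1, h2] with a' h3 h4
  have hr' := reaches_flow h4
  exact ⟨⟨_, hr'.right_mem⟩, h3, (proj_eq_proj_iff.2 hr').symm⟩

theorem secondCountableTopology_solutionSpace : SecondCountableTopology E.SolutionSpace :=
  isQuotientMap_proj.secondCountableTopology isOpenMap_proj

/-- The identification of the Euclidean space with the fibre of the jet space. -/
abbrev euclid (n : ℕ) : EuclideanSpace ℝ (Fin (n + 1)) ≃L[ℝ] (Fin (n + 1) → ℝ) :=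
  EuclideanSpace.equiv (Fin (n + 1)) ℝ

/-- The value of the independent variable that is used for the chart at a point of the solution
space. -/
def SolutionSpace.base (s : E.SolutionSpace) : ℝ := (Quot.out s).1.1

/-- The value (as a jet) at `x` of the solution that a point of the solution space stands for. -/
def SolutionSpace.eval (s : E.SolutionSpace) (x : ℝ) : Fin (n + 1) → ℝ :=
  E.flow ((Quot.out s).1, x)

theorem reaches_out (a : E.domain) :
    E.Reaches (Quot.out (E.proj a)).1 a.1.1 a.1.2 :=
  proj_eq_proj_iff.1 (Quot.out_eq (E.proj a))

/-- Points of one leaf reach the same values of `x`; so the choice made by `Quot.out` does not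
influence the charts. -/
theorem mem_flowDomain_out_iff (a : E.domain) (x : ℝ) :
    ((Quot.out (E.proj a)).1, x) ∈ E.flowDomain ↔ (a.1, x) ∈ E.flowDomain := by
  constructor
  · rintro ⟨w, hw⟩
    exact ⟨w, (reaches_out a).symm.trans hw⟩
  · rintro ⟨w, hw⟩
    exact ⟨w, (reaches_out a).trans hw⟩

theorem eval_proj {a : E.domain} {x : ℝ} (h : (a.1, x) ∈ E.flowDomain) :
    (E.proj a).eval x = E.flow (a.1, x) :=
  ((reaches_out a).trans (reaches_flow h)).flow_eq

theorem isOpen_flowDomain_slice (x : ℝ) :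
    IsOpen {a : E.domain | (a.1, x) ∈ E.flowDomain} :=
  isOpen_flowDomain.preimage (by fun_prop : Continuous fun a : E.domain => (a.1, x))

theorem continuousOn_flow_slice (x : ℝ) :
    ContinuousOn (fun a : E.domain => E.flow (a.1, x)) {a | (a.1, x) ∈ E.flowDomain} :=
  contDiffOn_flow.continuousOn.comp (by fun_prop) fun _ h => h

open Classical in
/-- The chart of the solution space given by the values of the solutions at `s₀.base`. -/
def sliceChart (s₀ : E.SolutionSpace) :
    OpenPartialHomeomorph E.SolutionSpace (EuclideanSpace ℝ (Fin (n + 1))) where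
  toFun s := (euclid n).symm (s.eval s₀.base)
  invFun v := if h : (s₀.base, euclid n v) ∈ E.domain then E.proj ⟨_, h⟩ else s₀
  source := {s | ((Quot.out s).1, s₀.base) ∈ E.flowDomain}
  target := {v | (s₀.base, euclid n v) ∈ E.domain}
  map_source' := by
    intro s hs
    have := (reaches_flow hs).right_mem
    rw [Set.mem_ofPred_eq, ContinuousLinearEquiv.apply_symm_apply]
    exact this
  map_target' := by
    intro v hv
    rw [Set.mem_ofPred_eq] at hv ⊢
    rw [dif_pos hv, mem_flowDomain_out_iff]
    exact (reaches_self hv).mem_flowDomain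
  left_inv' := by
    intro s hs
    obtain ⟨a, rfl⟩ := proj_surjective s
    have h1 : (a.1, s₀.base) ∈ E.flowDomain := (mem_flowDomain_out_iff a _).1 hs
    have hr := reaches_flow h1
    have h2 : (s₀.base, euclid n ((euclid n).symm ((E.proj a).eval s₀.base))) ∈ E.domain := by
      rw [ContinuousLinearEquiv.apply_symm_apply, eval_proj h1]
      exact hr.right_mem
    rw [dif_pos h2]
    refine (proj_eq_proj_iff.2 ?_).symm
    change E.Reaches a.1 s₀.base (euclid n ((euclid n).symm ((E.proj a).eval s₀.base)))
    rw [ContinuousLinearEquiv.apply_symm_apply, eval_proj h1]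
    exact hr
  right_inv' := by
    intro v hv
    rw [Set.mem_ofPred_eq] at hv
    rw [dif_pos hv, eval_proj (reaches_self hv).mem_flowDomain, flow_self hv,
      ContinuousLinearEquiv.symm_apply_apply]
  open_source := by
    rw [← isQuotientMap_proj.isOpen_preimage]
    simp only [Set.preimage_ofPred_eq, mem_flowDomain_out_iff]
    exact isOpen_flowDomain_slice _
  open_target := E.domain.isOpen.preimage (by fun_prop :
    Continuous fun v : EuclideanSpace ℝ (Fin (n + 1)) => (s₀.base, euclid n v))
  continuousOn_toFun := by
    have ho : IsOpen {s : E.SolutionSpace | ((Quot.out s).1, s₀.base) ∈ E.flowDomain} := by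
      rw [← isQuotientMap_proj.isOpen_preimage]
      simp only [Set.preimage_ofPred_eq, mem_flowDomain_out_iff]
      exact isOpen_flowDomain_slice _
    rw [isQuotientMap_proj.continuousOn_isOpen_iff ho]
    simp only [Set.preimage_ofPred_eq, mem_flowDomain_out_iff]
    refine ((euclid n).symm.continuous.comp_continuousOn
      (continuousOn_flow_slice s₀.base)).congr fun a ha => ?_
    simp only [Function.comp_apply]
    rw [eval_proj ha]
  continuousOn_invFun := by
    rw [continuousOn_iff_continuous_domRestrict]
    have : Continuous fun v : {v | (s₀.base, euclid n v) ∈ E.domain} =>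
        E.proj ⟨(s₀.base, euclid n v), v.2⟩ :=
      continuous_proj.comp (by fun_prop)
    refine this.congr fun v => ?_
    rw [Set.domRestrict_apply]
    have h : (s₀.base, euclid n v) ∈ E.domain := v.2
    exact (dif_pos (c := (s₀.base, euclid n v) ∈ E.domain) (t := fun h => E.proj ⟨_, h⟩) h).symm

theorem proj_mem_sliceChart_source {s₀ : E.SolutionSpace} {a : E.domain} :
    E.proj a ∈ (sliceChart s₀).source ↔ (a.1, s₀.base) ∈ E.flowDomain :=
  mem_flowDomain_out_iff a _

theorem sliceChart_proj {s₀ : E.SolutionSpace} {a : E.domain}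
    (h : (a.1, s₀.base) ∈ E.flowDomain) :
    sliceChart s₀ (E.proj a) = (euclid n).symm (E.flow (a.1, s₀.base)) := by
  change (euclid n).symm ((E.proj a).eval s₀.base) = _
  rw [eval_proj h]

theorem sliceChart_symm {s₀ : E.SolutionSpace} {v : EuclideanSpace ℝ (Fin (n + 1))}
    (h : (s₀.base, euclid n v) ∈ E.domain) :
    (sliceChart s₀).symm v = E.proj ⟨(s₀.base, euclid n v), h⟩ :=
  dif_pos h

theorem mem_sliceChart_source (s : E.SolutionSpace) : s ∈ (sliceChart s).source :=
  (reaches_self (Quot.out s).2).mem_flowDomain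

instance chartedSpaceSolutionSpace :
    ChartedSpace (EuclideanSpace ℝ (Fin (n + 1))) E.SolutionSpace where
  atlas := Set.range sliceChart
  chartAt := sliceChart
  mem_chart_source := mem_sliceChart_source
  chart_mem_atlas := Set.mem_range_self

/-- A change of charts is the flow from one slice to another. -/
instance isManifold_solutionSpace :
    IsManifold 𝓘(ℝ, EuclideanSpace ℝ (Fin (n + 1))) ∞ E.SolutionSpace := by
  refine isManifold_of_contDiffOn _ _ _ ?_
  rintro _ _ ⟨s, rfl⟩ ⟨s', rfl⟩
  have h1 : ∀ v ∈ ((sliceChart s).symm ≫ₕ sliceChart s').source,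
      ((s.base, euclid n v), s'.base) ∈ E.flowDomain := by
    intro v hv
    rw [OpenPartialHomeomorph.trans_source, Set.mem_inter_iff, Set.mem_preimage] at hv
    obtain ⟨h1, h2⟩ := hv
    rw [sliceChart_symm h1, proj_mem_sliceChart_source] at h2
    exact h2
  have h2 : ContDiffOn ℝ ∞ (fun v : EuclideanSpace ℝ (Fin (n + 1)) =>
      (euclid n).symm (E.flow ((s.base, euclid n v), s'.base)))
      ((sliceChart s).symm ≫ₕ sliceChart s').source := by
    refine (euclid n).symm.contDiff.comp_contDiffOn (contDiffOn_flow.comp ?_ h1)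
    exact (contDiff_const.prodMk (euclid n).contDiff).prodMk contDiff_const |>.contDiffOn
  refine (h2.congr fun v hv => ?_).mono fun v hv => hv.1
  have h3 := h1 v hv
  simp only [modelWithCornersSelf_coe, modelWithCornersSelf_coe_symm, Function.comp_apply, id_eq,
    OpenPartialHomeomorph.coe_trans]
  rw [sliceChart_symm (reaches_flow h3).left_mem, sliceChart_proj h3]

theorem extChartAt_domain_symm (a : E.domain) :
    ∀ᶠ z in 𝓝 a.1, ((extChartAt 𝓘(ℝ, ℝ × (Fin (n + 1) → ℝ)) a).symm z).1 = z := by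
  have := TopologicalSpace.Opens.chartAt_subtype_val_symm_eventuallyEq
    (H := ℝ × (Fin (n + 1) → ℝ)) E.domain (x := a)
  filter_upwards [this] with z hz
  exact hz.symm

theorem extChartAt_solutionSpace_proj {s : E.SolutionSpace} {a : E.domain}
    (h : (a.1, s.base) ∈ E.flowDomain) :
    extChartAt 𝓘(ℝ, EuclideanSpace ℝ (Fin (n + 1))) s (E.proj a) =
      (euclid n).symm (E.flow (a.1, s.base)) :=
  sliceChart_proj h

theorem mem_flowDomain_base (a : E.domain) : (a.1, (E.proj a).base) ∈ E.flowDomain :=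
  (mem_flowDomain_out_iff a _).1 (reaches_self (Quot.out (E.proj a)).2).mem_flowDomain

theorem writtenInExtChartAt_proj (a : E.domain) :
    writtenInExtChartAt 𝓘(ℝ, ℝ × (Fin (n + 1) → ℝ)) 𝓘(ℝ, EuclideanSpace ℝ (Fin (n + 1))) a
      E.proj =ᶠ[𝓝 a.1] fun z => (euclid n).symm (E.flow (z, (E.proj a).base)) := by
  have hc : ContinuousAt (fun z : ℝ × (Fin (n + 1) → ℝ) => (z, (E.proj a).base)) a.1 := by
    fun_prop
  filter_upwards [extChartAt_domain_symm a,
    hc (isOpen_flowDomain.mem_nhds (mem_flowDomain_base a))] with z h1 h2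
  simp only [writtenInExtChartAt, Function.comp_apply]
  rw [extChartAt_solutionSpace_proj (by rw [h1]; exact h2), h1]

theorem contDiffAt_flow_left {z : ℝ × (Fin (n + 1) → ℝ)} {x : ℝ} (h : (z, x) ∈ E.flowDomain) :
    ContDiffAt ℝ ∞ (fun z => E.flow (z, x)) z :=
  ContDiffAt.comp (g := E.flow) (f := fun z => (z, x)) z (contDiffAt_flow h) (by fun_prop)

theorem contMDiff_proj :
    ContMDiff 𝓘(ℝ, ℝ × (Fin (n + 1) → ℝ)) 𝓘(ℝ, EuclideanSpace ℝ (Fin (n + 1))) ∞ E.proj := by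
  intro a
  rw [contMDiffAt_iff]
  refine ⟨continuous_proj.continuousAt, ?_⟩
  have h1 : ContDiffAt ℝ ∞ (fun z => (euclid n).symm (E.flow (z, (E.proj a).base))) a.1 :=
    (euclid n).symm.contDiff.contDiffAt.comp _ (contDiffAt_flow_left (mem_flowDomain_base a))
  exact (h1.congr_of_eventuallyEq (writtenInExtChartAt_proj a)).contDiffWithinAt

/-- The derivative of the projection, in the chart at the image point. -/
def projDeriv (a : E.domain) :
    ℝ × (Fin (n + 1) → ℝ) →L[ℝ] EuclideanSpace ℝ (Fin (n + 1)) :=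
  ((euclid n).symm : (Fin (n + 1) → ℝ) →L[ℝ] EuclideanSpace ℝ (Fin (n + 1))).comp
    ((fderiv ℝ E.flow (a.1, (E.proj a).base)).comp
      (ContinuousLinearMap.inl ℝ (ℝ × (Fin (n + 1) → ℝ)) ℝ))

theorem hasMFDerivAt_proj (a : E.domain) :
    HasMFDerivAt 𝓘(ℝ, ℝ × (Fin (n + 1) → ℝ)) 𝓘(ℝ, EuclideanSpace ℝ (Fin (n + 1))) E.proj a
      (projDeriv a) := by
  refine ⟨continuous_proj.continuousAt, ?_⟩
  have h0 : HasFDerivAt (fun z => E.flow (z, (E.proj a).base))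
      ((fderiv ℝ E.flow (a.1, (E.proj a).base)).comp
        (ContinuousLinearMap.inl ℝ (ℝ × (Fin (n + 1) → ℝ)) ℝ)) a.1 :=
    HasFDerivAt.comp (g := E.flow) a.1
      ((contDiffAt_flow (mem_flowDomain_base a)).differentiableAt (by simp)).hasFDerivAt
      (hasFDerivAt_prodMk_left a.1 (E.proj a).base)
  have h1 := (euclid n).symm.hasFDerivAt.comp a.1 h0
  exact (h1.congr_of_eventuallyEq (writtenInExtChartAt_proj a)).hasFDerivWithinAt

theorem mfderiv_proj (a : E.domain) :
    mfderiv 𝓘(ℝ, ℝ × (Fin (n + 1) → ℝ)) 𝓘(ℝ, EuclideanSpace ℝ (Fin (n + 1))) E.proj a =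
      projDeriv a := (hasMFDerivAt_proj a).mfderiv

/-- Vertical vectors suffice: on them the derivative is the invertible `flowDeriv`. -/
theorem mfderiv_proj_surjective (a : E.domain) : Function.Surjective
    (mfderiv 𝓘(ℝ, ℝ × (Fin (n + 1) → ℝ)) 𝓘(ℝ, EuclideanSpace ℝ (Fin (n + 1))) E.proj a) := by
  intro w
  obtain ⟨v, hv⟩ := flowDeriv_surjective (x := a.1.1) (b := a.1.2) (mem_flowDomain_base a)
    (euclid n w)
  refine ⟨((0, v) : ℝ × (Fin (n + 1) → ℝ)), ?_⟩
  rw [mfderiv_proj]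
  exact (congrArg (euclid n).symm hv).trans ((euclid n).symm_apply_apply w)

end ODE

/-! ### Solutions of the linearization as tangent vectors -/

namespace ODE

open scoped Topology

variable {n : ℕ} {E : ODE n}

/-- The derivative of the projection along the fibres of the jet space. -/
def projDerivEquiv (a : E.domain) :
    (Fin (n + 1) → ℝ) ≃ₗ[ℝ] EuclideanSpace ℝ (Fin (n + 1)) :=
  (LinearEquiv.ofBijective
    (E.flowDeriv a.1 (E.proj a).base : (Fin (n + 1) → ℝ) →ₗ[ℝ] (Fin (n + 1) → ℝ))
    ⟨flowDeriv_injective (mem_flowDomain_base a), flowDeriv_surjective (mem_flowDomain_base a)⟩).trans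
    (euclid n).symm.toLinearEquiv

theorem projDerivEquiv_apply (a : E.domain) (v : Fin (n + 1) → ℝ) :
    projDerivEquiv a v = (euclid n).symm (E.flowDeriv a.1 (E.proj a).base v) := rfl

/-- The derivative of the identity that the projection is constant along the flow; both sides are
read in the chart at the same point, since `a` and `b` have equal projections. -/
theorem projDerivEquiv_flowDeriv {a b : E.domain} (h : E.Reaches a b.1.1 b.1.2)
    (v : Fin (n + 1) → ℝ) :
    projDerivEquiv b (E.flowDeriv a.1 b.1.1 v) = projDerivEquiv a v := by
  have hab : E.proj a = E.proj b := proj_eq_proj_iff.2 h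
  rw [projDerivEquiv_apply, projDerivEquiv_apply]
  have hb := mem_flowDomain_base b
  rw [← hab] at hb ⊢
  have hb' : b.1 = (b.1.1, E.flow (a.1, b.1.1)) := by rw [h.flow_eq]
  have := flowDeriv_comp (x := a.1.1) (b := a.1.2) (x'' := (E.proj a).base) h.mem_flowDomain
    (by rw [← hb']; exact hb)
  rw [← hb'] at this
  rw [← DFunLike.congr_fun this v]
  rfl

theorem Solution.reaches (y : E.Solution) (x x' : y.interval) :
    E.Reaches (y.lift x).1 (y.lift x').1.1 (y.lift x').1.2 :=
  y.isCurve.reaches y.isOpen y.isPreconnected x.2 x'.2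

theorem Solution.projDerivEquiv_jet (y : E.Solution) {h : ℝ → ℝ}
    (hh : IsLinearSolution n y.linearization y.interval h) (x x' : y.interval) :
    projDerivEquiv (y.lift x) (jet n h x) = projDerivEquiv (y.lift x') (jet n h x') := by
  rw [y.jet_linearSolution hh x.2 x'.2]
  exact (projDerivEquiv_flowDeriv (y.reaches x x') _).symm

/-- The isomorphism of the solution space of the linearization along `y` with the tangent space of
the solution space of the equation. -/
def Solution.tangentEquiv (y : E.Solution) :
    y.linearSolutions ≃ₗ[ℝ] TangentSpace 𝓘(ℝ, EuclideanSpace ℝ (Fin (n + 1))) y.point :=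
  (y.jetEquiv ⟨y.nonempty.choose, y.nonempty.choose_spec⟩).trans
    (projDerivEquiv (y.lift ⟨y.nonempty.choose, y.nonempty.choose_spec⟩))

theorem Solution.tangentEquiv_apply (y : E.Solution) (h : y.linearSolutions) (x : y.interval) :
    y.tangentEquiv h = projDerivEquiv (y.lift x) (jet n (h : ℝ → ℝ) x) :=
  y.projDerivEquiv_jet h.2.1 _ x

/-- All tangent spaces are the model space by definition, so no transport along `s = s'` is needed.
-/
theorem tangentMk_congr {s s' : E.SolutionSpace} (h : s = s')
    {v v' : EuclideanSpace ℝ (Fin (n + 1))} (hv : v = v') :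
    (⟨s, v⟩ : TangentBundle 𝓘(ℝ, EuclideanSpace ℝ (Fin (n + 1))) E.SolutionSpace) = ⟨s', v'⟩ := by
  subst h hv
  rfl

theorem Solution.tangentMap_proj (y : E.Solution) (h : y.linearSolutions) (x : y.interval) :
    tangentMap 𝓘(ℝ, ℝ × (Fin (n + 1) → ℝ)) 𝓘(ℝ, EuclideanSpace ℝ (Fin (n + 1))) E.proj
      ⟨y.lift x, ((0, jet n (h : ℝ → ℝ) x) : ℝ × (Fin (n + 1) → ℝ))⟩ =
        ⟨y.point, y.tangentEquiv h⟩ := by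
  refine tangentMk_congr (y.proj_lift x) ?_
  rw [mfderiv_proj]
  exact (y.tangentEquiv_apply h x).symm

end ODE

/-! ### Transformations of linear equations -/

section Transformations

open scoped Topology

theorem exists_local_rightInverse {lam : ℝ → ℝ} {x : ℝ} (hlam : ContDiffAt ℝ ∞ lam x)
    (hx : deriv lam x ≠ 0) :
    ∃ τ : ℝ → ℝ, ContDiffAt ℝ ∞ τ (lam x) ∧ τ (lam x) = x ∧ ∀ᶠ t in 𝓝 (lam x), lam (τ t) = t := by
  set e := ContinuousLinearEquiv.unitsEquivAut ℝ (Units.mk0 _ hx) with he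
  have hd : HasFDerivAt lam (e : ℝ →L[ℝ] ℝ) x := by
    have := (hlam.differentiableAt (by simp)).hasDerivAt.hasFDerivAt
    refine this.congr_fderiv ?_
    ext
    simp [he]
  have hne : (∞ : WithTop ℕ∞) ≠ 0 := by simp
  have hs : HasStrictFDerivAt lam (e : ℝ →L[ℝ] ℝ) x := hlam.hasStrictFDerivAt' hd hne
  refine ⟨hlam.localInverse hd hne, hlam.to_localInverse hd hne, ?_, ?_⟩
  · exact hlam.localInverse_apply_image hd hne
  · exact hs.eventually_right_inverse

/-- The coefficients in the derivatives of a function of the form `ρ * g ∘ lam`, where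
`ρ' = n z ρ` and `lam'' = - (a + 2 z) lam'`: the `m`-th derivative is
`∑ₖ B m k * ρ * lam' ^ k * g⁽ᵏ⁾ ∘ lam`. -/
def chainCoeff (n : ℕ) (a z : ℝ → ℝ) : ℕ → ℕ → ℝ → ℝ
  | 0 => fun k _ => if k = 0 then 1 else 0
  | m + 1 => fun k x => deriv (chainCoeff n a z m k) x +
      (n * z x - k * (a x + 2 * z x)) * chainCoeff n a z m k x +
      if k = 0 then 0 else chainCoeff n a z m (k - 1) x

variable {n : ℕ} {a b z : ℝ → ℝ} {J : Set ℝ}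

theorem chainCoeff_step (m k : ℕ) (x : ℝ) :
    chainCoeff n a z (m + 1) k x = deriv (chainCoeff n a z m k) x +
      (n * z x - k * (a x + 2 * z x)) * chainCoeff n a z m k x +
      if k = 0 then 0 else chainCoeff n a z m (k - 1) x := rfl

theorem contDiffOn_chainCoeff (hJ : IsOpen J) (ha : ContDiffOn ℝ ∞ a J) (hz : ContDiffOn ℝ ∞ z J)
    (m k : ℕ) : ContDiffOn ℝ ∞ (chainCoeff n a z m k) J := by
  induction m generalizing k with
  | zero => exact contDiffOn_const
  | succ m ih =>
    have h1 := ((contDiffOn_infty_iff_deriv_of_isOpen hJ).1 (ih k)).2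
    refine (h1.add (ContDiffOn.mul ?_ (ih k))).add ?_
    · fun_prop
    · split_ifs
      · exact contDiffOn_const
      · exact ih _

theorem chainCoeff_eq_zero {m k : ℕ} (hmk : m < k) : chainCoeff n a z m k = fun _ => 0 := by
  induction m generalizing k with
  | zero => funext x; simp [chainCoeff, hmk.ne']
  | succ m ih =>
    funext x
    simp [chainCoeff, ih (show m < k by omega), ih (show m < k - 1 by omega)]

theorem chainCoeff_self (m : ℕ) : chainCoeff n a z m m = fun _ => 1 := by
  induction m with
  | zero => funext x; simp [chainCoeff]
  | succ m ih =>
    funext x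
    simp [chainCoeff, chainCoeff_eq_zero (Nat.lt_succ_self m), ih]

/-- At `m = n` the term with `z` drops out. This is the reason for the exponent `n` in `ρ = vⁿ`: the
coefficient of `g⁽ⁿ⁾` can be removed by the choice of `a` alone. -/
theorem chainCoeff_succ (m : ℕ) : chainCoeff n a z (m + 1) m =
    fun x => -((m + 1) * m / 2) * a x + (m + 1) * (n - m) * z x := by
  induction m with
  | zero => funext x; simp [chainCoeff]
  | succ m ih =>
    funext x
    rw [chainCoeff_step, chainCoeff_self, Nat.add_sub_cancel, ih]
    simp
    ring

/-- The Riccati equation for `z` eliminates its derivative. At `m = n - 1` the term with `z ^ 2`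
vanishes, and the term with `a z` is the one cancelled by the contribution of `pₙ`. -/
theorem chainCoeff_succ_succ (hJ : IsOpen J) (ha : ContDiffOn ℝ ∞ a J) (hz : ContDiffOn ℝ ∞ z J)
    (hz' : ∀ x ∈ J, deriv z x = -a x * z x - b x - z x ^ 2) (m : ℕ) {x : ℝ} (hx : x ∈ J) :
    chainCoeff n a z (m + 2) m x =
      -((m + 2) * (m + 1) * m / 6) * deriv a x - (m + 2) * (m + 1) * (3 * n - 2 * m) / 6 * b x
      + (m + 2) * (m + 1) / 2 * (n - 1 - m) * (n - m) * z x ^ 2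
      + (m + 2) * (m + 1) ^ 2 / 2 * (m - n) * a x * z x
      + (m + 2) * (m + 1) * m * (3 * m + 1) / 24 * a x ^ 2 := by
  have hda : DifferentiableAt ℝ a x := (ha.contDiffAt (hJ.mem_nhds hx)).differentiableAt (by simp)
  have hdz : DifferentiableAt ℝ z x := (hz.contDiffAt (hJ.mem_nhds hx)).differentiableAt (by simp)
  have hd : ∀ c d : ℝ, deriv (fun x => c * a x + d * z x) x =
      c * deriv a x + d * (-a x * z x - b x - z x ^ 2) := by
    intro c d
    rw [← hz' x hx]
    exact ((hda.hasDerivAt.const_mul c).add (hdz.hasDerivAt.const_mul d)).deriv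
  induction m with
  | zero =>
    rw [chainCoeff_step, chainCoeff_succ, hd]
    simp
    ring
  | succ m ih =>
    rw [chainCoeff_step, Nat.add_sub_cancel, ih, chainCoeff_succ, hd]
    simp
    ring

theorem iteratedDeriv_mul_comp (hJ : IsOpen J) (ha : ContDiffOn ℝ ∞ a J)
    (hz : ContDiffOn ℝ ∞ z J) {rho lam : ℝ → ℝ}
    (hrho : ∀ x ∈ J, HasDerivAt rho (n * z x * rho x) x)
    (hlam : ∀ x ∈ J, HasDerivAt lam (deriv lam x) x)
    (hlam' : ∀ x ∈ J, HasDerivAt (deriv lam) (-(a x + 2 * z x) * deriv lam x) x)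
    {J' : Set ℝ} (hJ' : IsOpen J') (hmaps : Set.MapsTo lam J J') {g : ℝ → ℝ} {N : ℕ}
    (hg : ContDiffOn ℝ N g J') {m : ℕ} (hm : m ≤ N) :
    ∀ x ∈ J, iteratedDeriv m (fun x => rho x * g (lam x)) x = ∑ k ∈ Finset.range (m + 1),
      chainCoeff n a z m k x * (rho x * deriv lam x ^ k * iteratedDeriv k g (lam x)) := by
  induction m with
  | zero => intro x _; simp [chainCoeff]
  | succ m ih =>
    intro x hx
    have hev := Filter.eventually_of_mem (hJ.mem_nhds hx) (ih (by omega))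
    rw [iteratedDeriv_succ, Filter.EventuallyEq.deriv_eq hev]
    have hterm : ∀ k ∈ Finset.range (m + 1), HasDerivAt (fun x => chainCoeff n a z m k x *
        (rho x * deriv lam x ^ k * iteratedDeriv k g (lam x)))
        ((deriv (chainCoeff n a z m k) x + (n * z x - k * (a x + 2 * z x)) *
          chainCoeff n a z m k x) * (rho x * deriv lam x ^ k * iteratedDeriv k g (lam x)) +
          chainCoeff n a z m k x *
          (rho x * deriv lam x ^ (k + 1) * iteratedDeriv (k + 1) g (lam x))) x := by
      intro k hk
      have hk' : k < N := by have := Finset.mem_range.1 hk; omega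
      have h1 : HasDerivAt (chainCoeff n a z m k) (deriv (chainCoeff n a z m k) x) x :=
        (((contDiffOn_chainCoeff hJ ha hz m k).contDiffAt (hJ.mem_nhds hx)).differentiableAt
          (by simp)).hasDerivAt
      have h2 : HasDerivAt (fun x => iteratedDeriv k g (lam x))
          (iteratedDeriv (k + 1) g (lam x) * deriv lam x) x :=
        HasDerivAt.comp x (ContDiffOn.hasDerivAt_iteratedDeriv hJ' hk' hg (hmaps hx)) (hlam x hx)
      refine (h1.mul (((hrho x hx).mul ((hlam' x hx).pow k)).mul h2)).congr_deriv ?_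
      rcases k with _ | k
      · simp
        ring
      · simp
        ring
    rw [(HasDerivAt.fun_sum hterm).deriv, Finset.sum_add_distrib, Finset.sum_range_succ' _ (m + 1)]
    have h0 : ∀ k ∈ Finset.range (m + 1), chainCoeff n a z (m + 1) (k + 1) x *
        (rho x * deriv lam x ^ (k + 1) * iteratedDeriv (k + 1) g (lam x)) =
        (deriv (chainCoeff n a z m (k + 1)) x + (n * z x - (k + 1 : ℕ) * (a x + 2 * z x)) *
          chainCoeff n a z m (k + 1) x) *
            (rho x * deriv lam x ^ (k + 1) * iteratedDeriv (k + 1) g (lam x)) +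
        chainCoeff n a z m k x *
          (rho x * deriv lam x ^ (k + 1) * iteratedDeriv (k + 1) g (lam x)) := by
      intro k _
      rw [chainCoeff]
      simp
      ring
    rw [Finset.sum_congr rfl h0, Finset.sum_add_distrib, add_right_comm]
    congr 1
    rw [show chainCoeff n a z (m + 1) 0 x = deriv (chainCoeff n a z m 0) x +
      (n * z x - (0 : ℕ) * (a x + 2 * z x)) * chainCoeff n a z m 0 x by simp [chainCoeff]]
    rw [← Finset.sum_range_succ' (fun k => (deriv (chainCoeff n a z m k) x +
      (n * z x - k * (a x + 2 * z x)) * chainCoeff n a z m k x) *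
      (rho x * deriv lam x ^ k * iteratedDeriv k g (lam x))), Finset.sum_range_succ _ (m + 1),
      chainCoeff_eq_zero (Nat.lt_succ_self m)]
    simp

/-- The coefficients (up to a power of the derivative of the transformation) of the transform of a
linear equation. -/
def transformCoeff (n : ℕ) (p : Fin (n + 1) → ℝ → ℝ) (a z : ℝ → ℝ) (k : ℕ) (x : ℝ) : ℝ :=
  chainCoeff n a z (n + 1) k x + ∑ i : Fin (n + 1), p i x * chainCoeff n a z i k x

theorem linear_operator_mul_comp (hJ : IsOpen J) (ha : ContDiffOn ℝ ∞ a J)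
    (hz : ContDiffOn ℝ ∞ z J) {rho lam : ℝ → ℝ}
    (hrho : ∀ x ∈ J, HasDerivAt rho (n * z x * rho x) x)
    (hlam : ∀ x ∈ J, HasDerivAt lam (deriv lam x) x)
    (hlam' : ∀ x ∈ J, HasDerivAt (deriv lam) (-(a x + 2 * z x) * deriv lam x) x)
    {J' : Set ℝ} (hJ' : IsOpen J') (hmaps : Set.MapsTo lam J J') {g : ℝ → ℝ}
    (hg : ContDiffOn ℝ (n + 1 : ℕ) g J') (p : Fin (n + 1) → ℝ → ℝ) {x : ℝ} (hx : x ∈ J) :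
    iteratedDeriv (n + 1) (fun x => rho x * g (lam x)) x +
      ∑ i : Fin (n + 1), p i x * iteratedDeriv i (fun x => rho x * g (lam x)) x =
    ∑ k ∈ Finset.range (n + 2), transformCoeff n p a z k x *
      (rho x * deriv lam x ^ k * iteratedDeriv k g (lam x)) := by
  have h1 : ∀ m ≤ n + 1, iteratedDeriv m (fun x => rho x * g (lam x)) x =
      ∑ k ∈ Finset.range (n + 2), chainCoeff n a z m k x *
        (rho x * deriv lam x ^ k * iteratedDeriv k g (lam x)) := by
    intro m hm
    rw [iteratedDeriv_mul_comp hJ ha hz hrho hlam hlam' hJ' hmaps hg hm x hx]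
    refine Finset.sum_subset (fun k hk => ?_) fun k _ hk => ?_
    · rw [Finset.mem_range] at hk ⊢
      omega
    · rw [Finset.mem_range] at hk
      rw [chainCoeff_eq_zero (show m < k by omega), zero_mul]
  have h2 : ∀ i : Fin (n + 1), p i x * iteratedDeriv i (fun x => rho x * g (lam x)) x =
      ∑ k ∈ Finset.range (n + 2), p i x * chainCoeff n a z i k x *
        (rho x * deriv lam x ^ k * iteratedDeriv k g (lam x)) := fun i => by
    rw [h1 i i.2.le, Finset.mul_sum]
    simp only [mul_assoc]
  rw [h1 _ le_rfl, Finset.sum_congr rfl fun i _ => h2 i, Finset.sum_comm]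
  simp only [transformCoeff, add_mul, Finset.sum_add_distrib, Finset.sum_mul]

/-- Applied to `ρ g(λ)`, the operator becomes `ρ (λ')ⁿ⁺¹` times a monic operator applied to `g`,
evaluated at `λ`. The factor has no zeros, so the two equations are equivalent. -/
theorem exists_isLinearEquivalence (hJ : IsOpen J) (hJc : IsPreconnected J)
    (ha : ContDiffOn ℝ ∞ a J) (hz : ContDiffOn ℝ ∞ z J) {rho lam : ℝ → ℝ}
    (hrhos : ContDiffOn ℝ ∞ rho J) (hlams : ContDiffOn ℝ ∞ lam J)
    (hrho : ∀ x ∈ J, HasDerivAt rho (n * z x * rho x) x)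
    (hlam' : ∀ x ∈ J, HasDerivAt (deriv lam) (-(a x + 2 * z x) * deriv lam x) x)
    (hrho0 : ∀ x ∈ J, rho x ≠ 0) (hlam0 : ∀ x ∈ J, deriv lam x ≠ 0) (hinj : Set.InjOn lam J)
    (p : Fin (n + 1) → ℝ → ℝ) :
    ∃ q : Fin (n + 1) → ℝ → ℝ, IsLinearEquivalence n p J lam (fun x => (rho x)⁻¹) q ∧
      IsOpen (lam '' J) ∧
      ∀ i, ∀ x ∈ J, q i (lam x) = transformCoeff n p a z i x / deriv lam x ^ (n + 1 - (i : ℕ)) := by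
  have hlam : ∀ x ∈ J, HasDerivAt lam (deriv lam x) x := fun x hx =>
    ((hlams.contDiffAt (hJ.mem_nhds hx)).differentiableAt (by simp)).hasDerivAt
  -- The new coefficients are determined on the image of `λ` only; each carries the power of `λ'`
  -- left after dividing by `(λ')ⁿ⁺¹`.
  set q : Fin (n + 1) → ℝ → ℝ := fun i t =>
    transformCoeff n p a z i (Function.invFunOn lam J t) /
      deriv lam (Function.invFunOn lam J t) ^ (n + 1 - (i : ℕ)) with hq
  have hqx : ∀ i, ∀ x ∈ J,
      q i (lam x) = transformCoeff n p a z i x / deriv lam x ^ (n + 1 - (i : ℕ)) := by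
    intro i x hx
    simp only [hq]
    rw [hinj.leftInvOn_invFunOn hx]
  have hinv : ∀ x ∈ J, ∃ τ : ℝ → ℝ, ContDiffAt ℝ ∞ τ (lam x) ∧ τ (lam x) = x ∧
      ∀ᶠ t in 𝓝 (lam x), τ t ∈ J ∧ lam (τ t) = t := by
    intro x hx
    obtain ⟨τ, h1, h2, h3⟩ :=
      exists_local_rightInverse (hlams.contDiffAt (hJ.mem_nhds hx)) (hlam0 x hx)
    refine ⟨τ, h1, h2, Filter.Eventually.and ?_ h3⟩
    exact h1.continuousAt (by rw [h2]; exact hJ.mem_nhds hx)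
  have hJ' : IsOpen (lam '' J) := by
    rw [isOpen_iff_mem_nhds]
    rintro _ ⟨x, hx, rfl⟩
    obtain ⟨τ, -, -, h3⟩ := hinv x hx
    exact h3.mono fun t ht => ⟨τ t, ht⟩
  have hfun : ∀ g : ℝ → ℝ, (fun x => g (lam x) / (rho x)⁻¹) = fun x => rho x * g (lam x) := by
    intro g
    funext x
    rw [div_inv_eq_mul, mul_comm]
  have hop : ∀ g : ℝ → ℝ, ContDiffOn ℝ (n + 1 : ℕ) g (lam '' J) → ∀ x ∈ J,
      iteratedDeriv (n + 1) (fun x => rho x * g (lam x)) x +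
        ∑ i : Fin (n + 1), p i x * iteratedDeriv i (fun x => rho x * g (lam x)) x =
      rho x * deriv lam x ^ (n + 1) * (iteratedDeriv (n + 1) g (lam x) +
        ∑ i : Fin (n + 1), q i (lam x) * iteratedDeriv i g (lam x)) := by
    intro g hg x hx
    rw [linear_operator_mul_comp hJ ha hz hrho hlam hlam' hJ' (Set.mapsTo_image lam J) hg p hx,
      Finset.sum_range_succ]
    have htop : transformCoeff n p a z (n + 1) x = 1 := by
      have : ∀ i : Fin (n + 1), chainCoeff n a z i (n + 1) x = 0 := fun i => by
        rw [chainCoeff_eq_zero i.2]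
      simp [transformCoeff, chainCoeff_self, this]
    rw [htop, mul_add, Finset.mul_sum, Finset.sum_range, add_comm]
    congr 1
    · ring
    · refine Finset.sum_congr rfl fun i _ => ?_
      rw [hqx i x hx]
      have hpow : deriv lam x ^ (n + 1) =
          deriv lam x ^ (n + 1 - (i : ℕ)) * deriv lam x ^ (i : ℕ) := by
        rw [← pow_add]
        congr 1
        have := i.2
        omega
      have hne : deriv lam x ^ (n + 1 - (i : ℕ)) ≠ 0 := pow_ne_zero _ (hlam0 x hx)
      rw [hpow]
      field_simp
  refine ⟨q, ⟨hJ, hJc, hlams, hrhos.inv hrho0, hlam0, fun x hx => inv_ne_zero (hrho0 x hx),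
    fun g => ?_⟩, hJ', hqx⟩
  rw [hfun]
  constructor
  · rintro ⟨hg, heq⟩
    refine ⟨?_, fun x hx => ?_⟩
    · exact (hrhos.of_le (by exact_mod_cast le_top)).mul
        (hg.comp (hlams.of_le (by exact_mod_cast le_top)) (Set.mapsTo_image lam J))
    · rw [hop g hg x hx, heq _ (Set.mem_image_of_mem lam hx), mul_zero]
  · rintro ⟨hh, heq⟩
    -- Regularity of `g` comes from that of `ρ g(λ)` by dividing by `ρ` and composing with a smooth
    -- local inverse of `λ`.
    have hg : ContDiffOn ℝ (n + 1 : ℕ) g (lam '' J) := by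
      rintro _ ⟨x, hx, rfl⟩
      obtain ⟨τ, h1, h2, h3⟩ := hinv x hx
      have hk : ContDiffAt ℝ (n + 1 : ℕ) (fun x => (rho x)⁻¹ * (rho x * g (lam x))) x :=
        (((hrhos.inv hrho0).contDiffAt (hJ.mem_nhds hx)).of_le
          (by exact_mod_cast le_top)).mul (hh.contDiffAt (hJ.mem_nhds hx))
      have hk' : ContDiffAt ℝ (n + 1 : ℕ)
          (fun t => (rho (τ t))⁻¹ * (rho (τ t) * g (lam (τ t)))) (lam x) :=
        ContDiffAt.comp (g := fun x => (rho x)⁻¹ * (rho x * g (lam x))) (lam x)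
          (by rw [h2]; exact hk) (h1.of_le (by exact_mod_cast le_top))
      refine (hk'.congr_of_eventuallyEq ?_).contDiffWithinAt
      filter_upwards [h3] with t ht
      rw [ht.2, inv_mul_cancel_left₀ (hrho0 _ ht.1)]
    refine ⟨hg, ?_⟩
    rintro _ ⟨x, hx, rfl⟩
    have := hop g hg x hx
    rw [heq x hx] at this
    exact (mul_eq_zero.1 this.symm).resolve_left
      (mul_ne_zero (hrho0 x hx) (pow_ne_zero _ (hlam0 x hx)))

end Transformations

/-! ### Laguerre–Forsyth forms -/

section LaguerreForsyth

open scoped Topology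

/-- The coefficient of `v'` in the second order equation `v'' + a v' + b v = 0` associated with a
linear equation. -/
def projCoeffA (n : ℕ) (p : Fin (n + 1) → ℝ → ℝ) (x : ℝ) : ℝ :=
  2 * p (Fin.last n) x / (n * (n + 1))

/-- The coefficient of `v` in the second order equation `v'' + a v' + b v = 0` associated with a
linear equation. -/
def projCoeffB (n : ℕ) (p : Fin (n + 1) → ℝ → ℝ) (x : ℝ) : ℝ :=
  (p ⟨n - 1, by omega⟩ x - (n + 1) * n * (n - 1) / 6 * deriv (projCoeffA n p) x -
    (n + 1) * n * (n - 1) * (3 * n + 2) / 24 * projCoeffA n p x ^ 2) / (n * (n + 1) * (n + 2) / 6)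

variable {n : ℕ} {p : Fin (n + 1) → ℝ → ℝ} {J : Set ℝ}

theorem contDiffOn_projCoeffA (hp : ∀ i, ContDiffOn ℝ ∞ (p i) J) :
    ContDiffOn ℝ ∞ (projCoeffA n p) J :=
  (contDiffOn_const.mul (hp _)).div_const _

theorem contDiffOn_projCoeffB (hJ : IsOpen J) (hp : ∀ i, ContDiffOn ℝ ∞ (p i) J) :
    ContDiffOn ℝ ∞ (projCoeffB n p) J := by
  have h1 := contDiffOn_projCoeffA hp
  have h2 := ((contDiffOn_infty_iff_deriv_of_isOpen hJ).1 h1).2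
  exact (((hp _).sub (contDiffOn_const.mul h2)).sub (contDiffOn_const.mul (h1.pow 2))).div_const _

theorem transformCoeff_self (hn : 1 ≤ n) (z : ℝ → ℝ) (x : ℝ) :
    transformCoeff n p (projCoeffA n p) z n x = 0 := by
  have h : ∀ i : Fin n, chainCoeff n (projCoeffA n p) z (i.castSucc : Fin (n + 1)) n x = 0 :=
    fun i => by rw [chainCoeff_eq_zero (by simp)]
  have hn' : (n : ℝ) ≠ 0 := by positivity
  rw [transformCoeff, Fin.sum_univ_castSucc, chainCoeff_succ]
  simp only [h, Fin.val_last, chainCoeff_self, projCoeffA]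
  simp
  field_simp
  ring

/-- Only the orders `n + 1`, `n` and `n - 1` contribute. The definition of `projCoeffB` solves the
resulting equation for `b`, with `pₙ = n (n + 1) a / 2`. -/
theorem transformCoeff_pred (hn : 1 ≤ n) (hJ : IsOpen J) (hp : ∀ i, ContDiffOn ℝ ∞ (p i) J)
    {z : ℝ → ℝ} (hz : ContDiffOn ℝ ∞ z J)
    (hz' : ∀ x ∈ J, deriv z x = -projCoeffA n p x * z x - projCoeffB n p x - z x ^ 2)
    {x : ℝ} (hx : x ∈ J) :
    transformCoeff n p (projCoeffA n p) z (n - 1) x = 0 := by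
  obtain ⟨l, rfl⟩ := Nat.exists_eq_add_of_le' hn
  have h : ∀ i : Fin l, chainCoeff (l + 1) (projCoeffA (l + 1) p) z
      (i : ℕ) l x = 0 :=
    fun i => by rw [chainCoeff_eq_zero i.2]
  have hl : (l : ℝ) + 1 ≠ 0 := by positivity
  have hl2 : (l : ℝ) + 2 ≠ 0 := by positivity
  have hl3 : (l : ℝ) + 3 ≠ 0 := by positivity
  have hpa : p (Fin.last (l + 1)) x = (l + 1) * (l + 2) / 2 * projCoeffA (l + 1) p x := by
    simp only [projCoeffA]
    push_cast
    field_simp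
    ring
  have hpb : p (Fin.last l).castSucc x = (l + 1) * (l + 2) * (l + 3) / 6 * projCoeffB (l + 1) p x +
      (l + 2) * (l + 1) * l / 6 * deriv (projCoeffA (l + 1) p) x +
      (l + 2) * (l + 1) * l * (3 * l + 5) / 24 * projCoeffA (l + 1) p x ^ 2 := by
    have : (⟨l + 1 - 1, by omega⟩ : Fin (l + 1 + 1)) = (Fin.last l).castSucc := by
      ext; simp
    simp only [projCoeffB, this]
    push_cast
    field_simp
    ring
  rw [transformCoeff, Fin.sum_univ_castSucc, Fin.sum_univ_castSucc]
  simp only [Nat.add_sub_cancel, Fin.val_last, Fin.val_castSucc, h]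
  rw [chainCoeff_succ_succ hJ (contDiffOn_projCoeffA hp) hz hz' l hx, chainCoeff_self,
    chainCoeff_succ, hpa, hpb]
  push_cast
  simp
  ring

/-- A basis `v, w` of solutions of `v'' + a v' + b v = 0` on the open interval `J`, with `v`
positive and of positive Wronskian. -/
structure IsProjectivePair (a b : ℝ → ℝ) (J : Set ℝ) (v w : ℝ → ℝ) : Prop where
  isOpen : IsOpen J
  isPreconnected : IsPreconnected J
  contDiffOn_left : ContDiffOn ℝ ∞ v J
  contDiffOn_right : ContDiffOn ℝ ∞ w J
  deriv_deriv_left : ∀ x ∈ J, HasDerivAt (deriv v) (-a x * deriv v x - b x * v x) x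
  deriv_deriv_right : ∀ x ∈ J, HasDerivAt (deriv w) (-a x * deriv w x - b x * w x) x
  pos_left : ∀ x ∈ J, 0 < v x
  wronskian_pos : ∀ x ∈ J, 0 < v x * deriv w x - w x * deriv v x

theorem exists_second_order_solution {a b : ℝ → ℝ} {I : Set ℝ} (hI : IsOpen I)
    (ha : ContDiffOn ℝ ∞ a I) (hb : ContDiffOn ℝ ∞ b I) {x₀ : ℝ} (hx₀ : x₀ ∈ I) (c₀ c₁ : ℝ) :
    ∃ (δ : ℝ) (v : ℝ → ℝ), 0 < δ ∧ Set.Ioo (x₀ - δ) (x₀ + δ) ⊆ I ∧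
      ContDiffOn ℝ ∞ v (Set.Ioo (x₀ - δ) (x₀ + δ)) ∧
      (∀ x ∈ Set.Ioo (x₀ - δ) (x₀ + δ), HasDerivAt (deriv v) (-a x * deriv v x - b x * v x) x) ∧
      v x₀ = c₀ ∧ deriv v x₀ = c₁ := by
  have hp : ∀ i, ContDiffOn ℝ ∞ ((![b, a] : Fin 2 → ℝ → ℝ) i) I := by
    intro i
    fin_cases i
    · exact hb
    · exact ha
  -- The second order equation is the case `n = 1` of the linear equations above, with coefficients
  -- in the order `b, a`.
  obtain ⟨δ, u, hδ, hu, h0⟩ := ODE.exists_isCurve (E := linearODE (n := 1) hI hp)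
    (z := (x₀, ![c₀, c₁])) ⟨hx₀, trivial⟩
  have hsub : Set.Ioo (x₀ - δ) (x₀ + δ) ⊆ I := fun x hx => (hu x hx).1.1
  have hd0 : ∀ x ∈ Set.Ioo (x₀ - δ) (x₀ + δ), HasDerivAt (fun x => u x 0) (u x 1) x :=
    fun x hx => by
      have := hasDerivAt_pi.1 (hu x hx).2 (Fin.castSucc (0 : Fin 1))
      rwa [ODE.field_castSucc] at this
  have hd1 : ∀ x ∈ Set.Ioo (x₀ - δ) (x₀ + δ),
      HasDerivAt (fun x => u x 1) (-a x * u x 1 - b x * u x 0) x := fun x hx => by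
    have := hasDerivAt_pi.1 (hu x hx).2 (Fin.last 1)
    rw [ODE.field_last] at this
    refine this.congr_deriv ?_
    simp [linearODE, Fin.sum_univ_two]
    ring
  have hx : x₀ ∈ Set.Ioo (x₀ - δ) (x₀ + δ) := ⟨by linarith, by linarith⟩
  refine ⟨δ, fun x => u x 0, hδ, hsub, contDiffOn_pi.1 (hu.contDiffOn isOpen_Ioo) 0,
    fun x hx => ?_, by simp [h0], ?_⟩
  · have he : deriv (fun x => u x 0) =ᶠ[𝓝 x] fun x => u x 1 :=
      Filter.eventually_of_mem (isOpen_Ioo.mem_nhds hx) fun t ht => (hd0 t ht).deriv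
    rw [he.eq_of_nhds]
    exact (hd1 x hx).congr_of_eventuallyEq he
  · rw [(hd0 x₀ hx).deriv, h0]
    simp

theorem exists_isProjectivePair {a b : ℝ → ℝ} {I : Set ℝ} (hI : IsOpen I)
    (ha : ContDiffOn ℝ ∞ a I) (hb : ContDiffOn ℝ ∞ b I) {x₀ : ℝ} (hx₀ : x₀ ∈ I) :
    ∃ J ⊆ I, x₀ ∈ J ∧ ∃ v w : ℝ → ℝ, IsProjectivePair a b J v w ∧ v x₀ = 1 ∧ deriv v x₀ = 0 ∧
      w x₀ = 0 ∧ deriv w x₀ = 1 := by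
  obtain ⟨δ, v, hδ, hI1, hv, hv', hv0, hv1⟩ := exists_second_order_solution hI ha hb hx₀ 1 0
  obtain ⟨ε, w, hε, hI2, hw, hw', hw0, hw1⟩ := exists_second_order_solution hI ha hb hx₀ 0 1
  have hxδ : x₀ ∈ Set.Ioo (x₀ - δ) (x₀ + δ) := ⟨by linarith, by linarith⟩
  have hxε : x₀ ∈ Set.Ioo (x₀ - ε) (x₀ + ε) := ⟨by linarith, by linarith⟩
  have hcv : ContinuousAt v x₀ := (hv.contDiffAt (isOpen_Ioo.mem_nhds hxδ)).continuousAt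
  have hcw : ContinuousAt w x₀ := (hw.contDiffAt (isOpen_Ioo.mem_nhds hxε)).continuousAt
  have hcW : ContinuousAt (fun x => v x * deriv w x - w x * deriv v x) x₀ :=
    (hcv.mul (hw' x₀ hxε).continuousAt).sub (hcw.mul (hv' x₀ hxδ).continuousAt)
  have h1 : ∀ᶠ x in 𝓝 x₀, 0 < v x := hcv.eventually_const_lt (by rw [hv0]; exact one_pos)
  have h2 : ∀ᶠ x in 𝓝 x₀, 0 < v x * deriv w x - w x * deriv v x :=
    hcW.eventually_const_lt (by simp [hv0, hw1, hw0])
  obtain ⟨r, hr, hball⟩ := Metric.eventually_nhds_iff_ball.1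
    ((isOpen_Ioo.eventually_mem hxδ).and ((isOpen_Ioo.eventually_mem hxε).and (h1.and h2)))
  rw [Real.ball_eq_Ioo] at hball
  have hs1 : Set.Ioo (x₀ - r) (x₀ + r) ⊆ Set.Ioo (x₀ - δ) (x₀ + δ) := fun x hx => (hball x hx).1
  have hs2 : Set.Ioo (x₀ - r) (x₀ + r) ⊆ Set.Ioo (x₀ - ε) (x₀ + ε) := fun x hx => (hball x hx).2.1
  exact ⟨Set.Ioo (x₀ - r) (x₀ + r), hs1.trans hI1, ⟨by linarith, by linarith⟩, v, w,
    ⟨isOpen_Ioo, isPreconnected_Ioo, hv.mono hs1, hw.mono hs2, fun x hx => hv' x (hs1 hx),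
      fun x hx => hw' x (hs2 hx), fun x hx => (hball x hx).2.2.1,
      fun x hx => (hball x hx).2.2.2⟩, hv0, hv1, hw0, hw1⟩

namespace IsProjectivePair

variable {a b v w : ℝ → ℝ}

theorem hasDerivAt_left (h : IsProjectivePair a b J v w) {x : ℝ} (hx : x ∈ J) :
    HasDerivAt v (deriv v x) x :=
  ((h.contDiffOn_left.contDiffAt (h.isOpen.mem_nhds hx)).differentiableAt (by simp)).hasDerivAt

theorem hasDerivAt_right (h : IsProjectivePair a b J v w) {x : ℝ} (hx : x ∈ J) :
    HasDerivAt w (deriv w x) x :=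
  ((h.contDiffOn_right.contDiffAt (h.isOpen.mem_nhds hx)).differentiableAt (by simp)).hasDerivAt

theorem hasDerivAt_div (h : IsProjectivePair a b J v w) {x : ℝ} (hx : x ∈ J) :
    HasDerivAt (fun x => w x / v x) ((v x * deriv w x - w x * deriv v x) / v x ^ 2) x :=
  ((h.hasDerivAt_right hx).fun_div (h.hasDerivAt_left hx) (h.pos_left x hx).ne').congr_deriv
    (by ring)

theorem deriv_div_pos (h : IsProjectivePair a b J v w) {x : ℝ} (hx : x ∈ J) :
    0 < deriv (fun x => w x / v x) x := by
  rw [(h.hasDerivAt_div hx).deriv]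
  have := h.wronskian_pos x hx
  have := h.pos_left x hx
  positivity

theorem strictMonoOn_div (h : IsProjectivePair a b J v w) :
    StrictMonoOn (fun x => w x / v x) J := by
  refine strictMonoOn_of_deriv_pos h.isPreconnected.ordConnected.convex
    (fun x hx => (h.hasDerivAt_div hx).continuousAt.continuousWithinAt) fun x hx => ?_
  exact h.deriv_div_pos (interior_subset hx)

theorem deriv_div_eventuallyEq (h : IsProjectivePair a b J v w) {x : ℝ} (hx : x ∈ J) :
    deriv (fun x => w x / v x) =ᶠ[𝓝 x]
      fun x => (v x * deriv w x - w x * deriv v x) / v x ^ 2 :=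
  Filter.eventually_of_mem (h.isOpen.mem_nhds hx) fun _ ht => (h.hasDerivAt_div ht).deriv

/-- The Wronskian `W = v w' - w v'` satisfies `W' = -a W`, and `λ' = W / v²`. So `λ'' = -(a + 2
v'/v) λ'`, the relation required in `chainCoeff` with `z = v'/v`. -/
theorem hasDerivAt_deriv_div (h : IsProjectivePair a b J v w) {x : ℝ} (hx : x ∈ J) :
    HasDerivAt (deriv fun x => w x / v x)
      (-(a x + 2 * (deriv v x / v x)) * deriv (fun x => w x / v x) x) x := by
  have he := h.deriv_div_eventuallyEq hx
  have hv := h.hasDerivAt_left hx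
  have hw := h.hasDerivAt_right hx
  have hne := (h.pos_left x hx).ne'
  have h1 := ((hv.fun_mul (h.deriv_deriv_right x hx)).fun_sub
    (hw.fun_mul (h.deriv_deriv_left x hx))).fun_div (hv.fun_pow 2) (pow_ne_zero 2 hne)
  refine (h1.congr_of_eventuallyEq he).congr_deriv ?_
  rw [he.eq_of_nhds]
  field_simp
  ring

theorem contDiffOn_div (h : IsProjectivePair a b J v w) :
    ContDiffOn ℝ ∞ (fun x => w x / v x) J :=
  h.contDiffOn_right.div h.contDiffOn_left fun x hx => (h.pos_left x hx).ne'

theorem contDiffOn_logDeriv (h : IsProjectivePair a b J v w) :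
    ContDiffOn ℝ ∞ (fun x => deriv v x / v x) J :=
  ((contDiffOn_infty_iff_deriv_of_isOpen h.isOpen).1 h.contDiffOn_left).2.div h.contDiffOn_left
    fun x hx => (h.pos_left x hx).ne'

/-- The logarithmic derivative turns the second order linear equation into the Riccati equation used
in `transformCoeff_pred`. -/
theorem deriv_logDeriv (h : IsProjectivePair a b J v w) {x : ℝ} (hx : x ∈ J) :
    deriv (fun x => deriv v x / v x) x =
      -a x * (deriv v x / v x) - b x - (deriv v x / v x) ^ 2 := by
  have hne := (h.pos_left x hx).ne'
  rw [((h.deriv_deriv_left x hx).fun_div (h.hasDerivAt_left hx) hne).deriv]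
  field_simp

theorem hasDerivAt_pow_left (h : IsProjectivePair a b J v w) (n : ℕ) {x : ℝ} (hx : x ∈ J) :
    HasDerivAt (fun x => v x ^ n) (n * (deriv v x / v x) * v x ^ n) x := by
  have hne := (h.pos_left x hx).ne'
  refine ((h.hasDerivAt_left hx).fun_pow n).congr_deriv ?_
  rcases n with _ | n
  · simp
  · rw [Nat.add_sub_cancel, pow_succ]
    field_simp

end IsProjectivePair

/-- The choices `ρ = vⁿ`, `λ = w / v`, `z = v'/v` meet all requirements of the transformation
formula, and `a`, `b` are made to remove the two highest coefficients. -/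
theorem exists_laguerreForsyth (hn : 1 ≤ n) (hp : ∀ i, ContDiffOn ℝ ∞ (p i) J) {v w : ℝ → ℝ}
    (h : IsProjectivePair (projCoeffA n p) (projCoeffB n p) J v w) :
    ∃ q : Fin (n + 1) → ℝ → ℝ,
      IsLinearEquivalence n p J (fun x => w x / v x) (fun x => (v x ^ n)⁻¹) q ∧
      IsOpen ((fun x => w x / v x) '' J) ∧
      IsLaguerreForsyth n q ((fun x => w x / v x) '' J) := by
  obtain ⟨q, hq, ho, hqx⟩ := exists_isLinearEquivalence h.isOpen h.isPreconnected
    (contDiffOn_projCoeffA hp) h.contDiffOn_logDeriv (h.contDiffOn_left.pow n) h.contDiffOn_div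
    (fun x hx => h.hasDerivAt_pow_left n hx) (fun x hx => h.hasDerivAt_deriv_div hx)
    (fun x hx => pow_ne_zero n (h.pos_left x hx).ne') (fun x hx => (h.deriv_div_pos hx).ne')
    h.strictMonoOn_div.injOn p
  refine ⟨q, hq, ho, ?_⟩
  rintro _ ⟨x, hx, rfl⟩ i hi
  rw [hqx i x hx]
  have hi' : (i : ℕ) = n ∨ (i : ℕ) = n - 1 := by
    have := i.2
    omega
  rcases hi' with hi' | hi'
  · rw [hi', transformCoeff_self hn, zero_div]
  · rw [hi', transformCoeff_pred hn h.isOpen hp h.contDiffOn_logDeriv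
      (fun x hx => h.deriv_logDeriv hx) hx, zero_div]

/-- A Laguerre–Forsyth form with vanishing invariants is trivial. -/
theorem IsLaguerreForsyth.eq_zero {q : Fin (n + 1) → ℝ → ℝ} {J' : Set ℝ} (hJ' : IsOpen J')
    (hq : IsLaguerreForsyth n q J')
    (hθ : ∀ k, 3 ≤ k → k ≤ n + 1 → ∀ t ∈ J', laguerreForsythTheta n k q t = 0) :
    ∀ i, ∀ t ∈ J', q i t = 0 := by
  have key : ∀ k, 3 ≤ k → ∀ i : Fin (n + 1), (i : ℕ) + k = n + 1 → ∀ t ∈ J', q i t = 0 := by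
    intro k
    induction k using Nat.strong_induction_on with
    | _ k ih =>
      intro hk i hi t ht
      have h1 := hθ k hk (by omega) t ht
      -- Strong induction on the weight: the coefficient in the `j`-th term belongs to the weight `k
      -- - (j - 1)`, so for `j > 1` it vanishes near `t`, with its derivatives. Only `j = 1`
      -- remains, with a nonzero factor.
      rw [laguerreForsythTheta, Finset.sum_eq_single 1] at h1
      · have hi1 : Fin.ofNat (n + 1) (n + 1 - k) = i := by
          ext
          rw [Fin.val_ofNat, Nat.mod_eq_of_lt (by omega)]
          omega
        rw [hi1] at h1
        simp only [Nat.sub_self, iteratedDeriv_zero] at h1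
        refine (mul_eq_zero.1 h1).resolve_left ?_
        have h2 : (((2 * k - 1 - 1)! * (n + 1 - k)! : ℕ) : ℝ) ≠ 0 := by
          exact_mod_cast (mul_pos (Nat.factorial_pos _) (Nat.factorial_pos _)).ne'
        have h3 : (((k - 1)! * (0)! : ℕ) : ℝ) ≠ 0 := by
          exact_mod_cast (mul_pos (Nat.factorial_pos _) (Nat.factorial_pos _)).ne'
        exact div_ne_zero (mul_ne_zero (by norm_num) h2) h3
      · intro j hj hj1
        rw [Finset.mem_Icc] at hj
        have hq0 : q (Fin.ofNat (n + 1) (n + j - k)) =ᶠ[𝓝 t] fun _ => 0 :=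
          Filter.eventually_of_mem (hJ'.mem_nhds ht) (ih (k - (j - 1)) (by omega) (by omega) _ (by
            rw [Fin.val_ofNat, Nat.mod_eq_of_lt (by omega)]
            omega))
        rw [hq0.iteratedDeriv_eq]
        simp
      · intro h
        exact absurd (Finset.mem_Icc.2 ⟨le_rfl, by omega⟩) h
  intro i t ht
  by_cases hi : n - 1 ≤ (i : ℕ)
  · exact hq t ht i hi
  · exact key (n + 1 - i) (by omega) i (by omega) t ht

/-- If the Wilczynski invariants vanish, projective pairs trivialize the equation. -/
theorem isLinearEquivalence_zero (hn : 1 ≤ n) {I : Set ℝ} (hp : ∀ i, ContDiffOn ℝ ∞ (p i) I)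
    (hW : ∀ k, 3 ≤ k → k ≤ n + 1 → IsWilczynskiInvariant n k p I fun _ => 0) (hJ : J ⊆ I)
    {v w : ℝ → ℝ} (h : IsProjectivePair (projCoeffA n p) (projCoeffB n p) J v w) :
    IsOpen ((fun x => w x / v x) '' J) ∧
    IsLinearEquivalence n p J (fun x => w x / v x) (fun x => (v x ^ n)⁻¹) 0 := by
  obtain ⟨q, hq, ho, hLF⟩ := exists_laguerreForsyth hn (fun i => (hp i).mono hJ) h
  have hq0 := hLF.eq_zero ho (by
    rintro k hk hk' _ ⟨x, hx, rfl⟩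
    have := hW k hk hk' J hJ _ _ q hq hLF x hx
    exact (mul_eq_zero.1 this.symm).resolve_left (pow_ne_zero _ (hq.deriv_lam_ne_zero x hx)))
  refine ⟨ho, { hq with solution_iff := fun g => ?_ }⟩
  rw [← hq.solution_iff g]
  refine and_congr_right fun _ => forall₂_congr fun t ht => ?_
  simp [hq0 _ t ht]

end LaguerreForsyth

/-! ### Binary forms -/

namespace BinaryForm

variable {n : ℕ}

/-- The exponent of the monomial `v₁ⁿ⁻ᵏ v₂ᵏ`. -/
def exponent (n : ℕ) (k : Fin (n + 1)) : Fin 2 →₀ ℕ :=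
  Finsupp.single 0 (n - k) + Finsupp.single 1 (k : ℕ)

theorem exponent_one (k : Fin (n + 1)) : exponent n k 1 = k := by
  simp [exponent]

theorem exponent_zero (k : Fin (n + 1)) : exponent n k 0 = n - k := by
  simp [exponent]

theorem exponent_injective : Function.Injective (exponent n) := fun k l h => by
  have := DFunLike.congr_fun h 1
  rw [exponent_one, exponent_one] at this
  exact Fin.ext this

theorem degree_exponent (k : Fin (n + 1)) : (exponent n k).degree = n := by
  rw [Finsupp.degree_eq_sum, Fin.sum_univ_two, exponent_zero, exponent_one]
  have := k.2
  omega

theorem exists_exponent_eq {d : Fin 2 →₀ ℕ} (hd : d.degree = n) : ∃ k, exponent n k = d := by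
  rw [Finsupp.degree_eq_sum, Fin.sum_univ_two] at hd
  refine ⟨⟨d 1, by omega⟩, Finsupp.ext fun i => ?_⟩
  fin_cases i
  · simp only [Fin.zero_eta, exponent_zero]
    omega
  · exact exponent_one _

/-- The coefficients of a binary form. -/
def coeffEquiv (n : ℕ) : BinaryForm n ≃ₗ[ℝ] (Fin (n + 1) → ℝ) where
  toFun P k := MvPolynomial.coeff (exponent n k) P.1
  map_add' P Q := by
    ext k
    simp
  map_smul' c P := by
    ext k
    simp
  invFun c := ⟨∑ k, MvPolynomial.monomial (exponent n k) (c k),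
    Submodule.sum_mem _ fun k _ =>
      MvPolynomial.isHomogeneous_monomial _ (degree_exponent k)⟩
  left_inv P := by
    refine Subtype.ext (MvPolynomial.ext _ _ fun d => ?_)
    simp only [MvPolynomial.coeff_sum, MvPolynomial.coeff_monomial]
    by_cases hd : d.degree = n
    · obtain ⟨k, rfl⟩ := exists_exponent_eq hd
      simp [exponent_injective.eq_iff]
    · have hP : MvPolynomial.coeff d P.1 = 0 := by
        have := MvPolynomial.IsHomogeneous.coeff_eq_zero
          ((MvPolynomial.mem_homogeneousSubmodule _ _).1 P.2) (d := d) hd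
        exact this
      rw [hP]
      refine Finset.sum_eq_zero fun k _ => if_neg ?_
      rintro rfl
      exact hd (degree_exponent k)
  right_inv c := by
    ext k
    simp [MvPolynomial.coeff_sum, MvPolynomial.coeff_monomial, exponent_injective.eq_iff]

theorem coeffEquiv_linearPower (l : Fin 2 → ℝ) (k : Fin (n + 1)) :
    coeffEquiv n (linearPower n l) k = n.choose k * l 0 ^ (n - k : ℕ) * l 1 ^ (k : ℕ) := by
  suffices h : linearPower n l = (coeffEquiv n).symm
      fun k => n.choose k * l 0 ^ (n - k : ℕ) * l 1 ^ (k : ℕ) by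
    rw [h, LinearEquiv.apply_symm_apply]
  refine Subtype.ext ?_
  change linearForm l ^ n = ∑ k, MvPolynomial.monomial (exponent n k) _
  rw [linearForm, Fin.sum_univ_two, add_comm, add_pow, Finset.sum_range]
  refine Finset.sum_congr rfl fun k _ => ?_
  rw [MvPolynomial.monomial_eq, exponent, Finsupp.prod_fintype _ _ fun i => pow_zero _,
    Fin.prod_univ_two]
  simp only [Finsupp.add_apply, Finsupp.single_apply, map_mul, map_pow, map_natCast]
  simp
  ring

theorem linearPower_smul (s : ℝ) (l : Fin 2 → ℝ) :
    linearPower n (s • l) = s ^ n • linearPower n l := by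
  refine (coeffEquiv n).injective (funext fun k => ?_)
  rw [map_smul, Pi.smul_apply, coeffEquiv_linearPower, coeffEquiv_linearPower]
  simp only [Pi.smul_apply, smul_eq_mul, mul_pow]
  rw [show s ^ n = s ^ (n - k : ℕ) * s ^ (k : ℕ) by
    rw [← pow_add, Nat.sub_add_cancel (Nat.lt_succ_iff.1 k.2)]]
  ring

theorem binaryFormRep_linearPower (g : GL (Fin 2) ℝ) (l : Fin 2 → ℝ) :
    binaryFormRep n g (linearPower n l) = linearPower n (g.1.mulVec l) := by
  refine Subtype.ext ?_
  change MvPolynomial.aeval (fun j => linearForm fun i => g.1 i j) (linearForm l ^ n) =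
    linearForm (g.1.mulVec l) ^ n
  rw [map_pow]
  congr 1
  simp only [linearForm, Fin.sum_univ_two, map_add, map_mul, MvPolynomial.aeval_X,
    MvPolynomial.algHom_C, MvPolynomial.algebraMap_eq, Matrix.mulVec, dotProduct]
  ring

/-! ### The rational normal curve as a polynomial curve, and its rigidity -/

/-- The polynomial `t ↦ f ((v₁ + t v₂)ⁿ)`. -/
def curvePoly (f : BinaryForm n →ₗ[ℝ] ℝ) : Polynomial ℝ :=
  ∑ k : Fin (n + 1), Polynomial.monomial k
    (n.choose k * f ((coeffEquiv n).symm (Pi.single k 1)))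

theorem map_eq_sum (f : BinaryForm n →ₗ[ℝ] ℝ) (P : BinaryForm n) :
    f P = ∑ k, coeffEquiv n P k * f ((coeffEquiv n).symm (Pi.single k 1)) := by
  conv_lhs => rw [← (coeffEquiv n).symm_apply_apply P, pi_eq_sum_univ' (coeffEquiv n P)]
  simp [map_sum, Pi.single]

theorem eval_curvePoly (f : BinaryForm n →ₗ[ℝ] ℝ) (t : ℝ) :
    (curvePoly f).eval t = f (linearPower n ![1, t]) := by
  rw [map_eq_sum, curvePoly, Polynomial.eval_finsetSum]
  refine Finset.sum_congr rfl fun k _ => ?_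
  rw [coeffEquiv_linearPower, Polynomial.eval_monomial]
  simp
  ring

theorem natDegree_curvePoly_le (f : BinaryForm n →ₗ[ℝ] ℝ) : (curvePoly f).natDegree ≤ n :=
  Polynomial.natDegree_sum_le_of_forall_le _ _ fun k _ =>
    (Polynomial.natDegree_monomial_le _).trans (Nat.lt_succ_iff.1 k.2)

/-- The coefficients are the values of the functional on the monomials times binomial coefficients,
which are nonzero. Thus the curve spans `Vₙ`. -/
theorem curvePoly_injective : Function.Injective (curvePoly (n := n)) := fun f g h => by
  refine LinearMap.ext fun P => ?_
  rw [map_eq_sum f, map_eq_sum g]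
  refine Finset.sum_congr rfl fun k _ => ?_
  congr 1
  have hc : ∀ f : BinaryForm n →ₗ[ℝ] ℝ, (curvePoly f).coeff k =
      n.choose k * f ((coeffEquiv n).symm (Pi.single k 1)) := fun f => by
    simp only [curvePoly, Polynomial.finsetSum_coeff, Polynomial.coeff_monomial, Fin.val_inj]
    simp
  have hk : (n.choose k : ℝ) ≠ 0 := by
    exact_mod_cast (Nat.choose_pos (Nat.lt_succ_iff.1 k.2)).ne'
  exact mul_left_cancel₀ hk ((hc f).symm.trans ((congrArg (·.coeff k) h).trans (hc g)))

/-- A linear map is determined by its values on `n`-th powers. -/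
theorem linearMap_ext {A B : BinaryForm n →ₗ[ℝ] BinaryForm n}
    (h : ∀ t, A (linearPower n ![1, t]) = B (linearPower n ![1, t])) : A = B := by
  refine LinearMap.ext fun P => (coeffEquiv n).injective (funext fun k => ?_)
  have : ∀ C : BinaryForm n →ₗ[ℝ] BinaryForm n,
      coeffEquiv n (C P) k = (LinearMap.proj k ∘ₗ (coeffEquiv n).toLinearMap ∘ₗ C) P := fun _ => rfl
  rw [this, this]
  refine LinearMap.congr_fun (curvePoly_injective (Polynomial.funext fun t => ?_)) P
  simp [eval_curvePoly, h]

/-- The coefficients of the curve `t ↦ A ((v₁ + t v₂)ⁿ)`, normalized by binomial coefficients. -/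
def coeffPoly (A : BinaryForm n →ₗ[ℝ] BinaryForm n) (k : Fin (n + 1)) : Polynomial ℝ :=
  curvePoly ((n.choose k : ℝ)⁻¹ • (LinearMap.proj k ∘ₗ (coeffEquiv n).toLinearMap ∘ₗ A))

theorem choose_ne_zero (k : Fin (n + 1)) : (n.choose k : ℝ) ≠ 0 := by
  exact_mod_cast (Nat.choose_pos (Nat.lt_succ_iff.1 k.2)).ne'

theorem coeffEquiv_eq_eval (A : BinaryForm n →ₗ[ℝ] BinaryForm n) (k : Fin (n + 1)) (t : ℝ) :
    coeffEquiv n (A (linearPower n ![1, t])) k = n.choose k * (coeffPoly A k).eval t := by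
  rw [coeffPoly, eval_curvePoly]
  simp [choose_ne_zero k]

theorem eval_coeffPoly {A : BinaryForm n →ₗ[ℝ] BinaryForm n} {t : ℝ} {m : Fin 2 → ℝ}
    (h : A (linearPower n ![1, t]) = linearPower n m) (k : Fin (n + 1)) :
    (coeffPoly A k).eval t = m 0 ^ (n - k : ℕ) * m 1 ^ (k : ℕ) := by
  refine mul_left_cancel₀ (choose_ne_zero k) ?_
  rw [← coeffEquiv_eq_eval, h, coeffEquiv_linearPower, mul_assoc]

theorem curvePoly_comp (A : BinaryForm n →ₗ[ℝ] BinaryForm n) (f : BinaryForm n →ₗ[ℝ] ℝ) :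
    curvePoly (f ∘ₗ A) = ∑ k : Fin (n + 1),
      Polynomial.C (n.choose k * f ((coeffEquiv n).symm (Pi.single k 1))) * coeffPoly A k := by
  refine Polynomial.funext fun t => ?_
  rw [eval_curvePoly, LinearMap.comp_apply, map_eq_sum, Polynomial.eval_finsetSum]
  refine Finset.sum_congr rfl fun k _ => ?_
  rw [coeffEquiv_eq_eval, Polynomial.eval_mul, Polynomial.eval_C]
  ring

theorem curvePoly_proj_zero :
    curvePoly (LinearMap.proj (0 : Fin (n + 1)) ∘ₗ (coeffEquiv n).toLinearMap) = 1 := by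
  refine Polynomial.funext fun t => ?_
  rw [eval_curvePoly]
  simp [coeffEquiv_linearPower]

/-- The coefficient polynomials of a surjective map are linearly independent. -/
theorem eq_zero_of_sum_coeffPoly {A : BinaryForm n →ₗ[ℝ] BinaryForm n}
    (hA : Function.Surjective A) {c : Fin (n + 1) → ℝ}
    (h : ∑ k, Polynomial.C (c k) * coeffPoly A k = 0) : c = 0 := by
  let f : BinaryForm n →ₗ[ℝ] ℝ :=
    ∑ k, (c k * (n.choose k : ℝ)⁻¹) • (LinearMap.proj k ∘ₗ (coeffEquiv n).toLinearMap)
  have hf : ∀ k, f ((coeffEquiv n).symm (Pi.single k 1)) = c k * (n.choose k : ℝ)⁻¹ := fun k => by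
    simp [f, Pi.single_apply]
  have h0 : f ∘ₗ A = 0 := by
    refine curvePoly_injective ?_
    rw [curvePoly_comp, show curvePoly (0 : BinaryForm n →ₗ[ℝ] ℝ) = 0 by simp [curvePoly], ← h]
    refine Finset.sum_congr rfl fun k _ => ?_
    rw [hf, mul_left_comm, mul_inv_cancel₀ (choose_ne_zero k), mul_one]
  have hf0 : f = 0 := LinearMap.ext fun P => by
    obtain ⟨Q, rfl⟩ := hA P
    exact LinearMap.congr_fun h0 Q
  funext k
  have := hf k
  rw [hf0, LinearMap.zero_apply] at this
  exact (mul_eq_zero.1 this.symm).resolve_right (inv_ne_zero (choose_ne_zero k))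

/-- If a linear automorphism maps infinitely many points of the cone over the rational normal
curve into the cone, its coefficient polynomials come from a pair of affine functions. -/
theorem exists_coeffPoly_eq (hn : 1 ≤ n) {A : BinaryForm n →ₗ[ℝ] BinaryForm n}
    (hA : Function.Surjective A) {S : Set ℝ} (hS : S.Infinite)
    (h : ∀ t ∈ S, ∃ m, A (linearPower n ![1, t]) = linearPower n m) :
    ∃ (c : ℝ) (p q : Polynomial ℝ), c ≠ 0 ∧ p.natDegree ≤ 1 ∧ q.natDegree ≤ 1 ∧ IsCoprime p q ∧
      ∀ k : Fin (n + 1), coeffPoly A k = Polynomial.C c * q ^ (n - k : ℕ) * p ^ (k : ℕ) := by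
  -- On the cone the normalized coordinates `m₀ⁿ⁻ᵏ m₁ᵏ` satisfy the determinantal relations; an
  -- identity of polynomials at infinitely many points holds identically.
  have hrel : ∀ k : ℕ, (hk : k < n) →
      coeffPoly A 0 * coeffPoly A ⟨k + 1, by omega⟩ =
        coeffPoly A ⟨1, by omega⟩ * coeffPoly A ⟨k, by omega⟩ := fun k hk => by
    refine Polynomial.eq_of_infinite_eval_eq _ _ (hS.mono fun t ht => ?_)
    obtain ⟨m, hm⟩ := h t ht
    simp only [Set.mem_ofPred_eq, Polynomial.eval_mul, eval_coeffPoly hm]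
    obtain ⟨r, rfl⟩ : ∃ r, n = k + 1 + r := ⟨n - (k + 1), by omega⟩
    rw [show k + 1 + r - (k + 1) = r by omega, show k + 1 + r - k = r + 1 by omega,
      show k + 1 + r - 1 = k + r by omega]
    simp
    ring
  have ha0 : coeffPoly A 0 ≠ 0 := fun h0 => by
    have := eq_zero_of_sum_coeffPoly hA (c := Pi.single 0 1) (by
      rw [Finset.sum_eq_single 0 (fun k _ hk => by simp [Pi.single_eq_of_ne hk]) (by simp), h0,
        mul_zero])
    simpa using congrFun this 0
  -- Division by the gcd: `p / q` is the quotient of the coefficient polynomials of index `1` and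
  -- `0` in lowest terms.
  obtain ⟨g, q, p, hpq, hq, hp⟩ : ∃ g q p : Polynomial ℝ, IsCoprime q p ∧
      coeffPoly A 0 = g * q ∧ coeffPoly A ⟨1, by omega⟩ = g * p := by
    obtain ⟨q, hq⟩ := EuclideanDomain.gcd_dvd_left (coeffPoly A 0) (coeffPoly A ⟨1, by omega⟩)
    obtain ⟨p, hp⟩ := EuclideanDomain.gcd_dvd_right (coeffPoly A 0) (coeffPoly A ⟨1, by omega⟩)
    have hab := EuclideanDomain.gcd_eq_gcd_ab (coeffPoly A 0) (coeffPoly A ⟨1, by omega⟩)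
    have hne : EuclideanDomain.gcd (coeffPoly A 0) (coeffPoly A ⟨1, by omega⟩) ≠ 0 := fun h0 =>
      ha0 (EuclideanDomain.gcd_eq_zero_iff.1 h0).1
    refine ⟨_, q, p, ⟨EuclideanDomain.gcdA (coeffPoly A 0) (coeffPoly A ⟨1, by omega⟩),
      EuclideanDomain.gcdB (coeffPoly A 0) (coeffPoly A ⟨1, by omega⟩),
      mul_left_cancel₀ hne ?_⟩, hq, hp⟩
    rw [mul_one]
    refine Eq.trans ?_ hab.symm
    rw [mul_add, mul_left_comm, ← hq, mul_left_comm, ← hp]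
    ring
  have hg : g ≠ 0 := fun hg => ha0 (by rw [hq, hg, zero_mul])
  have hstep : ∀ k : ℕ, (hk : k < n + 1) → q ^ k * coeffPoly A ⟨k, hk⟩ = p ^ k * coeffPoly A 0 := by
    intro k
    induction k with
    | zero => simp
    | succ k ih =>
      intro hk
      have h1 := hrel k (by omega)
      rw [hq, hp, mul_assoc, mul_assoc] at h1
      have h2 := mul_left_cancel₀ hg h1
      rw [pow_succ, mul_assoc, h2, mul_left_comm, ih, pow_succ]
      ring
  -- From `qⁿ aₙ = pⁿ a₀` and coprimality of `pⁿ` and `qⁿ`.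
  obtain ⟨c, hc⟩ : q ^ n ∣ coeffPoly A 0 :=
    (hpq.pow (m := n) (n := n)).dvd_of_dvd_mul_left ⟨_, (hstep n (by omega)).symm⟩
  have hq0 : q ≠ 0 := fun h0 => ha0 (by rw [hq, h0, mul_zero])
  have hak : ∀ k : Fin (n + 1), coeffPoly A k = c * q ^ (n - k : ℕ) * p ^ (k : ℕ) := fun k => by
    refine mul_left_cancel₀ (pow_ne_zero k hq0) ?_
    rw [hstep k k.2, hc, show q ^ n = q ^ (n - k : ℕ) * q ^ (k : ℕ) by
      rw [← pow_add, Nat.sub_add_cancel (Nat.lt_succ_iff.1 k.2)]]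
    ring
  -- The inverse of `A` writes the first coordinate of the standard curve, the polynomial `1`, as a
  -- combination of the coefficient polynomials, all divisible by `c`.
  have hcu : IsUnit c := by
    obtain ⟨B, hB⟩ := A.exists_rightInverse_of_surjective (LinearMap.range_eq_top.2 hA)
    have hB' : B ∘ₗ A = LinearMap.id := by
      have : Module.Finite ℝ (BinaryForm n) := Module.Finite.equiv (coeffEquiv n).symm
      exact (LinearMap.comp_eq_id_comm _ _).1 hB
    have h1 := curvePoly_comp A
      ((LinearMap.proj (0 : Fin (n + 1)) ∘ₗ (coeffEquiv n).toLinearMap) ∘ₗ B)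
    rw [LinearMap.comp_assoc, hB', LinearMap.comp_id, curvePoly_proj_zero] at h1
    refine isUnit_of_dvd_one (h1 ▸ Finset.dvd_sum fun k _ => Dvd.dvd.mul_left ?_ _)
    rw [hak, mul_assoc]
    exact dvd_mul_right _ _
  obtain ⟨r, hr, rfl⟩ := Polynomial.isUnit_iff.1 hcu
  have hr0 : r ≠ 0 := hr.ne_zero
  -- The coefficient polynomials have degree at most `n`; two of them are constant multiples of `qⁿ`
  -- and `pⁿ`.
  have hdeg : ∀ s : Polynomial ℝ, (∃ k, coeffPoly A k = Polynomial.C r * s ^ n) →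
      s.natDegree ≤ 1 := by
    rintro s ⟨k, hk⟩
    have h1 := natDegree_curvePoly_le
      ((n.choose k : ℝ)⁻¹ • (LinearMap.proj k ∘ₗ (coeffEquiv n).toLinearMap ∘ₗ A))
    rw [← coeffPoly, hk, Polynomial.natDegree_C_mul hr0, Polynomial.natDegree_pow] at h1
    exact Nat.le_of_mul_le_mul_left (by omega) hn
  exact ⟨r, p, q, hr0, hdeg p ⟨Fin.last n, by simpa using hak (Fin.last n)⟩,
    hdeg q ⟨0, by simpa using hak 0⟩, hpq.symm, hak⟩

/-- **Rigidity of the rational normal curve**: a linear automorphism that maps infinitely many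
points of the cone over the curve into the cone belongs to `ρₙ(GL(2, ℝ))`. -/
theorem exists_eq_binaryFormRep (hn : 1 ≤ n) {A : BinaryForm n →ₗ[ℝ] BinaryForm n}
    (hA : Function.Surjective A) {S : Set ℝ} (hS : S.Infinite)
    (h : ∀ t ∈ S, ∃ m, A (linearPower n ![1, t]) = linearPower n m) :
    ∃ g : GL (Fin 2) ℝ, ∀ P, A P = binaryFormRep n g P := by
  obtain ⟨c, p, q, hc, hp, hq, hpq, hk⟩ := exists_coeffPoly_eq hn hA hS h
  -- At a parameter in `S` both `c qⁿ` and `c pⁿ` are `n`-th powers, and `p`, `q` do not both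
  -- vanish. For even `n` this excludes negative `c`, and needs that values lie in the cone itself
  -- and not merely in its negative.
  obtain ⟨d, rfl⟩ : ∃ d, c = d ^ n := by
    obtain ⟨t, ht⟩ := hS.nonempty
    obtain ⟨m, hm⟩ := h t ht
    have h0 := eval_coeffPoly hm 0
    have h1 := eval_coeffPoly hm (Fin.last n)
    rw [hk] at h0 h1
    simp at h0 h1
    by_cases hp0 : p.eval t = 0
    · have hq0 : q.eval t ≠ 0 := fun hq0 => by
        obtain ⟨a, b, hab⟩ := hpq
        have := congrArg (Polynomial.eval t) hab
        simp [hp0, hq0] at this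
      exact ⟨m 0 / q.eval t, by rw [div_pow, ← h0, mul_div_cancel_right₀ _ (pow_ne_zero n hq0)]⟩
    · exact ⟨m 1 / p.eval t, by rw [div_pow, ← h1, mul_div_cancel_right₀ _ (pow_ne_zero n hp0)]⟩
  have hd : d ≠ 0 := fun h0 => hc (by rw [h0, zero_pow (by omega)])
  have heval : ∀ s : Polynomial ℝ, s.natDegree ≤ 1 → ∀ t, s.eval t = s.coeff 0 + s.coeff 1 * t :=
    fun s hs t => by
      conv_lhs => rw [Polynomial.eq_X_add_C_of_natDegree_le_one hs]
      simp
      ring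
  let M : Matrix (Fin 2) (Fin 2) ℝ :=
    !![d * q.coeff 0, d * q.coeff 1; d * p.coeff 0, d * p.coeff 1]
  have hM : ∀ t, M.mulVec ![1, t] = d • ![q.eval t, p.eval t] := fun t => by
    funext i
    fin_cases i <;> simp [M, Matrix.mulVec, dotProduct, heval p hp, heval q hq] <;> ring
  have hAt : ∀ t, A (linearPower n ![1, t]) = linearPower n (M.mulVec ![1, t]) := fun t => by
    refine (coeffEquiv n).injective (funext fun k => ?_)
    rw [coeffEquiv_eq_eval, hM, linearPower_smul, map_smul, Pi.smul_apply, coeffEquiv_linearPower,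
      hk]
    simp
    ring
  -- A singular matrix would give a linear relation between `q` and `p`. Multiplied by `qⁿ⁻¹` it
  -- becomes one between the coefficient polynomials of index `0` and `1`, which are independent.
  have hdet : M.det ≠ 0 := fun h0 => by
    obtain ⟨v, hv, hvM⟩ := Matrix.exists_vecMul_eq_zero_iff.2 h0
    have hrel : Polynomial.C (v 0) * q + Polynomial.C (v 1) * p = 0 := by
      refine Polynomial.funext fun t => ?_
      have h1 : v ⬝ᵥ M.mulVec ![1, t] = 0 := by
        rw [Matrix.dotProduct_mulVec, hvM, zero_dotProduct]
      rw [hM, dotProduct_smul, smul_eq_mul] at h1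
      simpa [dotProduct] using (mul_eq_zero.1 h1).resolve_left hd
    have h1v : ((1 : Fin (n + 1)) : ℕ) = 1 := Nat.mod_eq_of_lt (show 1 < n + 1 by omega)
    have h1 : (1 : Fin (n + 1)) ≠ 0 := fun h1 => by
      rw [h1] at h1v
      simp at h1v
    have := eq_zero_of_sum_coeffPoly hA (c := Pi.single 0 (v 0) + Pi.single 1 (v 1)) (by
      simp only [Pi.add_apply, map_add, add_mul, Finset.sum_add_distrib]
      rw [Finset.sum_eq_single 0 (fun k _ hk => by simp [Pi.single_eq_of_ne hk]) (by simp),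
        Finset.sum_eq_single 1 (fun k _ hk => by simp [Pi.single_eq_of_ne hk]) (by simp),
        Pi.single_eq_same, Pi.single_eq_same, hk, hk, h1v, Fin.val_zero, Nat.sub_zero,
        ← pow_sub_one_mul (show n ≠ 0 by omega) q]
      linear_combination Polynomial.C (d ^ n) * q ^ (n - 1) * hrel)
    refine hv (funext fun i => ?_)
    fin_cases i
    · simpa [Pi.single_eq_of_ne h1.symm] using congrFun this 0
    · simpa [Pi.single_eq_of_ne h1] using congrFun this 1
  refine ⟨Matrix.GeneralLinearGroup.mkOfDetNeZero M hdet, fun P => ?_⟩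
  refine LinearMap.congr_fun (linearMap_ext fun t => ?_) P
  rw [hAt, binaryFormRep_linearPower]
  rfl

end BinaryForm

/-! ### Substituting a pair of functions into binary forms -/

namespace BinaryForm

open scoped Topology

variable {n : ℕ}

/-- It is enough to check on `n`-th powers, where the action is that of the matrix on `ℝ²`. -/
theorem binaryFormRep_mul (g h : GL (Fin 2) ℝ) (P : BinaryForm n) :
    binaryFormRep n (g * h) P = binaryFormRep n g (binaryFormRep n h P) := by
  refine LinearMap.congr_fun (linearMap_ext (A := binaryFormRep n (g * h))
    (B := binaryFormRep n g ∘ₗ binaryFormRep n h) fun t => ?_) P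
  rw [LinearMap.comp_apply]
  simp only [binaryFormRep_linearPower, Matrix.mulVec_mulVec]
  rfl

theorem binaryFormRep_one (P : BinaryForm n) : binaryFormRep n 1 P = P := by
  refine LinearMap.congr_fun (linearMap_ext (A := binaryFormRep n 1)
    (B := LinearMap.id) fun t => ?_) P
  rw [binaryFormRep_linearPower]
  simp

/-- The function obtained by substituting `w` and `v` for the variables of a binary form. -/
def subst (v w : ℝ → ℝ) (P : BinaryForm n) (x : ℝ) : ℝ :=
  ∑ k : Fin (n + 1), coeffEquiv n P k * (w x ^ (n - k : ℕ) * v x ^ (k : ℕ))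

theorem subst_linearPower (v w : ℝ → ℝ) (l : Fin 2 → ℝ) (x : ℝ) :
    subst v w (linearPower n l) x = (l 0 * w x + l 1 * v x) ^ n := by
  rw [subst, add_comm (l 0 * w x), add_pow, Finset.sum_range]
  refine Finset.sum_congr rfl fun k _ => ?_
  rw [coeffEquiv_linearPower, mul_pow, mul_pow]
  ring

theorem contDiffOn_subst {v w : ℝ → ℝ} {J : Set ℝ} (hv : ContDiffOn ℝ ∞ v J)
    (hw : ContDiffOn ℝ ∞ w J) (P : BinaryForm n) : ContDiffOn ℝ ∞ (subst v w P) J :=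
  ContDiffOn.sum fun _ _ => contDiffOn_const.mul ((hw.pow _).mul (hv.pow _))

theorem subst_add (v w : ℝ → ℝ) (P Q : BinaryForm n) :
    subst v w (P + Q) = subst v w P + subst v w Q := by
  funext x
  simp [subst, add_mul, Finset.sum_add_distrib]

theorem subst_smul (v w : ℝ → ℝ) (c : ℝ) (P : BinaryForm n) :
    subst v w (c • P) = c • subst v w P := by
  funext x
  simp [subst, Finset.mul_sum, mul_assoc]

/-- The polynomial that gives the values of a binary form at `(t, 1)`. -/
def dehomogenize (P : BinaryForm n) : Polynomial ℝ :=
  ∑ k : Fin (n + 1), Polynomial.monomial (n - k) (coeffEquiv n P k)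

theorem eval_dehomogenize (P : BinaryForm n) (t : ℝ) :
    (dehomogenize P).eval t = ∑ k : Fin (n + 1), coeffEquiv n P k * t ^ (n - k : ℕ) := by
  simp [dehomogenize, Polynomial.eval_finsetSum]

theorem natDegree_dehomogenize_le (P : BinaryForm n) : (dehomogenize P).natDegree ≤ n :=
  Polynomial.natDegree_sum_le_of_forall_le _ _ fun _ _ =>
    (Polynomial.natDegree_monomial_le _).trans (Nat.sub_le _ _)

theorem eq_zero_of_dehomogenize {P : BinaryForm n} (h : dehomogenize P = 0) : P = 0 := by
  refine (coeffEquiv n).injective (funext fun k => ?_)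
  have h1 : (dehomogenize P).coeff (n - k) = coeffEquiv n P k := by
    simp only [dehomogenize, Polynomial.finsetSum_coeff, Polynomial.coeff_monomial]
    rw [Finset.sum_eq_single k]
    · simp
    · intro l _ hl
      refine if_neg fun h => hl (Fin.ext ?_)
      have := l.2
      have := k.2
      omega
    · simp
  rw [← h1, h]
  simp

/-- Homogeneity turns substitution into `vⁿ P(w / v, 1)`, the shape in which the transformation
carries solutions of `g⁽ⁿ⁺¹⁾ = 0`. -/
theorem subst_eq {v w : ℝ → ℝ} {x : ℝ} (hv : v x ≠ 0) (P : BinaryForm n) :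
    subst v w P x = (dehomogenize P).eval (w x / v x) / (v x ^ n)⁻¹ := by
  rw [eval_dehomogenize, div_inv_eq_mul, Finset.sum_mul, subst]
  refine Finset.sum_congr rfl fun k _ => ?_
  rw [div_pow, show v x ^ n = v x ^ (n - k : ℕ) * v x ^ (k : ℕ) by
    rw [← pow_add, Nat.sub_add_cancel (Nat.lt_succ_iff.1 k.2)]]
  have := pow_ne_zero (n - k : ℕ) hv
  field_simp

theorem iteratedDeriv_polynomial (P : Polynomial ℝ) (k : ℕ) :
    iteratedDeriv k (fun t => P.eval t) = fun t => (Polynomial.derivative^[k] P).eval t := by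
  induction k with
  | zero => simp
  | succ k ih =>
    rw [iteratedDeriv_succ, ih, Function.iterate_succ_apply']
    funext t
    exact Polynomial.deriv _

theorem isLinearSolution_dehomogenize (P : BinaryForm n) (J : Set ℝ) :
    IsLinearSolution n 0 J fun t => (dehomogenize P).eval t := by
  refine ⟨?_, fun t _ => ?_⟩
  · simpa using ((dehomogenize P).contDiff_aeval (𝕜 := ℝ) (n + 1 : ℕ)).contDiffOn (s := J)
  · rw [iteratedDeriv_polynomial, Polynomial.iterate_derivative_eq_zero
      (Nat.lt_succ_of_le (natDegree_dehomogenize_le P))]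
    simp

end BinaryForm

namespace IsProjectivePair

open BinaryForm

open scoped Topology

variable {n : ℕ} {a b v w : ℝ → ℝ} {J : Set ℝ}

theorem isLinearSolution_subst {p : Fin (n + 1) → ℝ → ℝ} (h : IsProjectivePair a b J v w)
    (hp : IsLinearEquivalence n p J (fun x => w x / v x) (fun x => (v x ^ n)⁻¹) 0)
    (P : BinaryForm n) : IsLinearSolution n p J (subst v w P) :=
  ((hp.solution_iff _).1 (isLinearSolution_dehomogenize P _)).congr h.isOpen
    fun x hx => subst_eq (h.pos_left x hx).ne' P

theorem infinite (h : IsProjectivePair a b J v w) (hJ : J.Nonempty) : J.Infinite := by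
  obtain ⟨x, hx⟩ := hJ
  exact infinite_of_mem_nhds x (h.isOpen.mem_nhds hx)

theorem eq_zero_of_subst (h : IsProjectivePair a b J v w) (hJ : J.Nonempty) {P : BinaryForm n}
    (hP : ∀ x ∈ J, subst v w P x = 0) : P = 0 := by
  refine eq_zero_of_dehomogenize (Polynomial.eq_zero_of_infinite_isRoot _
    (((h.infinite hJ).image h.strictMonoOn_div.injOn).mono ?_))
  rintro _ ⟨x, hx, rfl⟩
  have h1 := hP x hx
  rw [subst_eq (h.pos_left x hx).ne', div_eq_zero_iff] at h1
  exact h1.resolve_right (inv_ne_zero (pow_ne_zero n (h.pos_left x hx).ne'))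

end IsProjectivePair

/-! ### Jets of `n`-th powers at a zero of the base -/

section PowerJet

open scoped Topology

/-- The jet of a power of a function at a zero of the function. -/
theorem iteratedDeriv_pow_of_eq_zero {f : ℝ → ℝ} {x : ℝ} (hf : ContDiffAt ℝ ∞ f x)
    (h0 : f x = 0) (n : ℕ) : ∀ i ≤ n, iteratedDeriv i (fun t => f t ^ n) x =
      if i = n then n ! * deriv f x ^ n else 0 := by
  induction n with
  | zero =>
    intro i hi
    obtain rfl : i = 0 := by omega
    simp
  | succ n ih =>
    intro i hi
    have h1 : (fun t => f t ^ (n + 1)) = f * fun t => f t ^ n := by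
      funext t
      simp [pow_succ']
    rw [h1, iteratedDeriv_mul (hf.of_le (by exact_mod_cast le_top))
      ((hf.pow n).of_le (by exact_mod_cast le_top))]
    rcases i with _ | i
    · simp [h0]
    · rw [Finset.sum_range_succ', Finset.sum_range_succ']
      -- In Leibniz's rule for `f * fⁿ` the undifferentiated `f` vanishes, and terms with at least
      -- two derivatives on `f` leave fewer than `n` on `fⁿ`. One term survives.
      rw [Finset.sum_eq_zero]
      · simp only [iteratedDeriv_zero, h0, Nat.sub_zero, zero_add, iteratedDeriv_one]
        rw [show i + 1 - 1 = i by omega, ih i (by omega)]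
        by_cases hin : i = n
        · subst hin
          simp [Nat.factorial_succ]
          ring
        · simp [hin]
      · intro j hj
        rw [Finset.mem_range] at hj
        rw [ih _ (by omega), if_neg (by omega), mul_zero]

theorem jet_pow_of_eq_zero {f : ℝ → ℝ} {x : ℝ} (hf : ContDiffAt ℝ ∞ f x) (h0 : f x = 0) (n : ℕ) :
    jet n (fun t => f t ^ n) x = (n ! * deriv f x ^ n) • Pi.single (Fin.last n) 1 := by
  funext i
  rw [jet, iteratedDeriv_pow_of_eq_zero hf h0 n i (Nat.lt_succ_iff.1 i.2), Pi.smul_apply]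
  by_cases hi : i = Fin.last n
  · subst hi
    simp
  · have : (i : ℕ) ≠ n := fun h => hi (Fin.ext h)
    simp [this, Pi.single_eq_of_ne hi]

end PowerJet

namespace IsProjectivePair

open BinaryForm

variable {n : ℕ} {a b v w : ℝ → ℝ} {J : Set ℝ}

/-- The linear form `v(x) v₁ - w(x) v₂` becomes `v(x) w - w(x) v`, which vanishes at `x` with the
Wronskian as derivative. Thus points of the rational normal curve correspond to solutions vanishing
to order `n`. -/
theorem jet_subst_linearPower (h : IsProjectivePair a b J v w) {x : ℝ} (hx : x ∈ J) :
    jet n (subst v w (linearPower n ![v x, -w x])) x =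
      (n ! * (v x * deriv w x - w x * deriv v x) ^ n) • Pi.single (Fin.last n) 1 := by
  have h1 : subst v w (linearPower n ![v x, -w x]) = fun t => (v x * w t + -w x * v t) ^ n := by
    funext t
    simp [subst_linearPower]
  have h2 : HasDerivAt (fun t => v x * w t + -w x * v t)
      (v x * deriv w x + -w x * deriv v x) x :=
    ((h.hasDerivAt_right hx).const_mul _).add ((h.hasDerivAt_left hx).const_mul _)
  have h3 : ContDiffAt ℝ ∞ (fun t => v x * w t + -w x * v t) x :=
    (contDiffAt_const.mul (h.contDiffOn_right.contDiffAt (h.isOpen.mem_nhds hx))).add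
      (contDiffAt_const.mul (h.contDiffOn_left.contDiffAt (h.isOpen.mem_nhds hx)))
  rw [h1, jet_pow_of_eq_zero h3 (by ring), h2.deriv]
  congr 3
  ring

/-- The jets of the functions obtained by substituting the pair into binary forms. -/
def substJet (h : IsProjectivePair a b J v w) (n : ℕ) {x : ℝ} (hx : x ∈ J) :
    BinaryForm n →ₗ[ℝ] (Fin (n + 1) → ℝ) where
  toFun P := jet n (subst v w P) x
  map_add' P Q := by
    rw [subst_add]
    exact jet_add h.isOpen
      ((contDiffOn_subst h.contDiffOn_left h.contDiffOn_right P).of_le (by exact_mod_cast le_top))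
      ((contDiffOn_subst h.contDiffOn_left h.contDiffOn_right Q).of_le (by exact_mod_cast le_top)) hx
  map_smul' c P := by
    rw [subst_smul]
    exact jet_smul c _ x

/-- A zero jet gives the zero solution on `J`, so the dehomogenized form vanishes at the infinitely
many values of `w / v`. Surjectivity follows by dimension. -/
theorem bijective_substJet {p : Fin (n + 1) → ℝ → ℝ} (h : IsProjectivePair a b J v w)
    (hp : ∀ i, ContDiffOn ℝ ∞ (p i) J)
    (he : IsLinearEquivalence n p J (fun x => w x / v x) (fun x => (v x ^ n)⁻¹) 0)
    {x : ℝ} (hx : x ∈ J) : Function.Bijective (h.substJet n hx) := by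
  have hinj : Function.Injective (h.substJet n hx) := by
    rw [injective_iff_map_eq_zero]
    intro P hP
    refine h.eq_zero_of_subst ⟨x, hx⟩ fun t ht => ?_
    have h0 := (h.isLinearSolution_subst he 0).eqOn h.isOpen h.isPreconnected hp
      (h.isLinearSolution_subst he P) hx ((map_zero (h.substJet n hx)).trans hP.symm) ht
    rw [← h0]
    simp [subst]
  have hfr : Function.Injective ((h.substJet n hx).comp (coeffEquiv n).symm.toLinearMap) :=
    hinj.comp (coeffEquiv n).symm.injective
  refine ⟨hinj, fun u => ?_⟩
  obtain ⟨c, hc⟩ := LinearMap.surjective_of_injective hfr u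
  exact ⟨_, hc⟩

end IsProjectivePair

/-! ### Frames adapted to the solutions that vanish to maximal order -/

namespace ODE

open BinaryForm

open scoped Topology

variable {n : ℕ} {E : ODE n}

/-- A frame is adapted at a point of the equation manifold if the solutions of the linearization
that vanish to maximal order there correspond to `n`-th powers. -/
def IsAdapted (u : BinaryForm n ≃ₗ[ℝ] EuclideanSpace ℝ (Fin (n + 1))) (a : E.domain) : Prop :=
  ∃ l, projDerivEquiv a (Pi.single (Fin.last n) 1) = u (linearPower n l)

theorem IsAdapted.of_rep {u u' : BinaryForm n ≃ₗ[ℝ] EuclideanSpace ℝ (Fin (n + 1))}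
    {a : E.domain} {g : GL (Fin 2) ℝ} (h : ∀ P, u P = u' (binaryFormRep n g P))
    (hu : IsAdapted u a) : IsAdapted u' a := by
  obtain ⟨l, hl⟩ := hu
  exact ⟨_, by rw [hl, h, binaryFormRep_linearPower]⟩

theorem eq_rep_inv {V : Type*} {u u' : BinaryForm n → V} {g : GL (Fin 2) ℝ}
    (h : ∀ P, u P = u' (binaryFormRep n g P)) (P : BinaryForm n) :
    u' P = u (binaryFormRep n g⁻¹ P) := by
  rw [h, ← binaryFormRep_mul, mul_inv_cancel, binaryFormRep_one]

/-- The restriction of a solution to a smaller interval. -/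
def Solution.restrict (y : E.Solution) {J : Set ℝ} (hJ : J ⊆ y.interval) (ho : IsOpen J)
    (hc : IsPreconnected J) (hne : J.Nonempty) : E.Solution where
  interval := J
  toFun := y.toFun
  isOpen := ho
  nonempty := hne
  isPreconnected := hc
  contDiffOn := y.contDiffOn.mono hJ
  jet_mem x hx := y.jet_mem x (hJ hx)
  eq_rhs x hx := y.eq_rhs x (hJ hx)

variable (E) in
/-- The generalized Wilczynski invariants of the equation vanish. -/
def IsWilczynskiFlat : Prop :=
  ∀ k, 3 ≤ k → k ≤ n + 1 → E.IsGeneralizedWilczynskiInvariant k 0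

/-- A projective pair for the linearization along `y`. -/
abbrev Solution.IsPair (y : E.Solution) (J : Set ℝ) (v w : ℝ → ℝ) : Prop :=
  IsProjectivePair (projCoeffA n y.linearization) (projCoeffB n y.linearization) J v w

theorem Solution.exists_isPair (y : E.Solution) {x : ℝ} (hx : x ∈ y.interval) :
    ∃ J ⊆ y.interval, x ∈ J ∧ ∃ v w : ℝ → ℝ, y.IsPair J v w ∧ v x = 1 ∧ deriv v x = 0 ∧
      w x = 0 ∧ deriv w x = 1 :=
  exists_isProjectivePair y.isOpen (contDiffOn_projCoeffA y.contDiffOn_linearization)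
    (contDiffOn_projCoeffB y.isOpen y.contDiffOn_linearization) hx

theorem Solution.IsPair.isLinearEquivalence (hn : 1 ≤ n) (hE : E.IsWilczynskiFlat)
    {y : E.Solution} {J : Set ℝ} {v w : ℝ → ℝ} (h : y.IsPair J v w) (hJ : J ⊆ y.interval) :
    IsLinearEquivalence n y.linearization J (fun x => w x / v x) (fun x => (v x ^ n)⁻¹) 0 :=
  (isLinearEquivalence_zero hn y.contDiffOn_linearization (fun k h3 hk => hE k h3 hk y) hJ h).2

theorem Solution.isTrivializable (hn : 1 ≤ n) (hE : E.IsWilczynskiFlat) (y : E.Solution) :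
    IsTrivializable n y.linearization y.interval := fun x hx => by
  obtain ⟨J, hJ, hxJ, v, w, h, -⟩ := y.exists_isPair hx
  exact ⟨J, hJ, hxJ, _, _, h.isLinearEquivalence hn hE hJ⟩

/-- The frame given by a projective pair. -/
theorem Solution.IsPair.exists_frame (hn : 1 ≤ n) (hE : E.IsWilczynskiFlat)
    {y : E.Solution} {J : Set ℝ} {v w : ℝ → ℝ} (h : y.IsPair J v w) (hJ : J ⊆ y.interval)
    (hne : J.Nonempty) :
    ∃ u : BinaryForm n ≃ₗ[ℝ] EuclideanSpace ℝ (Fin (n + 1)), ∀ x (hx : x ∈ J) P,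
      u P = projDerivEquiv (y.lift ⟨x, hJ hx⟩) (jet n (subst v w P) x) := by
  have he := h.isLinearEquivalence hn hE hJ
  obtain ⟨x₀, hx₀⟩ := hne
  refine ⟨(LinearEquiv.ofBijective _ (h.bijective_substJet
    (fun i => (y.contDiffOn_linearization i).mono hJ) he hx₀)).trans
      (projDerivEquiv (y.lift ⟨x₀, hJ hx₀⟩)), fun x hx P => ?_⟩
  -- The functions `subst v w P` solve the linearization on `J` only, so the solution is restricted
  -- to `J` before jets are compared.
  exact (y.restrict hJ h.isOpen h.isPreconnected ⟨x₀, hx₀⟩).projDerivEquiv_jet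
    (h.isLinearSolution_subst he P) ⟨x₀, hx₀⟩ ⟨x, hx⟩

section PairFrame

variable {y : E.Solution} {J : Set ℝ} {v w : ℝ → ℝ} {hJ : J ⊆ y.interval}
  {u : BinaryForm n ≃ₗ[ℝ] EuclideanSpace ℝ (Fin (n + 1))}

theorem Solution.IsPair.apply_linearPower (h : y.IsPair J v w)
    (hu : ∀ x (hx : x ∈ J) P,
      u P = projDerivEquiv (y.lift ⟨x, hJ hx⟩) (jet n (subst v w P) x))
    {x : ℝ} (hx : x ∈ J) : u (linearPower n ![v x, -w x]) =
      (n ! * (v x * deriv w x - w x * deriv v x) ^ n) •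
        projDerivEquiv (y.lift ⟨x, hJ hx⟩) (Pi.single (Fin.last n) 1) := by
  rw [hu x hx, h.jet_subst_linearPower hx, map_smul]

/-- The cone of `n`-th powers absorbs nonnegative factors by real `n`-th roots. For even `n` this
fails for negative ones, so the signs of the Wronskian and of `h⁽ⁿ⁾` matter. -/
theorem exists_pow_smul_linearPower (hn : 1 ≤ n) {c : ℝ} (hc : 0 ≤ c) (l : Fin 2 → ℝ) :
    ∃ l', c • linearPower n l = linearPower n l' := by
  refine ⟨(c ^ (n : ℝ)⁻¹) • l, ?_⟩
  rw [linearPower_smul, Real.rpow_inv_natCast_pow hc (by omega)]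

/-- The solution with jet `(0, …, 0, 1)` at `x` is a positive multiple of `(v(x) w - w(x) v)ⁿ`,
because the Wronskian is positive. -/
theorem Solution.IsPair.isAdapted (hn : 1 ≤ n) (h : y.IsPair J v w)
    (hu : ∀ x (hx : x ∈ J) P,
      u P = projDerivEquiv (y.lift ⟨x, hJ hx⟩) (jet n (subst v w P) x))
    {x : ℝ} (hx : x ∈ J) : IsAdapted u (y.lift ⟨x, hJ hx⟩) := by
  have hW : 0 < n ! * (v x * deriv w x - w x * deriv v x) ^ n :=
    mul_pos (by exact_mod_cast n.factorial_pos) (pow_pos (h.wronskian_pos x hx) n)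
  obtain ⟨l, hl⟩ := exists_pow_smul_linearPower hn (inv_nonneg.2 hW.le) ![v x, -w x]
  refine ⟨l, ?_⟩
  rw [← hl, map_smul, h.apply_linearPower hu hx, smul_smul, inv_mul_cancel₀ hW.ne', one_smul]

/-- A frame that is adapted at infinitely many points is equivalent to the frame given by a
projective pair. -/
theorem Solution.IsPair.exists_eq_rep (hn : 1 ≤ n) (h : y.IsPair J v w)
    (hu : ∀ x (hx : x ∈ J) P,
      u P = projDerivEquiv (y.lift ⟨x, hJ hx⟩) (jet n (subst v w P) x))
    {u' : BinaryForm n ≃ₗ[ℝ] EuclideanSpace ℝ (Fin (n + 1))} {K : Set ℝ} (hK : K.Infinite)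
    (hu' : ∀ x ∈ K, ∃ hx : x ∈ J, IsAdapted u' (y.lift ⟨x, hJ hx⟩)) :
    ∃ g, ∀ P, u P = u' (binaryFormRep n g P) := by
  have hKJ : K ⊆ J := fun x hx => (hu' x hx).1
  -- The point of the curve for `x` is `(v(x), -w(x))`, with affine parameter `-w/v`; strict
  -- monotonicity keeps the parameters distinct, so rigidity applies.
  have hS : ((fun x => -(w x / v x)) '' K).Infinite :=
    hK.image fun x hx x' hx' hxx' =>
      h.strictMonoOn_div.injOn (hKJ hx) (hKJ hx') (neg_injective hxx')
  obtain ⟨g, hg⟩ := exists_eq_binaryFormRep hn (A := (u.trans u'.symm).toLinearMap)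
    (u.trans u'.symm).surjective hS <| by
      rintro _ ⟨x, hx, rfl⟩
      obtain ⟨hxJ, l, hl⟩ := hu' x hx
      have hv := h.pos_left x hxJ
      have h1 : (![1, -(w x / v x)] : Fin 2 → ℝ) = (v x)⁻¹ • ![v x, -w x] := by
        funext i
        fin_cases i
        · simp [hv.ne']
        · simp
          ring
      have hW : 0 ≤ n ! * (v x * deriv w x - w x * deriv v x) ^ n :=
        (mul_pos (by exact_mod_cast n.factorial_pos) (pow_pos (h.wronskian_pos x hxJ) n)).le
      obtain ⟨m, hm⟩ := exists_pow_smul_linearPower hn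
        (mul_nonneg (pow_nonneg (inv_nonneg.2 hv.le) n) hW) l
      refine ⟨m, u'.injective ?_⟩
      rw [← hm, h1, linearPower_smul, map_smul]
      simp only [LinearEquiv.coe_coe, LinearEquiv.trans_apply, map_smul,
        LinearEquiv.apply_symm_apply]
      rw [h.apply_linearPower hu hxJ, hl, smul_smul]
  exact ⟨g, fun P => by rw [← hg P]; simp⟩

end PairFrame

/-- A frame that is adapted at infinitely many nearby points is adapted along the solution. -/
theorem Solution.isAdapted_of_eventually (hn : 1 ≤ n) (hE : E.IsWilczynskiFlat) (y : E.Solution)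
    {u : BinaryForm n ≃ₗ[ℝ] EuclideanSpace ℝ (Fin (n + 1))} {x₀ : ℝ} (hx₀ : x₀ ∈ y.interval)
    (hu : ∀ᶠ x in 𝓝 x₀, ∃ hx : x ∈ y.interval, IsAdapted u (y.lift ⟨x, hx⟩)) (x : y.interval) :
    IsAdapted u (y.lift x) := by
  set U : Set ℝ := {t | ∀ᶠ x in 𝓝 t, ∃ hx : x ∈ y.interval, IsAdapted u (y.lift ⟨x, hx⟩)}
    with hU
  have hUo : IsOpen U := isOpen_setOfPred_eventually_nhds
  have hsub : y.interval ⊆ U := by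
    refine y.isPreconnected.subset_of_closure_inter_subset hUo ⟨x₀, hx₀, hu⟩ ?_
    rintro t ⟨ht, htI⟩
    -- The set `U` is relatively closed: a pair on an interval `J` around a limit point meets `U`,
    -- rigidity on the overlap compares `u` with the frame of the pair, and adaptedness extends to
    -- all of `J`.
    obtain ⟨J, hJ, htJ, v, w, h, -⟩ := y.exists_isPair htI
    obtain ⟨s, hsJ, hsU⟩ := mem_closure_iff.1 ht J h.isOpen htJ
    obtain ⟨u₀, hu₀⟩ := h.exists_frame hn hE hJ ⟨t, htJ⟩
    have hev := hsU.and (h.isOpen.eventually_mem hsJ)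
    obtain ⟨g, hg⟩ := h.exists_eq_rep hn hu₀ (u' := u) (infinite_of_mem_nhds s hev)
      fun x hx => ⟨hx.2, hx.1.2⟩
    filter_upwards [h.isOpen.mem_nhds htJ] with x hx
    exact ⟨hJ hx, (h.isAdapted hn hu₀ hx).of_rep hg⟩
  obtain ⟨hx, h⟩ := (hsub x.2).self_of_nhds
  exact h

/-- The frames at a point of the solution space that are adapted along the leaf. -/
def adaptedFrames (s : E.SolutionSpace) :
    Set (BinaryForm n ≃ₗ[ℝ] EuclideanSpace ℝ (Fin (n + 1))) :=
  {u | ∀ a : E.domain, E.proj a = s → IsAdapted u a}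

theorem exists_solution (a : E.domain) : ∃ (y : E.Solution) (x : y.interval), y.lift x = a := by
  obtain ⟨y, x, -, h, -⟩ := (sameSolution_iff a a).2 (reaches_self a.2)
  exact ⟨y, x, h⟩

/-- A point of the leaf may lie beyond the interval of `y`. Some solution joins it to the given
point and agrees with `y` nearby, so adaptedness propagates along that solution. -/
theorem Solution.mem_adaptedFrames_of_eventually (hn : 1 ≤ n) (hE : E.IsWilczynskiFlat)
    (y : E.Solution) {u : BinaryForm n ≃ₗ[ℝ] EuclideanSpace ℝ (Fin (n + 1))} {x₀ : ℝ}
    (hx₀ : x₀ ∈ y.interval)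
    (hu : ∀ᶠ x in 𝓝 x₀, ∃ hx : x ∈ y.interval, IsAdapted u (y.lift ⟨x, hx⟩)) :
    u ∈ adaptedFrames (E.proj (y.lift ⟨x₀, hx₀⟩)) := by
  intro a ha
  obtain ⟨z, x, x', hx, rfl⟩ := (sameSolution_iff _ _).2 (proj_eq_proj_iff.1 ha.symm)
  have hxx : (x : ℝ) = x₀ := congrArg (fun a : E.domain => a.1.1) hx
  have hz₀ : x₀ ∈ z.interval := hxx ▸ x.2
  refine z.isAdapted_of_eventually hn hE hz₀ ?_ x'
  have hjet : jet n z.toFun x₀ = jet n y.toFun x₀ := by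
    have := congrArg (fun a : E.domain => a.1.2) hx
    simpa [Solution.lift, hxx] using this
  have heq : jet n z.toFun =ᶠ[𝓝 x₀] jet n y.toFun :=
    IsCurve.eventuallyEq (z.isOpen.inter y.isOpen) (z.isCurve.mono Set.inter_subset_left)
      (y.isCurve.mono Set.inter_subset_right) ⟨hz₀, hx₀⟩ hjet
  filter_upwards [hu, heq, z.isOpen.mem_nhds hz₀] with t ⟨ht, hta⟩ hjt htz
  refine ⟨htz, ?_⟩
  have : z.lift ⟨t, htz⟩ = y.lift ⟨t, ht⟩ := Subtype.ext (Prod.ext rfl hjt)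
  rwa [this]

/-- The adapted frames form one orbit. -/
theorem mem_adaptedFrames_iff (hn : 1 ≤ n) (hE : E.IsWilczynskiFlat) {s : E.SolutionSpace}
    {u u' : BinaryForm n ≃ₗ[ℝ] EuclideanSpace ℝ (Fin (n + 1))} (hu : u ∈ adaptedFrames s) :
    u' ∈ adaptedFrames s ↔ ∃ g : GL (Fin 2) ℝ, ∀ P, u' P = u (binaryFormRep n g P) := by
  constructor
  · intro hu'
    obtain ⟨a, rfl⟩ := proj_surjective s
    obtain ⟨y, x, rfl⟩ := exists_solution a
    obtain ⟨J, hJ, hxJ, v, w, h, -⟩ := y.exists_isPair x.2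
    obtain ⟨u₀, hu₀⟩ := h.exists_frame hn hE hJ ⟨x, hxJ⟩
    -- Every adapted frame is compared with the frame of one pair, so any two differ by an element
    -- of the group.
    have key : ∀ u ∈ adaptedFrames (E.proj (y.lift x)),
        ∃ g : GL (Fin 2) ℝ, ∀ P, u₀ P = u (binaryFormRep n g P) := fun u hu =>
      h.exists_eq_rep hn hu₀ (h.infinite ⟨x, hxJ⟩) fun t ht =>
        ⟨ht, hu _ ((y.proj_lift _).trans (y.proj_lift _).symm)⟩
    obtain ⟨g, hg⟩ := key u hu
    obtain ⟨g', hg'⟩ := key u' hu'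
    refine ⟨g * g'⁻¹, fun P => ?_⟩
    rw [binaryFormRep_mul, ← hg, eq_rep_inv (u := u₀) (u' := u') hg']
  · rintro ⟨g, hg⟩ a ha
    exact (hu a ha).of_rep fun P => eq_rep_inv (u := u') (u' := u) hg P

/-- Adapted frames, in terms of solutions of the linearization. -/
theorem Solution.mem_adaptedFrames_iff (hn : 1 ≤ n) (hE : E.IsWilczynskiFlat) (y : E.Solution)
    (u : BinaryForm n ≃ₗ[ℝ] EuclideanSpace ℝ (Fin (n + 1))) :
    u ∈ adaptedFrames y.point ↔ ∀ x ∈ y.interval, ∀ h : y.linearSolutions,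
      (∀ i < n, iteratedDeriv i (h : ℝ → ℝ) x = 0) → 0 < iteratedDeriv n (h : ℝ → ℝ) x →
        ∃ l : Fin 2 → ℝ, y.tangentEquiv h = u (linearPower n l) := by
  constructor
  · intro hu x hx h h0 hpos
    obtain ⟨l, hl⟩ := hu (y.lift ⟨x, hx⟩) (y.proj_lift _)
    obtain ⟨m, hm⟩ := exists_pow_smul_linearPower hn hpos.le l
    refine ⟨m, (y.tangentEquiv_apply h ⟨x, hx⟩).trans ?_⟩
    rw [← hm, map_smul, ← hl, ← map_smul]
    congr 1
    funext i
    refine Fin.lastCases ?_ (fun i => ?_) i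
    · simp [jet]
    · simp [jet, h0 i i.2]
  · intro hu
    obtain ⟨x₀, hx₀⟩ := y.nonempty
    rw [← y.proj_lift ⟨x₀, hx₀⟩]
    -- The condition on solutions speaks only of the interval of `y`, while adaptedness is required
    -- along the whole leaf; the gap is closed by propagation. At each point it is tested on the
    -- solution with jet `(0, …, 0, 1)`.
    refine y.mem_adaptedFrames_of_eventually hn hE hx₀ ?_
    filter_upwards [y.isOpen.mem_nhds hx₀] with x hx
    obtain ⟨h, hh⟩ := (y.jetEquiv ⟨x, hx⟩).surjective (Pi.single (Fin.last n) 1)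
    rw [Solution.jetEquiv_apply] at hh
    obtain ⟨l, hl⟩ := hu x hx h (fun i hi => by
        have := congrFun hh (Fin.castSucc ⟨i, hi⟩)
        rwa [Pi.single_eq_of_ne (Fin.castSucc_lt_last _).ne] at this) (by
        have := congrFun hh (Fin.last n)
        simp only [jet, Fin.val_last, Pi.single_eq_same] at this
        rw [this]
        exact one_pos)
    refine ⟨hx, l, ?_⟩
    rw [← hl, y.tangentEquiv_apply h ⟨x, hx⟩, hh]

end ODE

/-! ### Derivatives along a vector field -/

section LieDeriv

open scoped Topology

variable {F : Type*} [NormedAddCommGroup F] [NormedSpace ℝ F]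

/-- The derivative of a function along a vector field. -/
def derivAlong (X : F → F) (G : F → ℝ) (z : F) : ℝ := fderiv ℝ G z (X z)

variable {X : F → F} {G : F → ℝ} {Ω : Set F}

theorem contDiffOn_derivAlong (hΩ : IsOpen Ω) (hX : ContDiffOn ℝ ∞ X Ω)
    (hG : ContDiffOn ℝ ∞ G Ω) : ContDiffOn ℝ ∞ (derivAlong X G) Ω :=
  ((contDiffOn_infty_iff_fderiv_of_isOpen hΩ).1 hG).2.clm_apply hX

theorem contDiffOn_iterate_derivAlong (hΩ : IsOpen Ω) (hX : ContDiffOn ℝ ∞ X Ω)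
    (hG : ContDiffOn ℝ ∞ G Ω) (k : ℕ) : ContDiffOn ℝ ∞ ((derivAlong X)^[k] G) Ω := by
  induction k with
  | zero => exact hG
  | succ k ih =>
    rw [Function.iterate_succ_apply']
    exact contDiffOn_derivAlong hΩ hX ih

theorem hasDerivAt_comp_curve (hΩ : IsOpen Ω) (hG : ContDiffOn ℝ ∞ G Ω) {c : ℝ → F} {x : ℝ}
    (hx : c x ∈ Ω) (hc : HasDerivAt c (X (c x)) x) :
    HasDerivAt (fun x => G (c x)) (derivAlong X G (c x)) x :=
  HasFDerivAt.comp_hasDerivAt (l := G) x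
    ((hG.contDiffAt (hΩ.mem_nhds hx)).differentiableAt (by simp)).hasFDerivAt hc

/-- Derivatives along integral curves become functions of the point alone, so smoothness in the
point needs no solution of a differential equation. -/
theorem iteratedDeriv_comp_curve (hΩ : IsOpen Ω) (hX : ContDiffOn ℝ ∞ X Ω)
    (hG : ContDiffOn ℝ ∞ G Ω) {c : ℝ → F} {J : Set ℝ} (hJ : IsOpen J) (hcΩ : ∀ x ∈ J, c x ∈ Ω)
    (hc : ∀ x ∈ J, HasDerivAt c (X (c x)) x) (k : ℕ) : ∀ x ∈ J,
      iteratedDeriv k (fun x => G (c x)) x = (derivAlong X)^[k] G (c x) := by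
  induction k with
  | zero => simp
  | succ k ih =>
    intro x hx
    have h1 : iteratedDeriv k (fun x => G (c x)) =ᶠ[𝓝 x] fun x => (derivAlong X)^[k] G (c x) :=
      Filter.eventually_of_mem (hJ.mem_nhds hx) ih
    rw [iteratedDeriv_succ, h1.deriv_eq, Function.iterate_succ_apply']
    exact (hasDerivAt_comp_curve hΩ (contDiffOn_iterate_derivAlong hΩ hX hG k) (hcΩ x hx)
      (hc x hx)).deriv

end LieDeriv

/-! ### Smoothness of the adapted frames -/

namespace ODE

open BinaryForm

open scoped Topology

variable {n : ℕ} (E : ODE n)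

/-- The vector field on the equation manifold tangent to the lifts of the solutions. -/
def totalField (z : ℝ × (Fin (n + 1) → ℝ)) : ℝ × (Fin (n + 1) → ℝ) := (1, E.field z)

/-- The coefficient `projCoeffA` of the linearizations, as a function on the equation manifold. -/
def jetCoeffA (z : ℝ × (Fin (n + 1) → ℝ)) : ℝ :=
  2 * E.linCoeff (Fin.last n) z / (n * (n + 1))

/-- The coefficient `projCoeffB` of the linearizations, as a function on the equation manifold. -/
def jetCoeffB (z : ℝ × (Fin (n + 1) → ℝ)) : ℝ :=
  (E.linCoeff ⟨n - 1, by omega⟩ z -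
    (n + 1) * n * (n - 1) / 6 * derivAlong E.totalField E.jetCoeffA z -
    (n + 1) * n * (n - 1) * (3 * n + 2) / 24 * E.jetCoeffA z ^ 2) / (n * (n + 1) * (n + 2) / 6)

theorem contDiffOn_totalField : ContDiffOn ℝ ∞ E.totalField E.domain :=
  contDiffOn_const.prodMk E.contDiffOn_field

theorem contDiffOn_jetCoeffA : ContDiffOn ℝ ∞ E.jetCoeffA E.domain :=
  (contDiffOn_const.mul (E.contDiffOn_linCoeff _)).div_const _

theorem contDiffOn_jetCoeffB : ContDiffOn ℝ ∞ E.jetCoeffB E.domain :=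
  (((E.contDiffOn_linCoeff _).sub (contDiffOn_const.mul
    (contDiffOn_derivAlong E.domain.isOpen E.contDiffOn_totalField E.contDiffOn_jetCoeffA))).sub
    (contDiffOn_const.mul (E.contDiffOn_jetCoeffA.pow 2))).div_const _

theorem Solution.hasDerivAt_lift {E : ODE n} (y : E.Solution) {x : ℝ} (hx : x ∈ y.interval) :
    HasDerivAt (fun x => (x, jet n y.toFun x)) (E.totalField (x, jet n y.toFun x)) x :=
  (hasDerivAt_id x).prodMk (y.isCurve x hx).2

theorem Solution.projCoeffA_linearization {E : ODE n} (y : E.Solution) (x : ℝ) :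
    projCoeffA n y.linearization x = E.jetCoeffA (x, jet n y.toFun x) := rfl

/-- The derivative of the coefficient `a` along a solution is its total derivative, so `b` also
comes from a smooth function on the equation manifold. -/
theorem Solution.projCoeffB_linearization {E : ODE n} (y : E.Solution) {x : ℝ}
    (hx : x ∈ y.interval) :
    projCoeffB n y.linearization x = E.jetCoeffB (x, jet n y.toFun x) := by
  have h := hasDerivAt_comp_curve (c := fun x => (x, jet n y.toFun x)) E.domain.isOpen
    E.contDiffOn_jetCoeffA (y.jet_mem x hx) (y.hasDerivAt_lift hx)
  rw [projCoeffB, jetCoeffB, ← h.deriv]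
  rfl

/-! ### The equation together with its projective pairs as one vector field -/

/-- The space of points of the equation manifold together with the `1`-jets of a pair of
functions. -/
abbrev PairSpace (n : ℕ) : Type := (ℝ × (Fin (n + 1) → ℝ)) × (ℝ × ℝ) × (ℝ × ℝ)

/-- The vector field whose integral curves are formed by the solutions of the equation and the
projective pairs along them. -/
def pairField (q : PairSpace n) : PairSpace n :=
  (E.totalField q.1,
    (q.2.1.2, -E.jetCoeffA q.1 * q.2.1.2 - E.jetCoeffB q.1 * q.2.1.1),
    (q.2.2.2, -E.jetCoeffA q.1 * q.2.2.2 - E.jetCoeffB q.1 * q.2.2.1))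

/-- The domain of `pairField`. -/
def pairDomain : Set (PairSpace n) := Prod.fst ⁻¹' (E.domain : Set (ℝ × (Fin (n + 1) → ℝ)))

theorem isOpen_pairDomain : IsOpen E.pairDomain := E.domain.isOpen.preimage continuous_fst

theorem contDiffOn_pairField : ContDiffOn ℝ ∞ E.pairField E.pairDomain := by
  have hfst : ContDiffOn ℝ ∞ (Prod.fst : PairSpace n → _) E.pairDomain := contDiffOn_fst
  have hX : ContDiffOn ℝ ∞ (fun q : PairSpace n => E.totalField q.1) E.pairDomain :=
    E.contDiffOn_totalField.comp hfst fun _ h => h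
  have hA : ContDiffOn ℝ ∞ (fun q : PairSpace n => E.jetCoeffA q.1) E.pairDomain :=
    E.contDiffOn_jetCoeffA.comp hfst fun _ h => h
  have hB : ContDiffOn ℝ ∞ (fun q : PairSpace n => E.jetCoeffB q.1) E.pairDomain :=
    E.contDiffOn_jetCoeffB.comp hfst fun _ h => h
  unfold pairField
  fun_prop

theorem Solution.IsPair.hasDerivAt_pairField {E : ODE n} {y : E.Solution} {J : Set ℝ}
    {v w : ℝ → ℝ} (h : y.IsPair J v w) (hJ : J ⊆ y.interval) {x : ℝ} (hx : x ∈ J) :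
    HasDerivAt (fun x => (((x, jet n y.toFun x), (v x, deriv v x), (w x, deriv w x)) : PairSpace n))
      (E.pairField ((x, jet n y.toFun x), (v x, deriv v x), (w x, deriv w x))) x := by
  have h1 := h.deriv_deriv_left x hx
  have h2 := h.deriv_deriv_right x hx
  rw [y.projCoeffA_linearization, y.projCoeffB_linearization (hJ hx)] at h1 h2
  exact (y.hasDerivAt_lift (hJ hx)).prodMk
    (((h.hasDerivAt_left hx).prodMk h1).prodMk ((h.hasDerivAt_right hx).prodMk h2))

/-- The value of a binary form at a pair of functions. -/
def substValue (P : BinaryForm n) (q : PairSpace n) : ℝ :=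
  ∑ k : Fin (n + 1), coeffEquiv n P k * (q.2.2.1 ^ (n - k : ℕ) * q.2.1.1 ^ (k : ℕ))

theorem contDiff_substValue (P : BinaryForm n) : ContDiff ℝ ∞ (substValue P) := by
  unfold substValue
  fun_prop

/-- The jet at a point of the equation manifold of the solution of the linearization that is
obtained by substituting the normalized projective pair into a binary form. -/
def frameJet (P : BinaryForm n) (z : ℝ × (Fin (n + 1) → ℝ)) : Fin (n + 1) → ℝ :=
  fun i => (derivAlong E.pairField)^[i] (substValue P) (z, (1, 0), (0, 1))

theorem contDiffOn_frameJet (P : BinaryForm n) : ContDiffOn ℝ ∞ (E.frameJet P) E.domain := by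
  refine contDiffOn_pi.2 fun i => ?_
  refine (contDiffOn_iterate_derivAlong E.isOpen_pairDomain E.contDiffOn_pairField
    (contDiff_substValue P).contDiffOn i).comp ?_ fun z hz => hz
  exact (contDiff_id.prodMk contDiff_const).contDiffOn

variable {E}

/-- The frame of the pair with `v = 1, v' = 0, w = 0, w' = 1` at the point. Its values there are
given by `frameJet`, which is smooth although the pairs themselves are chosen separately for each
solution. -/
theorem exists_mem_adaptedFrames (hn : 1 ≤ n) (hE : E.IsWilczynskiFlat) (a : E.domain) :
    ∃ u ∈ adaptedFrames (E.proj a), ∀ P, u P = projDerivEquiv a (E.frameJet P a.1) := by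
  obtain ⟨y, x, rfl⟩ := exists_solution a
  obtain ⟨J, hJ, hxJ, v, w, h, h1, h2, h3, h4⟩ := y.exists_isPair x.2
  obtain ⟨u, hu⟩ := h.exists_frame hn hE hJ ⟨x, hxJ⟩
  refine ⟨u, y.mem_adaptedFrames_of_eventually hn hE x.2 ?_, fun P => ?_⟩
  · filter_upwards [h.isOpen.mem_nhds hxJ] with t ht
    exact ⟨hJ ht, h.isAdapted hn hu ht⟩
  · rw [hu x hxJ]
    congr 1
    funext i
    have := iteratedDeriv_comp_curve E.isOpen_pairDomain E.contDiffOn_pairField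
      (contDiff_substValue P).contDiffOn h.isOpen (fun t ht => y.jet_mem t (hJ ht))
      (fun t ht => h.hasDerivAt_pairField hJ ht) i x hxJ
    rw [h1, h2, h3, h4] at this
    exact this

/-- The inverse chart is the projection along a slice; read in the chart at the image point, it is
the flow from one slice to another. Its derivative is the map in `projDerivEquiv`. -/
theorem hasMFDerivAt_sliceChart_symm {s₀ : E.SolutionSpace}
    {z : EuclideanSpace ℝ (Fin (n + 1))} (hz : (s₀.base, euclid n z) ∈ E.domain) :
    HasMFDerivAt 𝓘(ℝ, EuclideanSpace ℝ (Fin (n + 1))) 𝓘(ℝ, EuclideanSpace ℝ (Fin (n + 1)))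
      (sliceChart s₀).symm z
      (((euclid n).symm : (Fin (n + 1) → ℝ) →L[ℝ] EuclideanSpace ℝ (Fin (n + 1))).comp
        ((E.flowDeriv (s₀.base, euclid n z) ((sliceChart s₀).symm z).base).comp
          ((euclid n) : EuclideanSpace ℝ (Fin (n + 1)) →L[ℝ] (Fin (n + 1) → ℝ)))) := by
  have hzt : z ∈ (sliceChart s₀).target := hz
  refine ⟨(sliceChart s₀).continuousAt_symm hzt, ?_⟩
  set x := ((sliceChart s₀).symm z).base with hx
  have hm : ((s₀.base, euclid n z), x) ∈ E.flowDomain := by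
    have := mem_flowDomain_base (E := E) ⟨(s₀.base, euclid n z), hz⟩
    rwa [← sliceChart_symm hz] at this
  have h1 : HasFDerivAt (fun z => (euclid n).symm (E.flow ((s₀.base, euclid n z), x)))
      (((euclid n).symm : (Fin (n + 1) → ℝ) →L[ℝ] EuclideanSpace ℝ (Fin (n + 1))).comp
        ((E.flowDeriv (s₀.base, euclid n z) x).comp
          ((euclid n) : EuclideanSpace ℝ (Fin (n + 1)) →L[ℝ] (Fin (n + 1) → ℝ)))) z :=
    (euclid n).symm.hasFDerivAt.comp z
      (HasFDerivAt.comp z (hasFDerivAt_flow_vertical hm) (euclid n).hasFDerivAt)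
  refine (h1.congr_of_eventuallyEq ?_).hasFDerivWithinAt
  filter_upwards [(euclid n).continuous.continuousAt.eventually
    (eventually_flowDomain_vertical hm)] with t ht
  change sliceChart ((sliceChart s₀).symm z) ((sliceChart s₀).symm t) = _
  rw [sliceChart_symm (reaches_flow ht).left_mem]
  exact sliceChart_proj ht

open Classical in
/-- A representative of a point of the solution space, on a slice of the equation manifold if
possible. -/
def sliceRep (s₀ s : E.SolutionSpace) : E.domain :=
  if h : s ∈ (sliceChart s₀).source then
    ⟨(s₀.base, euclid n (sliceChart s₀ s)), (sliceChart s₀).map_source h⟩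
  -- Off the chart any representative will do; this one makes `proj_sliceRep` hold everywhere.
  else Quot.out s

theorem proj_sliceRep (s₀ s : E.SolutionSpace) : E.proj (sliceRep s₀ s) = s := by
  rw [sliceRep]
  split_ifs with h
  · exact (sliceChart_symm ((sliceChart s₀).map_source h)).symm.trans ((sliceChart s₀).left_inv h)
  · exact Quot.out_eq s

/-- The section is the image, under the tangent map of the inverse chart, of a smooth vector field
on the target of the chart. -/
theorem contMDiffOn_projDerivEquiv_sliceRep (s₀ : E.SolutionSpace)
    {V : ℝ × (Fin (n + 1) → ℝ) → Fin (n + 1) → ℝ} (hV : ContDiffOn ℝ ∞ V E.domain) :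
    ContMDiffOn 𝓘(ℝ, EuclideanSpace ℝ (Fin (n + 1)))
      (𝓘(ℝ, EuclideanSpace ℝ (Fin (n + 1)))).tangent ∞
      (fun s => (⟨s, projDerivEquiv (sliceRep s₀ s) (V (sliceRep s₀ s).1)⟩ :
        TangentBundle 𝓘(ℝ, EuclideanSpace ℝ (Fin (n + 1))) E.SolutionSpace))
      (sliceChart s₀).source := by
  have h1 : ContDiffOn ℝ ∞ (fun z : EuclideanSpace ℝ (Fin (n + 1)) =>
      (euclid n).symm (V (s₀.base, euclid n z))) (sliceChart s₀).target :=
    (euclid n).symm.contDiff.comp_contDiffOn (hV.comp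
      (contDiff_const.prodMk (euclid n).contDiff).contDiffOn fun z hz => hz)
  have h2 := contMDiffOn_vectorSpace_iff_contDiffOn.2 h1
  have h3 : ContMDiffOn 𝓘(ℝ, EuclideanSpace ℝ (Fin (n + 1)))
      𝓘(ℝ, EuclideanSpace ℝ (Fin (n + 1))) ∞ (sliceChart s₀) (sliceChart s₀).source :=
    contMDiffOn_chart (x := s₀)
  have h4 : ContMDiffOn 𝓘(ℝ, EuclideanSpace ℝ (Fin (n + 1)))
      𝓘(ℝ, EuclideanSpace ℝ (Fin (n + 1))) ∞ (sliceChart s₀).symm (sliceChart s₀).target :=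
    contMDiffOn_chart_symm (x := s₀)
  have h5 := h4.contMDiffOn_tangentMapWithin (m := ∞) (by simp)
    (sliceChart s₀).open_target.uniqueMDiffOn
  have h6 := h5.comp (h2.comp h3 (sliceChart s₀).mapsTo) fun s hs =>
    (sliceChart s₀).map_source hs
  refine h6.congr fun s hs => ?_
  have ht : (s₀.base, euclid n (sliceChart s₀ s)) ∈ E.domain := (sliceChart s₀).map_source hs
  have hrep : sliceRep s₀ s = ⟨(s₀.base, euclid n (sliceChart s₀ s)), ht⟩ := dif_pos hs
  refine tangentMk_congr ((sliceChart s₀).left_inv hs).symm ?_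
  have hd := (mfderivWithin_of_isOpen (I := 𝓘(ℝ, EuclideanSpace ℝ (Fin (n + 1))))
    (I' := 𝓘(ℝ, EuclideanSpace ℝ (Fin (n + 1)))) (f := (sliceChart s₀).symm)
    (sliceChart s₀).open_target ht).trans (hasMFDerivAt_sliceChart_symm ht).mfderiv
  rw [hrep, projDerivEquiv_apply, ← sliceChart_symm ht]
  exact (DFunLike.congr_fun hd _).symm

/-- The `GL(2, ℝ)`-structure formed by the adapted frames. -/
def gl2Structure (hn : 1 ≤ n) (hE : E.IsWilczynskiFlat) : GL2Structure n E.SolutionSpace where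
  frames s := adaptedFrames s
  orbit s u hu u' := mem_adaptedFrames_iff hn hE hu
  exists_section s₀ := by
    -- The pointwise choice does no harm: the formula `hu'` determines the frame at each point and
    -- is smooth along the slice.
    choose u hu hu' using exists_mem_adaptedFrames hn hE
    refine ⟨(sliceChart s₀).source, (sliceChart s₀).open_source, mem_sliceChart_source s₀,
      fun s => u (sliceRep s₀ s), fun s _ => ?_, fun P => ?_⟩
    · have := hu (sliceRep s₀ s)
      rwa [proj_sliceRep] at this
    · refine (contMDiffOn_projDerivEquiv_sliceRep s₀ (E.contDiffOn_frameJet P)).congr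
        fun s _ => tangentMk_congr rfl ?_
      exact hu' _ P

end ODE

end

theorem theorem5 (n : ℕ) (hn : 2 ≤ n) (E : ODE n)
    (hW : ∀ k, 3 ≤ k → k ≤ n + 1 → E.IsGeneralizedWilczynskiInvariant k 0)
    (hS : T2Space E.SolutionSpace) :
    SecondCountableTopology E.SolutionSpace ∧
    ∃ (_ : ChartedSpace (EuclideanSpace ℝ (Fin (n + 1))) E.SolutionSpace)
      (_ : IsManifold 𝓘(ℝ, EuclideanSpace ℝ (Fin (n + 1))) ∞ E.SolutionSpace),
      -- the projection of the equation manifold to the solution space is a smooth submersion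
      ContMDiff 𝓘(ℝ, ℝ × (Fin (n + 1) → ℝ)) 𝓘(ℝ, EuclideanSpace ℝ (Fin (n + 1))) ∞ E.proj ∧
      (∀ a : E.domain, Function.Surjective
        (mfderiv 𝓘(ℝ, ℝ × (Fin (n + 1) → ℝ)) 𝓘(ℝ, EuclideanSpace ℝ (Fin (n + 1))) E.proj a)) ∧
      -- linearizations are trivializable
      (∀ y : E.Solution, IsTrivializable n y.linearization y.interval) ∧
      -- the tangent space at `y` is the solution space of the linearization along `y`
      ∃ Θ : (y : E.Solution) → (y.linearSolutions ≃ₗ[ℝ]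
          TangentSpace 𝓘(ℝ, EuclideanSpace ℝ (Fin (n + 1))) y.point),
        (∀ (y : E.Solution) (h : y.linearSolutions) (x : y.interval),
          tangentMap 𝓘(ℝ, ℝ × (Fin (n + 1) → ℝ)) 𝓘(ℝ, EuclideanSpace ℝ (Fin (n + 1))) E.proj
            ⟨y.lift x, ((0, jet n (h : ℝ → ℝ) x) : ℝ × (Fin (n + 1) → ℝ))⟩ =
              ⟨y.point, Θ y h⟩) ∧
        -- the structure: its frames are the isomorphisms with `Vₙ` that take the cone of `n`-th
        -- powers to the cone containing the solutions vanishing to order `n` at some point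
        ∃ P : GL2Structure n E.SolutionSpace,
          ∀ (y : E.Solution) (u : BinaryForm n ≃ₗ[ℝ]
              TangentSpace 𝓘(ℝ, EuclideanSpace ℝ (Fin (n + 1))) y.point),
            u ∈ P.frames y.point ↔
              ∀ x ∈ y.interval, ∀ h : y.linearSolutions,
                (∀ i < n, iteratedDeriv i (h : ℝ → ℝ) x = 0) →
                0 < iteratedDeriv n (h : ℝ → ℝ) x →
                ∃ l : Fin 2 → ℝ, Θ y h = u (linearPower n l) := by
  have hn' : 1 ≤ n := by omega
  exact ⟨ODE.secondCountableTopology_solutionSpace, ODE.chartedSpaceSolutionSpace,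
    ODE.isManifold_solutionSpace, ODE.contMDiff_proj, ODE.mfderiv_proj_surjective,
    ODE.Solution.isTrivializable hn' hW, ODE.Solution.tangentEquiv, ODE.Solution.tangentMap_proj,
    ODE.gl2Structure hn' hW, fun y u => y.mem_adaptedFrames_iff hn' hW u⟩
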